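/- For an integer $k\ge 2$ and a finite alphabet $\Sigma$, the $k$-LCS problem over $\Sigma$ is: given $k$ strings of length $n$ over $\Sigma$, compute the length of a longest sequence that is a subsequence of all $k$ strings. The Strong Exponential Time Hypothesis (SETH) asserts that for every $\varepsilon>0$ there is an integer $q>3$ such that $q$-SAT (satisfiability of CNF formulas with at most $q$ literals per clause) on $n$ variables and $m$ clauses cannot be solved in $O(2^{(1-\varepsilon)n})\cdot\mathrm{poly}(n+m)$ time. Algorithms are deterministic random access machine programs with logarithmic cost, where every elementary step is charged the lengths of the binary expansions of the numbers and memory addresses that it handles. **Theorem.** There is an absolute constant $c$ such that the following holds. If there are an integer $k\ge 2$, a constant $\varepsilon>0$ and an algorithm that solves $k$-LCS on strings of length $n\ge 1$ over an alphabet of size $c\cdot k$ in $O(n^{k-\varepsilon})$ time (where the constant in the $O$ may depend on $k$, $\varepsilon$ and the algorithm), then SETH is false. -/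

import Mathlib

/-! ### Random access machines with logarithmic cost -/

namespace RAM

/-- Arithmetic operations on natural numbers: addition, truncated subtraction, multiplication
and rounded-down division (with `x / 0 = 0`). -/
inductive ArithOp where
  | plus
  | monus
  | times
  | quot

/-- The function computed by an arithmetic operation. -/
def ArithOp.apply : ArithOp → ℕ → ℕ → ℕ
  | .plus, x, y => x + y
  | .monus, x, y => x - y
  | .times, x, y => x * y
  | .quot, x, y => x / y

/-- Programs of the random access machine, in structured form. The numbers `r`, `a`, `b` are names
of registers; a program mentions only finitely many registers. The memory is an infinite array
that is accessed by indirect addressing through a register. -/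
inductive Prog where
  /-- `r := c` -/
  | const (r c : ℕ)
  /-- `r := a ∘ b` -/
  | arith (o : ArithOp) (r a b : ℕ)
  /-- `r := mem[a]` -/
  | load (r a : ℕ)
  /-- `mem[a] := b` -/
  | store (a b : ℕ)
  /-- first `p`, then `q` -/
  | seq (p q : Prog)
  /-- if `r ≠ 0` then `p`, else `q` -/
  | cond (r : ℕ) (p q : Prog)
  /-- as long as `r ≠ 0`, execute `p` -/
  | loop (r : ℕ) (p : Prog)

/-- A state of the machine: contents of the registers and of the memory cells. -/
structure State where
  reg : ℕ → ℕ
  mem : ℕ → ℕ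

/-- Write `v` to register `r`. -/
def State.setReg (s : State) (r v : ℕ) : State :=
  { s with reg := Function.update s.reg r v }

/-- Write `v` to the memory cell with address `a`. -/
def State.setMem (s : State) (a v : ℕ) : State :=
  { s with mem := Function.update s.mem a v }

/-- The initial state: the input words are in memory cells `0, 1, 2, …`; all other cells and all
registers are zero. -/
def State.start (input : List ℕ) : State where
  reg := fun _ => 0
  mem := fun i => input.getD i 0

/-- The logarithmic cost of handling the number `x`: one plus the length of its binary expansion. -/
def wordCost (x : ℕ) : ℕ := Nat.size x + 1

/-- `Exec P s t s'`: started in state `s`, the program `P` halts in state `s'`, and the execution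
takes time `t`. Each elementary step is charged the cost of the operands that it handles,
addresses included. -/
inductive Exec : Prog → State → ℕ → State → Prop
  | const (r c : ℕ) (s : State) :
      Exec (.const r c) s (wordCost c) (s.setReg r c)
  | arith (o : ArithOp) (r a b : ℕ) (s : State) :
      Exec (.arith o r a b) s (wordCost (s.reg a) + wordCost (s.reg b))
        (s.setReg r (o.apply (s.reg a) (s.reg b)))
  | load (r a : ℕ) (s : State) :
      Exec (.load r a) s (wordCost (s.reg a) + wordCost (s.mem (s.reg a)))
        (s.setReg r (s.mem (s.reg a)))
  | store (a b : ℕ) (s : State) :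
      Exec (.store a b) s (wordCost (s.reg a) + wordCost (s.reg b))
        (s.setMem (s.reg a) (s.reg b))
  | seq {p q : Prog} {s s₁ s₂ : State} {t₁ t₂ : ℕ}
      (h₁ : Exec p s t₁ s₁) (h₂ : Exec q s₁ t₂ s₂) :
      Exec (.seq p q) s (t₁ + t₂) s₂
  | condTrue {r : ℕ} {p q : Prog} {s s₁ : State} {t : ℕ}
      (hr : s.reg r ≠ 0) (h : Exec p s t s₁) :
      Exec (.cond r p q) s (wordCost (s.reg r) + t) s₁
  | condFalse {r : ℕ} {p q : Prog} {s s₁ : State} {t : ℕ}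
      (hr : s.reg r = 0) (h : Exec q s t s₁) :
      Exec (.cond r p q) s (wordCost (s.reg r) + t) s₁
  | loopStop {r : ℕ} {p : Prog} {s : State}
      (hr : s.reg r = 0) :
      Exec (.loop r p) s (wordCost (s.reg r)) s
  | loopStep {r : ℕ} {p : Prog} {s s₁ s₂ : State} {t₁ t₂ : ℕ}
      (hr : s.reg r ≠ 0) (h₁ : Exec p s t₁ s₁) (h₂ : Exec (.loop r p) s₁ t₂ s₂) :
      Exec (.loop r p) s (wordCost (s.reg r) + t₁ + t₂) s₂

/-- On the given input the program `P` halts after time `t`, with output `out` in register `0`. -/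
def HaltsWith (P : Prog) (input : List ℕ) (out t : ℕ) : Prop :=
  ∃ s : State, Exec P (State.start input) t s ∧ s.reg 0 = out

end RAM

/-! ### The longest common subsequence of `k` strings -/

namespace KLCS

/-- `m` is the length of a longest common subsequence of the `k` strings `x 0, …, x (k - 1)`. -/
def IsLCSLength {k n : ℕ} {α : Type*} (x : Fin k → Fin n → α) (m : ℕ) : Prop :=
  IsGreatest {l : ℕ | ∃ z : List α, z.length = l ∧ ∀ i, z.Sublist (List.ofFn (x i))} m

/-- The input words for `k` strings of length `n`: the number `n`, then the symbols of the strings,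
one string after the other. -/
def encode {k n σ : ℕ} (x : Fin k → Fin n → Fin σ) : List ℕ :=
  n :: (List.ofFn fun i => List.ofFn fun j => (x i j : ℕ)).flatten

/-- For the fixed number `k` of strings and the fixed alphabet size `σ`, some algorithm solves
`k`-LCS on strings of length `n` in time `O(n ^ e)`. -/
def SolvableInTime (k σ : ℕ) (e : ℝ) : Prop :=
  ∃ (P : RAM.Prog) (C : ℝ), ∀ n : ℕ, 1 ≤ n → ∀ x : Fin k → Fin n → Fin σ,
    ∃ out t : ℕ, RAM.HaltsWith P (encode x) out t ∧ IsLCSLength x out ∧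
      (t : ℝ) ≤ C * (n : ℝ) ^ e

end KLCS

/-! ### Satisfiability and the Strong Exponential Time Hypothesis -/

namespace SAT

/-- A literal on `n` variables: the variable `v` for `(v, true)`, its negation for `(v, false)`. -/
abbrev Literal (n : ℕ) := Fin n × Bool

/-- A clause: the disjunction of a list of literals. -/
abbrev Clause (n : ℕ) := List (Literal n)

/-- A CNF formula: the conjunction of a list of clauses. -/
abbrev CNF (n : ℕ) := List (Clause n)

/-- Some assignment of truth values makes a literal of every clause true. -/
def Satisfiable {n : ℕ} (F : CNF n) : Prop :=
  ∃ a : Fin n → Bool, ∀ c ∈ F, ∃ l ∈ c, a l.1 = l.2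

/-- Every clause has at most `q` literals. -/
def HasWidth {n : ℕ} (q : ℕ) (F : CNF n) : Prop :=
  ∀ c ∈ F, c.length ≤ q

/-- A literal as an input word. -/
def encodeLiteral {n : ℕ} (l : Literal n) : ℕ := 2 * (l.1 : ℕ) + l.2.toNat

/-- A clause as input words: the number of its literals, then the literals. -/
def encodeClause {n : ℕ} (c : Clause n) : List ℕ := c.length :: c.map encodeLiteral

/-- The input words for a formula: the number of variables, the number of clauses, and then the
clauses. -/
def encode {n : ℕ} (F : CNF n) : List ℕ :=
  n :: F.length :: F.flatMap encodeClause

open Classical in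
/-- Some algorithm decides `q`-SAT on `n` variables and `m` clauses in time
`O(2 ^ (e * n)) * poly(n + m)`. (Repeated clauses are allowed, so that `m` is not bounded in terms
of `n` and reading the input may alone take time linear in `m`. For formulas without repeated
clauses `m` is polynomial in `n`.) -/
noncomputable def SolvableInTime (q : ℕ) (e : ℝ) : Prop :=
  ∃ (P : RAM.Prog) (C : ℝ) (d : ℕ), ∀ (n : ℕ) (F : CNF n), HasWidth q F →
    ∃ t : ℕ, RAM.HaltsWith P (encode F) (if Satisfiable F then 1 else 0) t ∧
      (t : ℝ) ≤ C * (2 : ℝ) ^ (e * (n : ℝ)) * ((n : ℝ) + (F.length : ℝ) + 1) ^ d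

/-- The Strong Exponential Time Hypothesis: for every `ε > 0` there is an integer `q > 3` such that
`q`-SAT on `n` variables cannot be solved in time `2 ^ ((1 - ε) * n)`. -/
def SETH : Prop :=
  ∀ ε : ℝ, 0 < ε → ∃ q : ℕ, 3 < q ∧ ¬ SolvableInTime q (1 - ε)

end SAT

/-!
# A fast algorithm for `k`-LCS refutes SETH

The theorem holds with `c = 5`. The proof is a reduction from `q`-SAT. The `n` variables of a
formula with `m` clauses are split into `k` groups of at most `s = ⌈n / k⌉` variables, so that each
group has `N = 2 ^ s` assignments. String `i` lists gadgets for all assignments of group `i`, and its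
length is `2 ^ (n / k)` up to a factor that is polynomial in `m` (for fixed `k`); hence time
`O(L ^ (k - ε))` on strings of length `L` is `2 ^ ((1 - ε / k) * n) * poly(n + m)`. As this
polynomial factor is allowed, it is not necessary to bound the number of clauses first.

*Gadgets.* A clause gadget is a list of `k` letters, ascending in string `0` and descending in the
other strings, so that two letters never fit together. String `i` has the `i`-th letter only if its
assignment satisfies the clause: there is a common letter if and only if one of the `k` assignments
satisfies the clause. Clause gadgets are separated by so many copies of a letter that skipping one
of these separators does not pay. So the gadgets of `k` assignments have a common subsequence of
length `e + 1` if together they satisfy the formula, and otherwise none; and a second alternative,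
the repetition of one letter, always provides length `e` (`satisfied_of_common_clausesGadget`,
`exists_common_clausesGadget`).

*Strings.* The gadgets of every tuple of assignments have to be alignable. String `i` contains the
whole list of gadgets `i + 1` times, with a separator before each gadget. Let the separating letters
be `0, …, 2 * k - 2`, with the weight of `x` proportional to `min (x + 1) (2 * k - 1 - x)`, which is
the number of strings that have `x` in their separators: those of string `i` are the letters
`k - 1 + i, …, k - 1 - i` in descending order, while in string `0` all separating letters, including
those at the ends of the string, are in ascending order.

* To align given gadgets, string `i` has to skip some of its `(i + 1) * N` gadgets in front of the
  aligned run of `N` gadgets, and the others behind it. With the letters `k - 1 - j` and `k - 1 + j`,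
  `1 ≤ j < k`, the strings `j, j + 1, …` skip gadgets simultaneously, while the strings before `j`
  have sufficiently many of these letters at their ends. No separator is wasted
  (`exists_common_text`).
* Conversely, as the orders are opposite, every separator contributes only one kind of letter to a
  common subsequence. Counting each letter with the inverse of its weight and summing over all
  strings bounds the number of separating letters. If the letters that a gadget of string `0`
  contributes lie in more than one gadget of another string, then a separator between these gadgets
  is lost, and a separator weighs at least as much as a whole gadget. So the optimum exceeds the
  threshold only if the gadgets of some tuple of assignments have a common subsequence of length
  `e + 1` (`length_le_of_common_text`).

*The machine.* The input for the `k`-LCS algorithm must be written by a program of the random access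
machine, within logarithmic cost. A small language of arithmetic expressions and list descriptions
is compiled to such programs (`Ex.compile_runs`, `Gen.compile_runs`). The registers of the compiled
program lie above all registers of the `k`-LCS algorithm, and the memory is left exactly as that
algorithm expects it, so that the algorithm runs as if it were started on the strings
(`Reduction.halts`). The time is polynomial in the number of digits of the numbers involved, times
the number of rounds of those loops that run over assignments or weights of that order; these loops
are not nested (`Reduction.exists_cost_le`).
-/


/-! ### Running programs: independence of unused registers, and composition of time bounds -/

namespace RAM

/-- A strict upper bound on the names of the registers that a program mentions. -/
def Prog.regBound : Prog → ℕ
  | .const r _ => r + 1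
  | .arith _ r a b => r + a + b + 1
  | .load r a => r + a + 1
  | .store a b => a + b + 1
  | .seq p q => p.regBound + q.regBound
  | .cond r p q => r + 1 + p.regBound + q.regBound
  | .loop r p => r + 1 + p.regBound

/-- A program neither reads nor writes the registers from `R` on if it does not mention them. -/
theorem Exec.transfer {P : Prog} {s s' : State} {t : ℕ} (h : Exec P s t s') (R : ℕ)
    (hR : P.regBound ≤ R) (u : State) (hu : ∀ r < R, u.reg r = s.reg r) (hm : u.mem = s.mem) :
    ∃ u' : State, Exec P u t u' ∧ (∀ r < R, u'.reg r = s'.reg r) ∧ u'.mem = s'.mem ∧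
      ∀ r, R ≤ r → u'.reg r = u.reg r := by
  induction h generalizing u with
  | const r c s =>
    simp only [Prog.regBound] at hR
    refine ⟨_, Exec.const r c u, ?_, hm, ?_⟩ <;> intro x hx <;>
      simp only [State.setReg, Function.update_apply] <;> split_ifs <;> first | rfl | omega | simp [hu x hx]
  | arith o r a b s =>
    simp only [Prog.regBound] at hR
    have ha := hu a (by omega)
    have hb := hu b (by omega)
    have := Exec.arith o r a b u
    rw [ha, hb] at this
    refine ⟨_, this, ?_, hm, ?_⟩ <;> intro x hx <;>
      simp only [State.setReg, Function.update_apply] <;> split_ifs <;> first | rfl | omega | simp [hu x hx]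
  | load r a s =>
    simp only [Prog.regBound] at hR
    have ha := hu a (by omega)
    have := Exec.load r a u
    rw [ha, hm] at this
    refine ⟨_, this, ?_, hm, ?_⟩ <;> intro x hx <;>
      simp only [State.setReg, Function.update_apply] <;> split_ifs <;> first | rfl | omega | simp [hu x hx]
  | store a b s =>
    simp only [Prog.regBound] at hR
    have ha := hu a (by omega)
    have hb := hu b (by omega)
    have := Exec.store a b u
    rw [ha, hb] at this
    exact ⟨_, this, hu, by simp [State.setMem, hm], fun _ _ => rfl⟩
  | seq h₁ h₂ ih₁ ih₂ =>
    simp only [Prog.regBound] at hR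
    obtain ⟨u₁, e₁, r₁, m₁, f₁⟩ := ih₁ (by omega) u hu hm
    obtain ⟨u₂, e₂, r₂, m₂, f₂⟩ := ih₂ (by omega) u₁ r₁ m₁
    exact ⟨u₂, e₁.seq e₂, r₂, m₂, fun r hr => (f₂ r hr).trans (f₁ r hr)⟩
  | condTrue hr h ih =>
    simp only [Prog.regBound] at hR
    rename_i r p q s s₁ t
    have hrr := hu r (by omega)
    obtain ⟨u₁, e₁, r₁, m₁, f₁⟩ := ih (by omega) u hu hm
    refine ⟨u₁, ?_, r₁, m₁, f₁⟩
    rw [← hrr] at hr ⊢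
    exact Exec.condTrue hr e₁
  | condFalse hr h ih =>
    simp only [Prog.regBound] at hR
    rename_i r p q s s₁ t
    have hrr := hu r (by omega)
    obtain ⟨u₁, e₁, r₁, m₁, f₁⟩ := ih (by omega) u hu hm
    refine ⟨u₁, ?_, r₁, m₁, f₁⟩
    rw [← hrr] at hr ⊢
    exact Exec.condFalse hr e₁
  | loopStop hr =>
    simp only [Prog.regBound] at hR
    rename_i r p s
    have hrr := hu r (by omega)
    refine ⟨u, ?_, hu, hm, fun _ _ => rfl⟩
    rw [← hrr] at hr ⊢
    exact Exec.loopStop hr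
  | loopStep hr h₁ h₂ ih₁ ih₂ =>
    rename_i r p s s₁ s₂ t₁ t₂
    have hR' := hR
    simp only [Prog.regBound] at hR
    have hrr := hu r (by omega)
    obtain ⟨u₁, e₁, r₁, m₁, f₁⟩ := ih₁ (by omega) u hu hm
    obtain ⟨u₂, e₂, r₂, m₂, f₂⟩ := ih₂ hR' u₁ r₁ m₁
    refine ⟨u₂, ?_, r₂, m₂, fun r hr => (f₂ r hr).trans (f₁ r hr)⟩
    rw [← hrr] at hr ⊢
    exact Exec.loopStep hr e₁ e₂

theorem wordCost_le_of_lt {x v : ℕ} (h : x < 2 ^ v) : wordCost x ≤ v + 1 :=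
  Nat.succ_le_succ (Nat.size_le.2 h)

/-- Started in `s`, the program halts within time `τ` in a state that satisfies `Q`. -/
def Runs (P : Prog) (s : State) (τ : ℕ) (Q : State → Prop) : Prop :=
  ∃ t s', Exec P s t s' ∧ t ≤ τ ∧ Q s'

theorem Runs.mono {P : Prog} {s : State} {τ τ' : ℕ} {Q Q' : State → Prop} (h : Runs P s τ Q)
    (hτ : τ ≤ τ') (hQ : ∀ s', Q s' → Q' s') : Runs P s τ' Q' := by
  obtain ⟨t, s', e, ht, hs⟩ := h
  exact ⟨t, s', e, ht.trans hτ, hQ s' hs⟩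

theorem Runs.seq {p q : Prog} {s : State} {τ₁ τ₂ : ℕ} {Q₁ Q₂ : State → Prop}
    (h₁ : Runs p s τ₁ Q₁) (h₂ : ∀ s₁, Q₁ s₁ → Runs q s₁ τ₂ Q₂) :
    Runs (.seq p q) s (τ₁ + τ₂) Q₂ := by
  obtain ⟨t₁, s₁, e₁, ht₁, hs₁⟩ := h₁
  obtain ⟨t₂, s₂, e₂, ht₂, hs₂⟩ := h₂ s₁ hs₁
  exact ⟨_, s₂, e₁.seq e₂, by omega, hs₂⟩

theorem Runs.const {r c v : ℕ} {s : State} {Q : State → Prop} (hc : c < 2 ^ v)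
    (hQ : Q (s.setReg r c)) : Runs (.const r c) s (v + 1) Q :=
  ⟨_, _, Exec.const r c s, wordCost_le_of_lt hc, hQ⟩

theorem Runs.arith {o : ArithOp} {r a b v w : ℕ} {s : State} {Q : State → Prop}
    (ha : s.reg a < 2 ^ v) (hb : s.reg b < 2 ^ w)
    (hQ : Q (s.setReg r (o.apply (s.reg a) (s.reg b)))) :
    Runs (.arith o r a b) s (v + w + 2) Q :=
  ⟨_, _, Exec.arith o r a b s, by
    have := wordCost_le_of_lt ha
    have := wordCost_le_of_lt hb
    omega, hQ⟩

theorem Runs.load {r a v w : ℕ} {s : State} {Q : State → Prop}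
    (ha : s.reg a < 2 ^ v) (hb : s.mem (s.reg a) < 2 ^ w)
    (hQ : Q (s.setReg r (s.mem (s.reg a)))) :
    Runs (.load r a) s (v + w + 2) Q :=
  ⟨_, _, Exec.load r a s, by
    have := wordCost_le_of_lt ha
    have := wordCost_le_of_lt hb
    omega, hQ⟩

theorem Runs.store {a b v w : ℕ} {s : State} {Q : State → Prop}
    (ha : s.reg a < 2 ^ v) (hb : s.reg b < 2 ^ w)
    (hQ : Q (s.setMem (s.reg a) (s.reg b))) :
    Runs (.store a b) s (v + w + 2) Q :=
  ⟨_, _, Exec.store a b s, by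
    have := wordCost_le_of_lt ha
    have := wordCost_le_of_lt hb
    omega, hQ⟩

/-- A loop whose register `c` counts down from `n` to `0`, with invariant `I j` after `j` rounds. -/
theorem Runs.loop {c n v τ : ℕ} {body : Prog} (I : ℕ → State → Prop) (hn : n < 2 ^ v)
    (hc : ∀ j s, I j s → s.reg c = n - j)
    (hbody : ∀ j s, j < n → I j s → Runs body s τ (I (j + 1))) (s : State) (hs : I 0 s) :
    Runs (.loop c body) s (n * (τ + v + 1) + 1) (I n) := by
  suffices H : ∀ m j s, m + j = n → I j s →
      Runs (.loop c body) s (m * (τ + v + 1) + 1) (I n) from H n 0 s (by omega) hs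
  intro m
  induction m with
  | zero =>
    intro j s hj hI
    obtain rfl : j = n := by omega
    have h0 : s.reg c = 0 := by rw [hc _ _ hI]; omega
    exact ⟨_, s, Exec.loopStop h0, by simp [h0, wordCost], hI⟩
  | succ m ih =>
    intro j s hj hI
    have h0 : s.reg c = n - j := hc _ _ hI
    obtain ⟨t₁, s₁, e₁, ht₁, hs₁⟩ := hbody j s (by omega) hI
    obtain ⟨t₂, s₂, e₂, ht₂, hs₂⟩ := ih (j + 1) s₁ (by omega) hs₁
    refine ⟨_, s₂, Exec.loopStep (by omega) e₁ e₂, ?_, hs₂⟩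
    have : wordCost (s.reg c) ≤ v + 1 := wordCost_le_of_lt (by omega)
    rw [Nat.succ_mul]
    omega

@[simp] theorem State.setReg_reg (s : State) (r v x : ℕ) :
    (s.setReg r v).reg x = if x = r then v else s.reg x := by
  simp [State.setReg, Function.update_apply]

@[simp] theorem State.setReg_mem (s : State) (r v : ℕ) : (s.setReg r v).mem = s.mem := rfl

@[simp] theorem State.setMem_reg (s : State) (a v : ℕ) : (s.setMem a v).reg = s.reg := rfl

@[simp] theorem State.setMem_mem (s : State) (a v : ℕ) :
    (s.setMem a v).mem = Function.update s.mem a v := rfl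

/-! ### Arithmetic expressions and their compilation -/

/-- Arithmetic expressions over an environment of natural numbers and an input `M : ℕ → ℕ`.
`read e` is the input word with index `e`. `iter x n a e` starts from the value `a` and replaces it
`n` times by the value of `e`; there, variable `2 * x` is the number of the round and variable
`2 * x + 1` is the current value. -/
inductive Ex where
  | lit (c : ℕ)
  | var (x : ℕ)
  | op (o : ArithOp) (a b : Ex)
  | read (a : Ex)
  | iter (x : ℕ) (n a e : Ex)

/-- `iterIdx f a n` applies `f 0`, `f 1`, …, `f (n - 1)` in this order to `a`. -/
def iterIdx (f : ℕ → ℕ → ℕ) (a : ℕ) : ℕ → ℕ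
  | 0 => a
  | n + 1 => f n (iterIdx f a n)

/-- The environment inside an iteration. -/
def iterEnv (ρ : ℕ → ℕ) (x j a : ℕ) : ℕ → ℕ :=
  Function.update (Function.update ρ (2 * x) j) (2 * x + 1) a

/-- The value of an expression. -/
def Ex.eval (M : ℕ → ℕ) : Ex → (ℕ → ℕ) → ℕ
  | lit c, _ => c
  | var x, ρ => ρ x
  | op o a b, ρ => o.apply (a.eval M ρ) (b.eval M ρ)
  | read a, ρ => M (a.eval M ρ)
  | iter x n a e, ρ =>
      iterIdx (fun j y => e.eval M (iterEnv ρ x j y)) (a.eval M ρ) (n.eval M ρ)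

/-- All iterations in the evaluation of an expression have at most `Z` rounds, and their
intermediate values have at most `Z` binary digits. -/
def Ex.Ok (M : ℕ → ℕ) (Z : ℕ) : Ex → (ℕ → ℕ) → Prop
  | lit _, _ => True
  | var _, _ => True
  | op _ a b, ρ => a.Ok M Z ρ ∧ b.Ok M Z ρ
  | read a, ρ => a.Ok M Z ρ
  | iter x n a e, ρ => n.Ok M Z ρ ∧ a.Ok M Z ρ ∧ n.eval M ρ ≤ Z ∧
      (∀ j ≤ n.eval M ρ,
        iterIdx (fun j y => e.eval M (iterEnv ρ x j y)) (a.eval M ρ) j < 2 ^ Z) ∧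
      ∀ j < n.eval M ρ, e.Ok M Z (iterEnv ρ x j
        (iterIdx (fun j y => e.eval M (iterEnv ρ x j y)) (a.eval M ρ) j))

/-- A bound on the number of binary digits of the value, if all variables and input words have at
most `Z` digits. -/
def Ex.bits (Z : ℕ) : Ex → ℕ
  | lit c => Nat.size c
  | var _ => Z
  | op _ a b => a.bits Z + b.bits Z + 1
  | read _ => Z
  | iter _ _ _ _ => Z

theorem ArithOp.apply_lt (o : ArithOp) {x y a b : ℕ} (hx : x < 2 ^ a) (hy : y < 2 ^ b) :
    o.apply x y < 2 ^ (a + b + 1) := by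
  have h1 : 2 ^ a ≤ 2 ^ (a + b) := Nat.pow_le_pow_right (by norm_num) (by omega)
  have h2 : 2 ^ b ≤ 2 ^ (a + b) := Nat.pow_le_pow_right (by norm_num) (by omega)
  have h3 : 2 ^ (a + b + 1) = 2 ^ (a + b) + 2 ^ (a + b) := by ring
  cases o with
  | plus => simp only [ArithOp.apply]; omega
  | monus => simp only [ArithOp.apply]; omega
  | times =>
    simp only [ArithOp.apply]
    have : x * y < 2 ^ a * 2 ^ b := Nat.mul_lt_mul'' hx hy
    rw [← pow_add] at this
    omega
  | quot =>
    simp only [ArithOp.apply]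
    have := Nat.div_le_self x y
    omega

theorem Ex.eval_lt {M : ℕ → ℕ} {Z : ℕ} (hM : ∀ a, M a < 2 ^ Z) (e : Ex) {ρ : ℕ → ℕ}
    (hρ : ∀ x, ρ x < 2 ^ Z) (h : e.Ok M Z ρ) : e.eval M ρ < 2 ^ e.bits Z := by
  induction e with
  | lit c => exact Nat.lt_size_self c
  | var x => exact hρ x
  | op o a b iha ihb => exact o.apply_lt (iha h.1) (ihb h.2)
  | read a => exact hM _
  | iter x n a e => exact h.2.2.2.1 _ le_rfl

theorem iterEnv_lt {ρ : ℕ → ℕ} {Z x j a : ℕ} (hρ : ∀ x, ρ x < 2 ^ Z) (hj : j < 2 ^ Z)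
    (ha : a < 2 ^ Z) (y : ℕ) : iterEnv ρ x j a y < 2 ^ Z := by
  simp only [iterEnv, Function.update_apply]
  split_ifs <;> simp [*]

/-- The registers with names from `R` on: a zero, a one, the address of the first input word, the
address of the next output word, the variables and the temporary registers. -/
inductive Reg where
  | zero
  | one
  | base
  | ptr
  | var (x : ℕ)
  | tmp (d : ℕ)

/-- The name of a register. -/
def Reg.addr (R : ℕ) : Reg → ℕ
  | zero => R
  | one => R + 1
  | base => R + 2
  | ptr => R + 3
  | var x => R + 4 + 2 * x
  | tmp d => R + 5 + 2 * d

@[simp] theorem Reg.addr_inj {R : ℕ} {g h : Reg} : g.addr R = h.addr R ↔ g = h := by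
  refine ⟨fun H => ?_, fun H => H ▸ rfl⟩
  cases g <;> cases h <;> simp only [Reg.addr] at H <;>
    first | rfl | (exfalso; omega) | (congr 1; omega)

theorem Reg.le_addr {R : ℕ} (g : Reg) : R ≤ g.addr R := by
  cases g <;> simp only [Reg.addr] <;> omega

/-- The register that always contains `0`. -/
abbrev rZero (R : ℕ) : ℕ := Reg.zero.addr R
/-- The register that always contains `1`. -/
abbrev rOne (R : ℕ) : ℕ := Reg.one.addr R
/-- The register with the memory address of the first input word. -/
abbrev rBase (R : ℕ) : ℕ := Reg.base.addr R
/-- The register with the memory address of the next output word. -/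
abbrev rPtr (R : ℕ) : ℕ := Reg.ptr.addr R
/-- The register of a variable. -/
abbrev rVar (R x : ℕ) : ℕ := (Reg.var x).addr R
/-- The temporary registers. -/
abbrev rTmp (R d : ℕ) : ℕ := (Reg.tmp d).addr R

/-- `r := a` -/
abbrev mov (R r a : ℕ) : Prog := .arith .plus r a (rZero R)

theorem Runs.mov {R r a v : ℕ} {s : State} {Q : State → Prop} (hz : s.reg (rZero R) = 0)
    (ha : s.reg a < 2 ^ v) (hQ : Q (s.setReg r (s.reg a))) :
    Runs (mov R r a) s (v + 2) Q :=
  Runs.arith (w := 0) ha (by simp [hz]) (by simpa [ArithOp.apply, hz] using hQ)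

/-- A program that evaluates an expression into temporary register `d`, without changing any
register other than the temporary registers from `d` on. -/
def Ex.compile (R : ℕ) : Ex → ℕ → Prog
  | lit c, d => .const (rTmp R d) c
  | var x, d => mov R (rTmp R d) (rVar R x)
  | op o a b, d =>
      .seq (a.compile R d) (.seq (b.compile R (d + 1))
        (.arith o (rTmp R d) (rTmp R d) (rTmp R (d + 1))))
  | read a, d =>
      .seq (a.compile R d) (.seq (.arith .plus (rTmp R d) (rTmp R d) (rBase R))
        (.load (rTmp R d) (rTmp R d)))
  | iter x n a e, d =>
      .seq (n.compile R d) (.seq (a.compile R (d + 1))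
      (.seq (mov R (rTmp R (d + 2)) (rVar R (2 * x)))
      (.seq (mov R (rTmp R (d + 3)) (rVar R (2 * x + 1)))
      (.seq (mov R (rVar R (2 * x + 1)) (rTmp R (d + 1)))
      (.seq (.const (rVar R (2 * x)) 0)
      (.seq (.loop (rTmp R d)
        (.seq (e.compile R (d + 4))
        (.seq (mov R (rVar R (2 * x + 1)) (rTmp R (d + 4)))
        (.seq (.arith .plus (rVar R (2 * x)) (rVar R (2 * x)) (rOne R))
          (.arith .monus (rTmp R d) (rTmp R d) (rOne R))))))
      (.seq (mov R (rTmp R d) (rVar R (2 * x + 1)))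
      (.seq (mov R (rVar R (2 * x)) (rTmp R (d + 2)))
        (mov R (rVar R (2 * x + 1)) (rTmp R (d + 3)))))))))))

/-- A bound on the time for evaluating an expression. -/
def Ex.cost (Z : ℕ) : Ex → ℕ
  | lit c => Nat.size c + 1
  | var _ => Z + 2
  | op _ a b => a.cost Z + (b.cost Z + (a.bits Z + b.bits Z + 2))
  | read a => a.cost Z + ((a.bits Z + Z + 2) + ((a.bits Z + Z + 1) + Z + 2))
  | iter _ n a e => n.cost Z + a.cost Z + a.bits Z + 7 * (Z + 2) + 4 +
      Z * (e.cost Z + 4 * (Z + 3))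

/-- The machine state contains the constants, the input `M`, and variables of at most `Z` digits. -/
structure Ready (R : ℕ) (M : ℕ → ℕ) (Z : ℕ) (s : State) : Prop where
  zero : s.reg (rZero R) = 0
  one : s.reg (rOne R) = 1
  input : ∀ a, s.mem (s.reg (rBase R) + a) = M a
  input_lt : ∀ a, M a < 2 ^ Z
  base_lt : s.reg (rBase R) < 2 ^ Z
  var_lt : ∀ x, s.reg (rVar R x) < 2 ^ Z

/-- The values of the variables. -/
def State.env (R : ℕ) (s : State) : ℕ → ℕ := fun x => s.reg (rVar R x)

/-- `s'` differs from `s` at most in the temporary registers from `d` on. -/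
structure Same (R d : ℕ) (s s' : State) : Prop where
  mem : s'.mem = s.mem
  reg : ∀ r, (∀ i, d ≤ i → r ≠ rTmp R i) → s'.reg r = s.reg r

theorem Same.trans {R d d' : ℕ} {s s' s'' : State} (h : Same R d s s') (h' : Same R d' s' s'')
    (hd : d ≤ d') : Same R d s s'' where
  mem := h'.mem.trans h.mem
  reg r hr := (h'.reg r fun i hi => hr i (hd.trans hi)).trans (h.reg r hr)

theorem Same.var {R d : ℕ} {s s' : State} (h : Same R d s s') (x : ℕ) :
    s'.reg (rVar R x) = s.reg (rVar R x) := h.reg _ (by simp)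

theorem Same.env {R d : ℕ} {s s' : State} (h : Same R d s s') : s'.env R = s.env R :=
  funext fun x => h.var x

theorem Same.tmp {R d i : ℕ} {s s' : State} (h : Same R d s s') (hi : i < d) :
    s'.reg (rTmp R i) = s.reg (rTmp R i) :=
  h.reg _ fun j hj => by simp only [ne_eq, Reg.addr_inj, Reg.tmp.injEq]; omega

theorem Same.ready {R d Z : ℕ} {M : ℕ → ℕ} {s s' : State} (h : Same R d s s')
    (hs : Ready R M Z s) : Ready R M Z s' where
  zero := by rw [h.reg _ (by simp)]; exact hs.zero
  one := by rw [h.reg _ (by simp)]; exact hs.one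
  input a := by rw [h.reg _ (by simp), h.mem]; exact hs.input a
  input_lt := hs.input_lt
  base_lt := by rw [h.reg _ (by simp)]; exact hs.base_lt
  var_lt x := by rw [h.var]; exact hs.var_lt x

theorem Ex.compile_runs {R Z : ℕ} {M : ℕ → ℕ} (e : Ex) (d : ℕ) (s : State) (hs : Ready R M Z s)
    (h : e.Ok M Z (s.env R)) :
    Runs (e.compile R d) s (e.cost Z)
      fun s' => Same R d s s' ∧ s'.reg (rTmp R d) = e.eval M (s.env R) := by
  induction e generalizing d s with
  | lit c =>
    refine Runs.const (Nat.lt_size_self c) ⟨⟨rfl, fun r hr => ?_⟩, by simp [Ex.eval]⟩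
    simp [hr d le_rfl]
  | var x =>
    refine Runs.mov hs.zero (hs.var_lt x) ⟨⟨rfl, fun r hr => ?_⟩, by simp [Ex.eval, State.env]⟩
    simp [hr d le_rfl]
  | op o a b iha ihb =>
    refine (iha d s hs h.1).seq fun s₁ ⟨h₁, v₁⟩ => ?_
    refine (ihb (d + 1) s₁ (h₁.ready hs) (by rw [h₁.env]; exact h.2)).seq fun s₂ ⟨h₂, v₂⟩ => ?_
    have v₁' : s₂.reg (rTmp R d) = a.eval M (s.env R) := by rw [h₂.tmp (by omega), v₁]
    rw [h₁.env] at v₂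
    refine Runs.arith (by rw [v₁']; exact a.eval_lt hs.input_lt hs.var_lt h.1)
      (by rw [v₂]; exact b.eval_lt hs.input_lt hs.var_lt h.2) ⟨?_, ?_⟩
    · refine (h₁.trans h₂ (by omega)).trans (d' := d) ⟨rfl, fun r hr => ?_⟩ le_rfl
      simp [hr d le_rfl]
    · simp [v₁', v₂, Ex.eval]
  | read a iha =>
    refine (iha d s hs h).seq fun s₁ ⟨h₁, v₁⟩ => ?_
    have hs₁ := h₁.ready hs
    have hlt : a.eval M (s.env R) < 2 ^ a.bits Z := a.eval_lt hs.input_lt hs.var_lt h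
    refine (Runs.arith (Q := fun s' => s' = s₁.setReg (rTmp R d)
      (ArithOp.plus.apply (s₁.reg (rTmp R d)) (s₁.reg (rBase R))))
      (by rw [v₁]; exact hlt) hs₁.base_lt rfl).seq ?_
    rintro _ rfl
    have hlt' := ArithOp.plus.apply_lt hlt hs₁.base_lt
    have hin := hs₁.input (a.eval M (s.env R))
    rw [add_comm] at hin
    refine Runs.load (by rw [← v₁] at hlt'; simpa using hlt') ?_ ⟨?_, ?_⟩
    · simp [v₁, ArithOp.apply, hin, hs.input_lt]
    · refine h₁.trans (d' := d) ⟨rfl, fun r hr => ?_⟩ le_rfl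
      simp [hr d le_rfl]
    · simp [v₁, ArithOp.apply, hin, Ex.eval]
  | iter x n a e ihn iha ihe =>
    obtain ⟨hn, ha, hnZ, hacc, he⟩ := h
    set ρ := s.env R with hρ
    set acc : ℕ → ℕ := iterIdx (fun j y => e.eval M (iterEnv ρ x j y)) (a.eval M ρ) with hA
    have hZ : Z < 2 ^ Z := Nat.lt_two_pow_self
    refine Runs.mono (τ := n.cost Z + (a.cost Z + ((Z + 2) + ((Z + 2) + ((a.bits Z + 2) +
      (Z + 1 + ((n.eval M ρ * ((e.cost Z + ((Z + 2) + ((Z + 1 + 2) + (Z + 1 + 2)))) + Z + 1) + 1)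
       + ((Z + 2) + ((Z + 2) + (Z + 2)))))))))) (Q := fun s' => Same R d s s' ∧
        s'.reg (rTmp R d) = acc (n.eval M ρ)) ?_ ?_ ?_
    rotate_left
    · have : n.eval M ρ * ((e.cost Z + ((Z + 2) + ((Z + 1 + 2) + (Z + 1 + 2)))) + Z + 1) ≤
        Z * (e.cost Z + 4 * (Z + 3)) := Nat.mul_le_mul hnZ (by omega)
      simp only [Ex.cost]
      omega
    · exact fun s' h => h
    refine (ihn d s hs hn).seq fun s₁ ⟨h₁, v₁⟩ => ?_
    refine (iha (d + 1) s₁ (h₁.ready hs) (by rw [h₁.env]; exact ha)).seq fun s₂ ⟨h₂, v₂⟩ => ?_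
    rw [h₁.env] at v₂
    have h₂' := h₁.trans h₂ (by omega)
    have hs₂ := h₂'.ready hs
    have hvar : ∀ y, s₂.reg (rVar R y) = ρ y := fun y => h₂'.var y
    have vn : s₂.reg (rTmp R d) = n.eval M ρ := by rw [h₂.tmp (by omega), v₁]
    have hρlt : ∀ y, ρ y < 2 ^ Z := hs.var_lt
    refine (Runs.mov (Q := fun s' => s' = _) hs₂.zero (hs₂.var_lt _) rfl).seq ?_
    rintro _ rfl
    refine (Runs.mov (v := Z) (Q := fun s' => s' = _) (by simpa using hs₂.zero)
      (by simpa using hs₂.var_lt _) rfl).seq ?_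
    rintro _ rfl
    refine (Runs.mov (v := a.bits Z) (Q := fun s' => s' = _) (by simpa using hs₂.zero)
      (by
        have := a.eval_lt hs.input_lt hs.var_lt ha
        change a.eval M (s.env R) < _ at this
        rw [← v₂] at this
        simpa using this) rfl).seq ?_
    rintro _ rfl
    refine (Runs.const (v := Z) (Q := fun s' => s' = _) (by simp) rfl).seq ?_
    rintro _ rfl
    refine (Runs.loop (n := n.eval M ρ) (I := fun j s' => s'.mem = s.mem ∧
      s'.reg (rTmp R d) = n.eval M ρ - j ∧ s'.reg (rTmp R (d + 2)) = ρ (2 * x) ∧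
      s'.reg (rTmp R (d + 3)) = ρ (2 * x + 1) ∧ s'.reg (rVar R (2 * x)) = j ∧
      s'.reg (rVar R (2 * x + 1)) = acc j ∧ ∀ r, (∀ i, d ≤ i → r ≠ rTmp R i) →
        r ≠ rVar R (2 * x) → r ≠ rVar R (2 * x + 1) → s'.reg r = s.reg r) (v := Z) (by omega)
      (fun j s' h => h.2.1) ?_ _ ?_).seq ?_
    · rintro j s' hj ⟨hm, hc, ht2, ht3, hj', hacc', hr⟩
      have henv : s'.env R = iterEnv ρ x j (acc j) := by
        funext y
        simp only [iterEnv, Function.update_apply, State.env]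
        split_ifs with hy hy'
        · rw [hy, hacc']
        · rw [hy', hj']
        · exact hr _ (by simp) (by simpa using hy') (by simpa using hy)
      have hs' : Ready R M Z s' := by
        refine ⟨by rw [hr _ (by simp) (by simp) (by simp), hs.zero],
          by rw [hr _ (by simp) (by simp) (by simp), hs.one], ?_,
          hs.input_lt, by rw [hr _ (by simp) (by simp) (by simp)]; exact hs.base_lt, ?_⟩
        · intro a
          rw [hr _ (by simp) (by simp) (by simp), hm]
          exact hs.input a
        · intro y
          have : s'.reg (rVar R y) = s'.env R y := rfl
          rw [this, henv]
          exact iterEnv_lt hρlt (by omega) (hacc j (by omega)) y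
      refine (ihe (d + 4) s' hs' (by rw [henv]; exact he j hj)).seq fun s₃ ⟨h₃, v₃⟩ => ?_
      have v₃' : s₃.reg (rTmp R (d + 4)) = acc (j + 1) := by
        rw [v₃, henv]; rfl
      have hs₃ := h₃.ready hs'
      have c₃ : s₃.reg (rTmp R d) = n.eval M ρ - j := by rw [h₃.tmp (by omega), hc]
      have x₃ : s₃.reg (rVar R (2 * x)) = j := by rw [h₃.var, hj']
      refine (Runs.mov (Q := fun s' => s' = _) hs₃.zero
        (by rw [v₃']; exact hacc (j + 1) hj) rfl).seq ?_
      rintro _ rfl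
      refine (Runs.arith (v := Z) (w := 1) (Q := fun s' => s' = _) ?_ ?_ rfl).seq ?_
      · simpa using hs₃.var_lt _
      · simp [hs₃.one]
      rintro _ rfl
      refine Runs.arith (v := Z) (w := 1) ?_ ?_ ⟨?_, ?_, ?_, ?_, ?_, ?_, ?_⟩
      · simp [c₃]; omega
      · simp [hs₃.one]
      · simp [h₃.mem, hm]
      · simp [c₃, hs₃.one, ArithOp.apply]; omega
      · simpa using (h₃.tmp (by omega)).trans ht2
      · simpa using (h₃.tmp (by omega)).trans ht3
      · simp [x₃, hs₃.one, ArithOp.apply]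
      · simpa using v₃'
      · intro r hr1 hr2 hr3
        simp only [State.setReg_reg]
        rw [if_neg (hr1 d le_rfl), if_neg hr2, if_neg hr3, h₃.reg r fun i hi => hr1 i (by omega)]
        exact hr r hr1 hr2 hr3
    · refine ⟨?_, ?_, ?_, ?_, ?_, ?_, ?_⟩
      · simpa using h₂'.mem
      · simpa using vn
      · simpa using hvar (2 * x)
      · simpa using hvar (2 * x + 1)
      · simp
      · simpa [hA, iterIdx] using v₂
      · intro r hr1 hr2 hr3
        simp only [State.setReg_reg]
        rw [if_neg hr2, if_neg hr3, if_neg (hr1 _ (by omega)), if_neg (hr1 _ (by omega))]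
        exact h₂'.reg r hr1
    · rintro s' ⟨hm, hc, ht2, ht3, hj', hacc', hr⟩
      have hz : s'.reg (rZero R) = 0 := by
        rw [hr _ (by simp) (by simp) (by simp)]; exact hs.zero
      refine (Runs.mov (v := Z) (Q := fun s' => s' = _) hz
        (by simpa [hacc'] using hacc _ le_rfl) rfl).seq ?_
      rintro _ rfl
      refine (Runs.mov (v := Z) (Q := fun s' => s' = _) (by simpa using hz)
        (by simpa [ht2] using hρlt _) rfl).seq ?_
      rintro _ rfl
      refine Runs.mov (v := Z) (by simpa using hz) (by simpa [ht3] using hρlt _)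
        ⟨⟨by simpa using hm, fun r hr1 => ?_⟩, by simp [hacc']⟩
      by_cases h1 : r = rVar R (2 * x + 1)
      · rw [h1]
        simp only [State.setReg_reg, Reg.addr_inj]
        simp [ht3, hρ, State.env]
      by_cases h2 : r = rVar R (2 * x)
      · rw [h2]
        simp only [State.setReg_reg, Reg.addr_inj]
        simp [ht2, hρ, State.env]
      simp only [State.setReg_reg]
      rw [if_neg h1, if_neg h2, if_neg (hr1 _ le_rfl)]
      exact hr r hr1 h2 h1

end RAM

namespace RAM

/-! ### Programs that write a list -/

/-- Descriptions of lists of numbers: a single entry, a concatenation, or a concatenation over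
`x = 0, …, n - 1`. The flag of a loop says which of two bounds its number of rounds obeys. -/
inductive Gen where
  | emit (e : Ex)
  | seq (g h : Gen)
  | loop (big : Bool) (x : ℕ) (n : Ex) (g : Gen)

/-- The list that is described. -/
def Gen.den (M : ℕ → ℕ) : Gen → (ℕ → ℕ) → List ℕ
  | emit e, ρ => [e.eval M ρ]
  | seq g h, ρ => g.den M ρ ++ h.den M ρ
  | loop _ x n g, ρ =>
      (List.range (n.eval M ρ)).flatMap fun j => g.den M (Function.update ρ x j)

/-- All expressions are within the bound `Z`, loops marked `true` have at most `X` rounds, and the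
other loops have at most `Z` rounds. -/
def Gen.Ok (M : ℕ → ℕ) (Z X : ℕ) : Gen → (ℕ → ℕ) → Prop
  | emit e, ρ => e.Ok M Z ρ
  | seq g h, ρ => g.Ok M Z X ρ ∧ h.Ok M Z X ρ
  | loop big x n g, ρ => n.Ok M Z ρ ∧ n.eval M ρ ≤ (if big then X else Z) ∧
      ∀ j < n.eval M ρ, g.Ok M Z X (Function.update ρ x j)

/-- A bound on the time for writing the list. -/
def Gen.cost (Z X : ℕ) : Gen → ℕ
  | emit e => e.cost Z + ((Z + e.bits Z + 2) + (Z + 1 + 2))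
  | seq g h => g.cost Z X + h.cost Z X
  | loop big _ n g => n.cost Z + (3 * (Z + 2) + 1 +
      (if big then X else Z) * (g.cost Z X + 3 * (Z + 3)))

/-- A program that appends the list to the output. -/
def Gen.compile (R : ℕ) : Gen → ℕ → Prog
  | emit e, d =>
      .seq (e.compile R d) (.seq (.store (rPtr R) (rTmp R d))
        (.arith .plus (rPtr R) (rPtr R) (rOne R)))
  | seq g h, d => .seq (g.compile R d) (h.compile R d)
  | loop _ x n g, d =>
      .seq (n.compile R d) (.seq (mov R (rTmp R (d + 1)) (rVar R x))
      (.seq (.const (rVar R x) 0)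
      (.seq (.loop (rTmp R d)
        (.seq (g.compile R (d + 2)) (.seq (.arith .plus (rVar R x) (rVar R x) (rOne R))
          (.arith .monus (rTmp R d) (rTmp R d) (rOne R)))))
        (mov R (rVar R x) (rTmp R (d + 1))))))

/-- The memory after writing a list from address `p` on. -/
def writeList (m : ℕ → ℕ) (p : ℕ) : List ℕ → ℕ → ℕ
  | [] => m
  | x :: l => writeList (Function.update m p x) (p + 1) l

theorem writeList_append (m : ℕ → ℕ) (p : ℕ) (l l' : List ℕ) :
    writeList m p (l ++ l') = writeList (writeList m p l) (p + l.length) l' := by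
  induction l generalizing m p with
  | nil => rfl
  | cons x l ih =>
    simp only [List.cons_append, writeList, ih, List.length_cons]
    congr 1
    omega

theorem writeList_apply (m : ℕ → ℕ) (p : ℕ) (l : List ℕ) (a : ℕ) :
    writeList m p l a = if p ≤ a ∧ a < p + l.length then l.getD (a - p) 0 else m a := by
  induction l generalizing m p with
  | nil => simp [writeList]
  | cons x l ih =>
    simp only [writeList, ih, List.length_cons, Function.update_apply]
    by_cases h : p ≤ a
    · obtain ⟨b, rfl⟩ := Nat.exists_eq_add_of_le h
      rcases b with _ | b
      · simp
      · have h1 : p + (b + 1) - (p + 1) = b := by omega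
        have h2 : p + (b + 1) - p = b + 1 := by omega
        rw [h1, h2, List.getD_cons_succ]
        by_cases hb : b < l.length
        · rw [if_pos (by omega), if_pos (by omega)]
        · rw [if_neg (by omega), if_neg (by omega), if_neg (by omega)]
    · rw [if_neg (by omega), if_neg (by omega), if_neg (by omega)]

/-- `s'` arises from `s` by writing the list `l` to the output, with no other change outside the
temporary registers from `d` on. -/
structure Wrote (R d : ℕ) (l : List ℕ) (s s' : State) : Prop where
  mem : s'.mem = writeList s.mem (s.reg (rPtr R)) l
  ptr : s'.reg (rPtr R) = s.reg (rPtr R) + l.length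
  reg : ∀ r, r ≠ rPtr R → (∀ i, d ≤ i → r ≠ rTmp R i) → s'.reg r = s.reg r

theorem Wrote.ready {R d Z : ℕ} {M : ℕ → ℕ} {l : List ℕ} {s s' : State} (h : Wrote R d l s s')
    (hs : Ready R M Z s) (hl : s.reg (rPtr R) + l.length ≤ s.reg (rBase R)) :
    Ready R M Z s' where
  zero := by rw [h.reg _ (by simp) (by simp)]; exact hs.zero
  one := by rw [h.reg _ (by simp) (by simp)]; exact hs.one
  input a := by
    rw [h.reg _ (by simp) (by simp), h.mem, writeList_apply, if_neg (by omega)]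
    exact hs.input a
  input_lt := hs.input_lt
  base_lt := by rw [h.reg _ (by simp) (by simp)]; exact hs.base_lt
  var_lt x := by rw [h.reg _ (by simp) (by simp)]; exact hs.var_lt x

theorem Wrote.env {R d : ℕ} {l : List ℕ} {s s' : State} (h : Wrote R d l s s') :
    s'.env R = s.env R :=
  funext fun x => h.reg _ (by simp) (by simp)

theorem Gen.compile_runs {R Z X : ℕ} {M : ℕ → ℕ} (hX : X < 2 ^ Z) (g : Gen) (d : ℕ) (s : State)
    (hs : Ready R M Z s) (h : g.Ok M Z X (s.env R))
    (hl : s.reg (rPtr R) + (g.den M (s.env R)).length ≤ s.reg (rBase R)) :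
    Runs (g.compile R d) s (g.cost Z X) (Wrote R d (g.den M (s.env R)) s) := by
  have hZ : Z < 2 ^ Z := Nat.lt_two_pow_self
  induction g generalizing d s with
  | emit e =>
    refine (e.compile_runs d s hs h).seq fun s₁ ⟨h₁, v₁⟩ => ?_
    have hs₁ := h₁.ready hs
    have hlt : e.eval M (s.env R) < 2 ^ e.bits Z := e.eval_lt hs.input_lt hs.var_lt h
    have hp : s₁.reg (rPtr R) = s.reg (rPtr R) := h₁.reg _ (by simp)
    have hplt : s.reg (rPtr R) < 2 ^ Z := by
      have := hs.base_lt
      omega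
    refine (Runs.store (Q := fun s' => s' = _) (by rw [hp]; exact hplt)
      (by rw [v₁]; exact hlt) rfl).seq ?_
    rintro _ rfl
    refine Runs.arith (by simpa [hp] using hplt) (w := 1) (by simp [hs₁.one]) ⟨?_, ?_, ?_⟩
    · simp [hp, v₁, Gen.den, writeList, h₁.mem]
    · simp [hp, hs₁.one, ArithOp.apply, Gen.den]
    · intro r hr1 hr2
      simp only [State.setReg_reg, State.setMem_reg, if_neg hr1]
      exact h₁.reg r hr2
  | seq g₁ g₂ ih₁ ih₂ =>
    simp only [Gen.den, List.length_append] at hl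
    refine (ih₁ d s hs h.1 (by omega)).seq fun s₁ h₁ => ?_
    refine (ih₂ d s₁ (h₁.ready hs (by omega)) (by rw [h₁.env]; exact h.2) ?_).mono le_rfl
      fun s₂ h₂ => ⟨?_, ?_, fun r hr1 hr2 => (h₂.reg r hr1 hr2).trans (h₁.reg r hr1 hr2)⟩
    · rw [h₁.env, h₁.ptr, h₁.reg (rBase R) (by simp) (by simp)]
      omega
    · rw [h₂.mem, h₁.mem, h₁.ptr, h₁.env]
      exact (writeList_append _ _ _ _).symm
    · rw [h₂.ptr, h₁.ptr, h₁.env]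
      simp [Gen.den, add_assoc]
  | loop big x n g ih =>
    obtain ⟨hn, hcnt, hg⟩ := h
    set ρ := s.env R with hρ
    set D : ℕ → List ℕ := fun m =>
      (List.range m).flatMap fun j => g.den M (Function.update ρ x j) with hD
    have hDs : ∀ m, D (m + 1) = D m ++ g.den M (Function.update ρ x m) := by
      intro m
      simp [hD, List.range_succ]
    have hDmono : ∀ m m', m ≤ m' → (D m).length ≤ (D m').length := by
      refine monotone_nat_of_le_succ fun m => ?_
      rw [hDs, List.length_append]
      omega
    have hcnt' : n.eval M ρ < 2 ^ Z := by split_ifs at hcnt <;> omega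
    change s.reg (rPtr R) + (D (n.eval M ρ)).length ≤ _ at hl
    refine Runs.mono (τ := n.cost Z + ((Z + 2) + ((Z + 1) + ((n.eval M ρ *
      ((g.cost Z X + ((Z + 1 + 2) + (Z + 1 + 2))) + Z + 1) + 1) + (Z + 2)))))
      (Q := Wrote R d (D (n.eval M ρ)) s) ?_ ?_ ?_
    rotate_left
    · have : n.eval M ρ * ((g.cost Z X + ((Z + 1 + 2) + (Z + 1 + 2))) + Z + 1) ≤
        (if big then X else Z) * (g.cost Z X + 3 * (Z + 3)) := Nat.mul_le_mul hcnt (by omega)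
      simp only [Gen.cost]
      omega
    · exact fun s' h => h
    refine (n.compile_runs d s hs hn).seq fun s₁ ⟨h₁, v₁⟩ => ?_
    have hs₁ := h₁.ready hs
    refine (Runs.mov (Q := fun s' => s' = _) hs₁.zero (hs₁.var_lt x) rfl).seq ?_
    rintro _ rfl
    refine (Runs.const (v := Z) (Q := fun s' => s' = _) (by simp) rfl).seq ?_
    rintro _ rfl
    have hx₁ : s₁.reg (rVar R x) = ρ x := h₁.var x
    refine (Runs.loop (n := n.eval M ρ) (v := Z) (I := fun j s' =>
      s'.mem = writeList s.mem (s.reg (rPtr R)) (D j) ∧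
      s'.reg (rPtr R) = s.reg (rPtr R) + (D j).length ∧
      s'.reg (rTmp R d) = n.eval M ρ - j ∧ s'.reg (rTmp R (d + 1)) = ρ x ∧
      s'.reg (rVar R x) = j ∧ ∀ r, r ≠ rPtr R → (∀ i, d ≤ i → r ≠ rTmp R i) →
        r ≠ rVar R x → s'.reg r = s.reg r) hcnt' (fun j s' h => h.2.2.1) ?_ _ ?_).seq ?_
    · rintro j s' hj ⟨hm, hp, hc, ht, hxj, hr⟩
      have henv : s'.env R = Function.update ρ x j := by
        funext y
        simp only [Function.update_apply, State.env]
        split_ifs with hy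
        · rw [hy, hxj]
        · exact hr _ (by simp) (by simp) (by simpa using hy)
      have hlj := hDmono (j + 1) (n.eval M ρ) hj
      rw [hDs, List.length_append] at hlj
      have hbase : s'.reg (rBase R) = s.reg (rBase R) := hr _ (by simp) (by simp) (by simp)
      have hs' : Ready R M Z s' := by
        refine ⟨by rw [hr _ (by simp) (by simp) (by simp), hs.zero],
          by rw [hr _ (by simp) (by simp) (by simp), hs.one], ?_, hs.input_lt,
          by rw [hbase]; exact hs.base_lt, ?_⟩
        · intro a
          rw [hbase, hm, writeList_apply, if_neg (by omega)]
          exact hs.input a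
        · intro y
          have : s'.reg (rVar R y) = s'.env R y := rfl
          rw [this, henv, Function.update_apply]
          split_ifs
          · omega
          · exact hs.var_lt y
      refine (ih (d + 2) s' hs' (by rw [henv]; exact hg j hj)
        (by rw [henv, hp, hbase]; omega)).seq fun s₂ h₂ => ?_
      rw [henv] at h₂
      have hs₂ := h₂.ready hs' (by rw [hp, hbase]; omega)
      have x₂ : s₂.reg (rVar R x) = j := by rw [h₂.reg _ (by simp) (by simp), hxj]
      have c₂ : s₂.reg (rTmp R d) = n.eval M ρ - j := by
        rw [h₂.reg _ (by simp) (by simp; omega), hc]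
      refine (Runs.arith (v := Z) (w := 1) (Q := fun s' => s' = _) (hs₂.var_lt x)
        (by simp [hs₂.one]) rfl).seq ?_
      rintro _ rfl
      refine Runs.arith (v := Z) (w := 1) (by simp [c₂]; omega) (by simp [hs₂.one])
        ⟨?_, ?_, ?_, ?_, ?_, ?_⟩
      · simp [h₂.mem, hm, hp, hDs, writeList_append]
      · simp [h₂.ptr, hp, hDs, add_assoc]
      · simp [c₂, hs₂.one, ArithOp.apply]; omega
      · simpa using (h₂.reg _ (by simp) (by simp; omega)).trans ht
      · simp [x₂, hs₂.one, ArithOp.apply]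
      · intro r hr1 hr2 hr3
        simp only [State.setReg_reg]
        rw [if_neg (hr2 d le_rfl), if_neg hr3, h₂.reg r hr1 fun i hi => hr2 i (by omega)]
        exact hr r hr1 hr2 hr3
    · have hp₁ : s₁.reg (rPtr R) = s.reg (rPtr R) := h₁.reg _ (by simp)
      refine ⟨?_, ?_, ?_, ?_, ?_, ?_⟩
      · simpa [hD, writeList] using h₁.mem
      · simpa [hD] using hp₁
      · simpa using v₁
      · simpa using hx₁
      · simp
      · intro r hr1 hr2 hr3
        simp only [State.setReg_reg]
        rw [if_neg hr3, if_neg (hr2 _ (by omega))]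
        exact h₁.reg r hr2
    · rintro s' ⟨hm, hp, hc, ht, hxj, hr⟩
      have hz : s'.reg (rZero R) = 0 := by
        rw [hr _ (by simp) (by simp) (by simp)]; exact hs.zero
      refine Runs.mov hz (by rw [ht]; exact hs.var_lt x) ⟨hm, by simpa using hp, ?_⟩
      intro r hr1 hr2
      by_cases h1 : r = rVar R x
      · rw [h1]
        simp only [State.setReg_reg]
        simp [ht, hρ, State.env]
      · simp only [State.setReg_reg]
        rw [if_neg h1]
        exact hr r hr1 hr2 h1

end RAM

namespace RAM

/-! ### Running a program on a computed input -/

/-- Evaluate expressions one after the other and assign their values to variables. -/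
def compileParams (R : ℕ) : List (ℕ × Ex) → Prog
  | [] => .const (rTmp R 0) 0
  | (x, e) :: l => .seq (e.compile R 0) (.seq (mov R (rVar R x) (rTmp R 0)) (compileParams R l))

/-- The environment after these assignments. -/
def paramEnv (M : ℕ → ℕ) : List (ℕ × Ex) → (ℕ → ℕ) → ℕ → ℕ
  | [], ρ => ρ
  | (x, e) :: l, ρ => paramEnv M l (Function.update ρ x (e.eval M ρ))

/-- The expressions are within the bound `Z`, and their values have at most `Z` digits. -/
def ParamsOk (M : ℕ → ℕ) (Z : ℕ) : List (ℕ × Ex) → (ℕ → ℕ) → Prop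
  | [], _ => True
  | (x, e) :: l, ρ => e.Ok M Z ρ ∧ e.eval M ρ < 2 ^ Z ∧
      ParamsOk M Z l (Function.update ρ x (e.eval M ρ))

/-- A bound on the time for the assignments. -/
def paramsCost (Z : ℕ) : List (ℕ × Ex) → ℕ
  | [] => 1
  | (_, e) :: l => e.cost Z + (Z + 2 + paramsCost Z l)

theorem compileParams_runs {R Z : ℕ} {M : ℕ → ℕ} (l : List (ℕ × Ex)) (s : State)
    (hs : Ready R M Z s) (h : ParamsOk M Z l (s.env R)) :
    Runs (compileParams R l) s (paramsCost Z l) fun s' => s'.mem = s.mem ∧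
      s'.env R = paramEnv M l (s.env R) ∧ Ready R M Z s' ∧
      ∀ r, (∀ i, r ≠ rTmp R i) → (∀ x, r ≠ rVar R x) → s'.reg r = s.reg r := by
  induction l generalizing s with
  | nil =>
    have hsame : Same R 0 s (s.setReg (rTmp R 0) 0) :=
      ⟨rfl, fun r hr => by simp [hr 0 le_rfl]⟩
    exact Runs.const (v := 0) (by simp) ⟨rfl, hsame.env, hsame.ready hs,
      fun r hr _ => hsame.reg r fun i _ => hr i⟩
  | cons p l ih =>
    obtain ⟨x, e⟩ := p
    obtain ⟨he, hlt, hl⟩ := h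
    refine (e.compile_runs 0 s hs he).seq fun s₁ ⟨h₁, v₁⟩ => ?_
    have hs₁ := h₁.ready hs
    refine (Runs.mov (v := Z) (Q := fun s' => s' = _) hs₁.zero (by rw [v₁]; exact hlt) rfl).seq ?_
    rintro _ rfl
    have henv : (s₁.setReg (rVar R x) (s₁.reg (rTmp R 0))).env R =
        Function.update (s.env R) x (e.eval M (s.env R)) := by
      funext y
      simp only [State.env, State.setReg_reg, Reg.addr_inj, Reg.var.injEq, Function.update_apply]
      split_ifs
      · exact v₁
      · exact h₁.var y
    refine (ih _ ⟨by simpa using hs₁.zero, by simpa using hs₁.one, by simpa using hs₁.input,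
      hs.input_lt, by simpa using hs₁.base_lt, fun y => ?_⟩ ?_).mono le_rfl ?_
    · change State.env R _ y < _
      rw [henv, Function.update_apply]
      split_ifs
      · exact hlt
      · exact hs.var_lt y
    · rw [henv]; exact hl
    · rintro s' ⟨hm, he', hr, hreg⟩
      refine ⟨by rw [hm]; exact h₁.mem, by rw [he', henv]; rfl, hr, fun r h1 h2 => ?_⟩
      rw [hreg r h1 h2]
      simp only [State.setReg_reg, if_neg (h2 x)]
      exact h₁.reg r fun i _ => h1 i

/-- A many-one reduction: parameters are computed from the input, and then a list that serves as
input for another program. The input is first moved away, to an address kept in the variable `base`.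
The variable `size` bounds the length of the input, and `thr` is the threshold to which the output
of the other program is compared. -/
structure Reduction where
  params : List (ℕ × Ex)
  gen : Gen
  base : ℕ
  size : ℕ
  thr : ℕ

/-- Move the input to the address in the variable `base`. -/
def Reduction.moveInput (r : Reduction) (R : ℕ) : Prog :=
  .seq (mov R (rTmp R 0) (rVar R r.size))
    (.loop (rTmp R 0)
      (.seq (.arith .plus (rTmp R 1) (rVar R r.base) (rPtr R))
      (.seq (.load (rTmp R 2) (rPtr R))
      (.seq (.store (rTmp R 1) (rTmp R 2))
      (.seq (.store (rPtr R) (rZero R))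
      (.seq (.arith .plus (rPtr R) (rPtr R) (rOne R))
        (.arith .monus (rTmp R 0) (rTmp R 0) (rOne R))))))))

/-- Erase the moved input. -/
def Reduction.clearInput (r : Reduction) (R : ℕ) : Prog :=
  .seq (mov R (rTmp R 0) (rVar R r.size)) (.seq (mov R (rPtr R) (rBase R))
    (.loop (rTmp R 0)
      (.seq (.store (rPtr R) (rZero R))
      (.seq (.arith .plus (rPtr R) (rPtr R) (rOne R))
        (.arith .monus (rTmp R 0) (rTmp R 0) (rOne R))))))

/-- Compute the input of the other program. -/
def Reduction.prepare (r : Reduction) (R : ℕ) : Prog :=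
  .seq (.const (rOne R) 1) (.seq (compileParams R r.params) (.seq (r.moveInput R)
    (.seq (.const (rPtr R) 0) (.seq (mov R (rBase R) (rVar R r.base))
      (.seq (r.gen.compile R 0) (r.clearInput R))))))

/-- Run `P` on the computed list, and decide whether its output exceeds the threshold. -/
def Reduction.prog (r : Reduction) (P : Prog) : Prog :=
  let R := P.regBound + 1
  .seq (r.prepare R) (.seq P (.seq (.arith .monus 0 0 (rVar R r.thr))
    (.seq (.arith .monus 0 (rOne R) 0) (.arith .monus 0 (rOne R) 0))))

/-- A bound on the time of a reduction, without the time of the other program. -/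
def Reduction.cost (r : Reduction) (Z X : ℕ) : ℕ :=
  paramsCost Z r.params + r.gen.cost Z X + Z * (14 * (Z + 2)) + Z * (7 * (Z + 2)) + 20 * (Z + 2)

theorem Reduction.moveInput_runs {R Z S b : ℕ} {M : ℕ → ℕ} (r : Reduction) (s : State)
    (hs : Ready R M Z s) (hm : s.mem = M) (hS : s.reg (rVar R r.size) = S)
    (hb : s.reg (rVar R r.base) = b) (hM : ∀ a, S ≤ a → M a = 0) (hSb : S ≤ b) (hbS : b + S < 2 ^ Z)
    (hSZ : S ≤ Z) (hp : s.reg (rPtr R) = 0) :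
    Runs (r.moveInput R) s (Z * (14 * (Z + 2)) + 2 * (Z + 2)) fun s' =>
      (s'.mem = fun a => if a < b then 0 else M (a - b)) ∧
      ∀ r, (∀ i, r ≠ rTmp R i) → r ≠ rPtr R → s'.reg r = s.reg r := by
  have hZ : Z < 2 ^ Z := Nat.lt_two_pow_self
  refine Runs.mono (τ := (Z + 2) + (S * (((Z + Z + 2) + ((Z + Z + 2) + ((Z + Z + 2) +
    ((Z + 0 + 2) + ((Z + 1 + 2) + (Z + 1 + 2)))))) + Z + 1) + 1)) ?_ ?_ fun _ h => h
  rotate_left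
  · have : S * (((Z + Z + 2) + ((Z + Z + 2) + ((Z + Z + 2) +
      ((Z + 0 + 2) + ((Z + 1 + 2) + (Z + 1 + 2)))))) + Z + 1) ≤ Z * (14 * (Z + 2)) :=
      Nat.mul_le_mul hSZ (by omega)
    omega
  refine (Runs.mov (Q := fun s' => s' = _) hs.zero (hs.var_lt _) rfl).seq ?_
  rintro _ rfl
  refine (Runs.loop (n := S) (v := Z) (I := fun j s' =>
    (s'.mem = fun a => if a < j then 0 else if a < b then M a else
      if a < b + j then M (a - b) else 0) ∧ s'.reg (rPtr R) = j ∧ s'.reg (rTmp R 0) = S - j ∧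
    ∀ r, (∀ i, r ≠ rTmp R i) → r ≠ rPtr R → s'.reg r = s.reg r)
    (by omega) (fun j s' h => h.2.2.1) ?_ _ ?_).mono le_rfl ?_
  · rintro j s' hj ⟨hmj, hpj, hcj, hr⟩
    have hbj : s'.reg (rVar R r.base) = b := by rw [hr _ (by simp) (by simp), hb]
    have hz : s'.reg (rZero R) = 0 := by rw [hr _ (by simp) (by simp), hs.zero]
    have ho : s'.reg (rOne R) = 1 := by rw [hr _ (by simp) (by simp), hs.one]
    have hmp : s'.mem j = M j := by
      simp only [hmj]
      rw [if_neg (by omega), if_pos (by omega)]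
    have hjlt : j < 2 ^ Z := by omega
    refine (Runs.arith (v := Z) (w := Z) (Q := fun s' => s' = _) (by rw [hbj]; omega)
      (by rw [hpj]; omega) rfl).seq ?_
    rintro _ rfl
    refine (Runs.load (v := Z) (w := Z) (Q := fun s' => s' = _) (by simpa [hpj] using hjlt)
      (by simpa [hpj, hmp] using hs.input_lt _) rfl).seq ?_
    rintro _ rfl
    refine (Runs.store (v := Z) (w := Z) (Q := fun s' => s' = _)
      (by simp [hpj, hbj, ArithOp.apply]; omega)
      (by simpa [hpj, hmp] using hs.input_lt _) rfl).seq ?_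
    rintro _ rfl
    refine (Runs.store (v := Z) (w := 0) (Q := fun s' => s' = _) (by simpa [hpj] using hjlt)
      (by simp [hz]) rfl).seq ?_
    rintro _ rfl
    refine (Runs.arith (v := Z) (w := 1) (Q := fun s' => s' = _) (by simpa [hpj] using hjlt)
      (by simp [ho]) rfl).seq ?_
    rintro _ rfl
    refine Runs.arith (v := Z) (w := 1) (by simp [hcj]; omega)
      (by simp [ho]) ⟨?_, by simp [hpj, ho, ArithOp.apply],
        by simp [hcj, ho, ArithOp.apply]; omega, ?_⟩
    · funext a
      simp only [State.setReg_mem, State.setMem_mem, State.setReg_reg, State.setMem_reg,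
        Function.update_apply, hpj, hbj, hz, hmj, ArithOp.apply, Reg.addr_inj, if_true,
        reduceCtorEq, if_false, Reg.tmp.injEq, OfNat.one_ne_ofNat]
      split_ifs <;> first | rfl | (exfalso; omega) | (congr 1; omega)
    · intro x hx1 hx2
      simp only [State.setReg_reg, State.setMem_reg, if_neg (hx1 _), if_neg hx2]
      exact hr x hx1 hx2
  · refine ⟨?_, by simpa using hp, by simpa using hS, fun x hx1 _ => by simp [hx1 0]⟩
    funext a
    simp only [State.setReg_mem, hm, Nat.not_lt_zero, if_false, add_zero]
    split_ifs
    · rfl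
    · exact hM a (by omega)
  · rintro s' ⟨hmj, -, -, hr⟩
    refine ⟨?_, hr⟩
    rw [hmj]
    funext a
    by_cases h2 : a < b
    · rw [if_pos h2, if_pos h2]
      split_ifs
      · rfl
      · exact hM a (by omega)
    · rw [if_neg h2, if_neg h2, if_neg (by omega)]
      split_ifs
      · rfl
      · exact (hM _ (by omega)).symm

theorem Reduction.clearInput_runs {R Z S b : ℕ} {M : ℕ → ℕ} (r : Reduction) (s : State)
    (hs : Ready R M Z s) (hS : s.reg (rVar R r.size) = S)
    (hb : s.reg (rBase R) = b) (hbS : b + S < 2 ^ Z) (hSZ : S ≤ Z) :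
    Runs (r.clearInput R) s (Z * (7 * (Z + 2)) + 3 * (Z + 2)) fun s' =>
      (s'.mem = fun a => if b ≤ a ∧ a < b + S then 0 else s.mem a) ∧
      ∀ r, (∀ i, r ≠ rTmp R i) → r ≠ rPtr R → s'.reg r = s.reg r := by
  have hZ : Z < 2 ^ Z := Nat.lt_two_pow_self
  refine Runs.mono (τ := (Z + 2) + ((Z + 2) + (S * (((Z + 0 + 2) + ((Z + 1 + 2) + (Z + 1 + 2)))
    + Z + 1) + 1))) ?_ ?_ fun _ h => h
  rotate_left
  · have : S * (((Z + 0 + 2) + ((Z + 1 + 2) + (Z + 1 + 2))) + Z + 1) ≤ Z * (7 * (Z + 2)) :=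
      Nat.mul_le_mul hSZ (by omega)
    omega
  refine (Runs.mov (Q := fun s' => s' = _) hs.zero (hs.var_lt _) rfl).seq ?_
  rintro _ rfl
  refine (Runs.mov (v := Z) (Q := fun s' => s' = _) (by simpa using hs.zero)
    (by simpa using hs.base_lt) rfl).seq ?_
  rintro _ rfl
  refine (Runs.loop (n := S) (v := Z) (I := fun j s' =>
    (s'.mem = fun a => if b ≤ a ∧ a < b + j then 0 else s.mem a) ∧ s'.reg (rPtr R) = b + j ∧
    s'.reg (rTmp R 0) = S - j ∧ ∀ r, (∀ i, r ≠ rTmp R i) → r ≠ rPtr R → s'.reg r = s.reg r)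
    (by omega) (fun j s' h => h.2.2.1) ?_ _ ?_).mono le_rfl fun s' h => ⟨h.1, h.2.2.2⟩
  · rintro j s' hj ⟨hmj, hpj, hcj, hr⟩
    have hz : s'.reg (rZero R) = 0 := by rw [hr _ (by simp) (by simp), hs.zero]
    have ho : s'.reg (rOne R) = 1 := by rw [hr _ (by simp) (by simp), hs.one]
    have hjlt : b + j < 2 ^ Z := by omega
    refine (Runs.store (v := Z) (w := 0) (Q := fun s' => s' = _) (by rw [hpj]; exact hjlt)
      (by simp [hz]) rfl).seq ?_
    rintro _ rfl
    refine (Runs.arith (v := Z) (w := 1) (Q := fun s' => s' = _) (by simpa [hpj] using hjlt)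
      (by simp [ho]) rfl).seq ?_
    rintro _ rfl
    refine Runs.arith (v := Z) (w := 1) (by simp [hcj]; omega)
      (by simp [ho]) ⟨?_, by simp [hpj, ho, ArithOp.apply]; omega,
        by simp [hcj, ho, ArithOp.apply]; omega, ?_⟩
    · funext a
      simp only [State.setReg_mem, State.setMem_mem, Function.update_apply, hpj, hz, hmj]
      by_cases h : a = b + j
      · rw [if_pos h, if_pos (by omega)]
      · rw [if_neg h]
        by_cases h' : b ≤ a ∧ a < b + j
        · rw [if_pos h', if_pos (by omega)]
        · rw [if_neg h', if_neg (by omega)]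
    · intro x hx1 hx2
      simp only [State.setReg_reg, State.setMem_reg, if_neg (hx1 _), if_neg hx2]
      exact hr x hx1 hx2
  · refine ⟨?_, by simpa using hb, by simpa using hS, fun x hx1 hx2 => by simp [hx1 0, hx2]⟩
    funext a
    simp only [State.setReg_mem]
    rw [if_neg (by omega)]

/-- The hypotheses under which a reduction works: `Z` bounds the lengths of all numbers, and `X` the
number of rounds of the long loops. -/
structure Reduction.Valid (r : Reduction) (input : List ℕ) (Z X : ℕ) (ρ : ℕ → ℕ) : Prop where
  env : ρ = paramEnv (fun a => input.getD a 0) r.params fun _ => 0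
  input_lt : ∀ a, input.getD a 0 < 2 ^ Z
  params_ok : ParamsOk (fun a => input.getD a 0) Z r.params fun _ => 0
  gen_ok : r.gen.Ok (fun a => input.getD a 0) Z X ρ
  X_lt : X < 2 ^ Z
  size_le : ρ r.size ≤ Z
  length_le : input.length ≤ ρ r.size
  size_le_base : ρ r.size ≤ ρ r.base
  base_lt : ρ r.base + ρ r.size < 2 ^ Z
  den_le : (r.gen.den (fun a => input.getD a 0) ρ).length ≤ ρ r.base

theorem Reduction.prepare_runs {r : Reduction} {input : List ℕ} {Z X : ℕ} {ρ : ℕ → ℕ}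
    (h : r.Valid input Z X ρ) (R : ℕ) :
    Runs (r.prepare R) (State.start input) (paramsCost Z r.params + r.gen.cost Z X +
      Z * (14 * (Z + 2)) + Z * (7 * (Z + 2)) + 10 * (Z + 2)) fun s' =>
      s'.mem = (State.start (r.gen.den (fun a => input.getD a 0) ρ)).mem ∧
      (∀ x < R, s'.reg x = 0) ∧ s'.reg (rOne R) = 1 ∧ ∀ x, s'.reg (rVar R x) = ρ x := by
  obtain ⟨henv, hin, hpar, hgen, hX, hSZ, hlen, hSb, hbS, hden⟩ := h
  set M : ℕ → ℕ := fun a => input.getD a 0 with hM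
  have hZ : Z < 2 ^ Z := Nat.lt_two_pow_self
  refine Runs.mono (τ := 2 + (paramsCost Z r.params + ((Z * (14 * (Z + 2)) + 2 * (Z + 2)) +
    (1 + ((Z + 2) + (r.gen.cost Z X + (Z * (7 * (Z + 2)) + 3 * (Z + 2)))))))) ?_ (by omega)
    fun _ h => h
  refine (Runs.const (v := 1) (Q := fun s' => s' = _) (by simp) rfl).seq ?_
  rintro _ rfl
  set s₀ := (State.start input).setReg (rOne R) 1 with hs₀
  have hr₀ : Ready R M Z s₀ := by
    refine ⟨by simp [hs₀, State.start], by simp [hs₀], fun a => ?_, hin, by simp [hs₀, State.start],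
      fun x => by simp [hs₀, State.start]⟩
    simp [hs₀, State.start, hM]
  have he₀ : s₀.env R = fun _ => 0 := by
    funext x
    simp [State.env, hs₀, State.start]
  refine (compileParams_runs r.params s₀ hr₀ (by rw [he₀]; exact hpar)).seq ?_
  rintro s₁ ⟨m₁, e₁, hs₁, r₁⟩
  rw [he₀, ← henv] at e₁
  have hv₁ : ∀ x, s₁.reg (rVar R x) = ρ x := fun x => congrFun e₁ x
  have p₁ : s₁.reg (rPtr R) = 0 := by
    rw [r₁ _ (by simp) (by simp)]
    simp [hs₀, State.start]
  refine (r.moveInput_runs s₁ hs₁ m₁ (hv₁ _) (hv₁ _) (fun a ha => ?_) hSb hbS hSZ p₁).seq ?_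
  · exact List.getD_eq_default _ _ (hlen.trans ha)
  rintro s₂ ⟨m₂, r₂⟩
  have hv₂ : ∀ x, s₂.reg (rVar R x) = ρ x := fun x => by rw [r₂ _ (by simp) (by simp), hv₁]
  have z₂ : s₂.reg (rZero R) = 0 := by rw [r₂ _ (by simp) (by simp), hs₁.zero]
  have o₂ : s₂.reg (rOne R) = 1 := by rw [r₂ _ (by simp) (by simp), hs₁.one]
  refine (Runs.const (v := 0) (Q := fun s' => s' = _) (by simp) rfl).seq ?_
  rintro _ rfl
  refine (Runs.mov (v := Z) (Q := fun s' => s' = _) (by simpa using z₂)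
    (by simp [hv₂]; omega) rfl).seq ?_
  rintro _ rfl
  set s₃ := (s₂.setReg (rPtr R) 0).setReg (rBase R) ((s₂.setReg (rPtr R) 0).reg (rVar R r.base))
    with hs₃
  have hb₃ : s₃.reg (rBase R) = ρ r.base := by simp [hs₃, hv₂]
  have hp₃ : s₃.reg (rPtr R) = 0 := by simp [hs₃]
  have hm₃ : s₃.mem = fun a => if a < ρ r.base then 0 else M (a - ρ r.base) := m₂
  have he₃ : s₃.env R = ρ := by
    funext x
    simp [State.env, hs₃, hv₂]
  have hr₃ : Ready R M Z s₃ := by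
    refine ⟨by simpa [hs₃] using z₂, by simpa [hs₃] using o₂, fun a => ?_, hin, ?_, fun x => ?_⟩
    · rw [hb₃, hm₃]
      simp
    · rw [hb₃]; omega
    · change s₃.env R x < _
      rw [he₃, ← e₁]
      exact hs₁.var_lt x
  refine (r.gen.compile_runs hX 0 s₃ hr₃ (by rw [he₃]; exact hgen)
    (by rw [he₃, hp₃, hb₃]; omega)).seq ?_
  intro s₄ h₄
  rw [he₃] at h₄
  have hb₄ : s₄.reg (rBase R) = ρ r.base := by rw [h₄.reg _ (by simp) (by simp), hb₃]
  have hv₄ : ∀ x, s₄.reg (rVar R x) = ρ x := fun x => by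
    rw [h₄.reg _ (by simp) (by simp)]
    exact congrFun he₃ x
  have hr₄ := h₄.ready hr₃ (by rw [hp₃, hb₃]; omega)
  refine (r.clearInput_runs s₄ hr₄ (hv₄ _) hb₄ hbS hSZ).mono le_rfl ?_
  rintro s₅ ⟨m₅, r₅⟩
  refine ⟨?_, fun x hx => ?_, ?_, fun x => by rw [r₅ _ (by simp) (by simp), hv₄]⟩
  · rw [m₅, h₄.mem, hp₃]
    funext a
    simp only [writeList_apply, Nat.zero_le, true_and, zero_add, Nat.sub_zero, State.start, hm₃]
    split_ifs with h1 h2 h3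
    · rw [List.getD_eq_default _ _ (by omega)]
    · rfl
    · rw [List.getD_eq_default _ _ (by omega)]
    · rw [List.getD_eq_default _ _ (by omega)]
      exact List.getD_eq_default _ _ (by omega)
  · have hne : ∀ g : Reg, x ≠ g.addr R := fun g => by
      have := g.le_addr (R := R)
      omega
    rw [r₅ _ (fun i => hne _) (hne _), h₄.reg _ (hne _) fun i _ => hne _]
    simp only [hs₃, State.setReg_reg, if_neg (hne _)]
    rw [r₂ _ (fun i => hne _) (hne _), r₁ _ (fun i => hne _) fun i => hne _]
    simp only [hs₀, State.setReg_reg, if_neg (hne _)]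
    rfl
  · rw [r₅ _ (by simp) (by simp)]
    exact hr₄.one

/-- A reduction turns a program `P` into one that compares the output of `P` on the computed list to
the threshold. -/
theorem Reduction.halts {r : Reduction} {input : List ℕ} {Z X : ℕ} {ρ : ℕ → ℕ}
    (h : r.Valid input Z X ρ) {P : Prog} {out t : ℕ}
    (hP : HaltsWith P (r.gen.den (fun a => input.getD a 0) ρ) out t) (hout : out < 2 ^ Z)
    (hthr : ρ r.thr < 2 ^ Z) :
    ∃ t', HaltsWith (r.prog P) input (if ρ r.thr < out then 1 else 0) t' ∧ t' ≤ t + r.cost Z X := by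
  set R := P.regBound + 1 with hR
  obtain ⟨t₁, s₁, e₁, ht₁, m₁, z₁, o₁, v₁⟩ := r.prepare_runs h R
  obtain ⟨s, e, hs⟩ := hP
  obtain ⟨s₂, e₂, r₂, -, f₂⟩ := e.transfer R (by omega) s₁ (fun x hx => by rw [z₁ x hx]; rfl) m₁
  have h0 : s₂.reg 0 = out := by rw [r₂ 0 (by omega), hs]
  have hthr₂ : s₂.reg (rVar R r.thr) = ρ r.thr := by rw [f₂ _ (Reg.le_addr _), v₁]
  have hone₂ : s₂.reg (rOne R) = 1 := by rw [f₂ _ (Reg.le_addr _), o₁]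
  have hne : ∀ g : Reg, g.addr R ≠ 0 := fun g => by
    have := g.le_addr (R := R)
    omega
  have hfin : Runs (.seq (.arith .monus 0 0 (rVar R r.thr))
      (.seq (.arith .monus 0 (rOne R) 0) (.arith .monus 0 (rOne R) 0))) s₂
      ((Z + Z + 2) + ((1 + Z + 2) + (1 + 1 + 2)))
      fun s' => s'.reg 0 = if ρ r.thr < out then 1 else 0 := by
    refine (Runs.arith (Q := fun s' => s' = _) (by rw [h0]; exact hout)
      (by rw [hthr₂]; exact hthr) rfl).seq ?_
    rintro _ rfl
    refine (Runs.arith (Q := fun s' => s' = _) (by simp [hne, hone₂])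
      (by simp [ArithOp.apply, h0]; omega) rfl).seq ?_
    rintro _ rfl
    refine Runs.arith (by simp [hne, hone₂]) ?_ ?_
    · simp [ArithOp.apply, hone₂, hne]
    · simp only [State.setReg_reg, ArithOp.apply, if_true, if_neg (hne _), hone₂, hthr₂, h0]
      split_ifs <;> omega
  obtain ⟨t₃, s₃, e₃, ht₃, hs₃⟩ := hfin
  refine ⟨_, ⟨s₃, e₁.seq (e₂.seq e₃), hs₃⟩, ?_⟩
  simp only [Reduction.cost]
  omega

end RAM

namespace KLCS

open scoped List

/-! ### Common subsequences of lists that are cut into blocks -/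

/-- `T t` is the number of the block of `B 0, B 1, …` in which the letter `f t` of a subsequence `f`
of the concatenation of these blocks is found. -/
structure Tagging {α : Type*} {m : ℕ} (f : Fin m → α) (B : ℕ → List α) (T : Fin m → ℕ) : Prop where
  mono : Monotone T
  sub : ∀ x, ((List.finRange m).filter fun t => T t = x).map f <+ B x

theorem exists_tagging {α : Type*} {m K : ℕ} {f : Fin m → α} {B : ℕ → List α}
    (h : List.ofFn f <+ (List.range K).flatMap B) :
    ∃ T : Fin m → ℕ, Tagging f B T ∧ ∀ t, T t < K := by
  set tagged : List (α × ℕ) := (List.range K).flatMap fun x => (B x).map fun a => (a, x) with ht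
  have hfst : tagged.map Prod.fst = (List.range K).flatMap B := by
    simp [ht, List.map_flatMap, Function.comp_def]
  rw [← hfst, List.sublist_map_iff] at h
  obtain ⟨w, hw, hf⟩ := h
  have hlen : w.length = m := by simpa using (congrArg List.length hf).symm
  obtain ⟨g, rfl⟩ : ∃ g : Fin m → α × ℕ, w = List.ofFn g := by
    subst hlen
    exact ⟨w.get, (List.ofFn_get w).symm⟩
  have hg : ∀ t, (g t).1 = f t := by
    rw [List.map_ofFn] at hf
    intro t
    exact (congrFun (List.ofFn_injective hf) t).symm
  have hpw : tagged.Pairwise fun p q => p.2 ≤ q.2 := by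
    rw [ht, List.pairwise_flatMap]
    refine ⟨fun x _ => ?_, ?_⟩
    · rw [List.pairwise_map]
      exact List.pairwise_of_forall fun _ _ => le_rfl
    · refine List.pairwise_lt_range.imp fun {a b} hab => ?_
      simp only [List.mem_map]
      rintro _ ⟨_, _, rfl⟩ _ ⟨_, _, rfl⟩
      exact hab.le
  refine ⟨fun t => (g t).2, ⟨?_, fun x => ?_⟩, fun t => ?_⟩
  · have := List.pairwise_ofFn.1 (hpw.sublist hw)
    intro a b hab
    rcases hab.lt_or_eq with h | rfl
    · exact this h
    · exact le_rfl
  · have h1 := (hw.filter fun p => p.2 = x).map Prod.fst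
    have h2 : ((List.finRange m).filter fun t => (g t).2 = x).map f =
        ((List.ofFn g).filter fun p => p.2 = x).map Prod.fst := by
      rw [List.ofFn_eq_map, List.filter_map, List.map_map]
      refine List.map_congr_left fun t _ => ?_
      simp [hg]
    rw [h2]
    refine h1.trans ?_
    rw [ht, List.filter_flatMap, List.map_flatMap]
    by_cases hx : x < K
    · have : ((List.range K).flatMap fun y =>
          (((B y).map fun a => (a, y)).filter fun p => p.2 = x).map Prod.fst) =
          (List.range K).flatMap fun y => if y = x then B x else [] := by
        congr 1
        funext y
        by_cases hy : y = x
        · subst hy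
          simp [List.filter_map, Function.comp_def]
        · simp [List.filter_map, Function.comp_def, hy]
      rw [this]
      obtain ⟨c, rfl⟩ := Nat.exists_eq_add_of_lt hx
      rw [show x + c + 1 = x + (1 + c) by omega, List.range_add, List.range_add]
      simp only [List.flatMap_append, List.map_append, List.flatMap_map]
      have e1 : (List.range x).flatMap (fun y => if y = x then B x else []) = [] := by
        refine List.flatMap_eq_nil_iff.2 fun y hy => ?_
        rw [List.mem_range] at hy
        rw [if_neg (by omega)]
      simp [e1]
    · rw [List.flatMap_eq_nil_iff.2]
      · simp
      · intro y hy
        simp at hy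
        have : y ≠ x := by omega
        simp [List.filter_map, Function.comp_def, this]
  · have : g t ∈ tagged := hw.subset (List.mem_ofFn.2 ⟨t, rfl⟩)
    simp only [ht, List.mem_flatMap, List.mem_map, List.mem_range] at this
    obtain ⟨x, hx, a, -, hgt⟩ := this
    have : (g t).2 = x := by rw [← hgt]
    change (g t).2 < K
    omega

namespace Tagging

variable {α : Type*} {m : ℕ} {f : Fin m → α} {B : ℕ → List α} {T : Fin m → ℕ}

theorem sub_of (h : Tagging f B T) {x : ℕ} {p : Fin m → Prop} [DecidablePred p]
    (hp : ∀ t, p t → T t = x) : ((List.finRange m).filter p).map f <+ B x := by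
  refine List.Sublist.trans (List.Sublist.map f ?_) (h.sub x)
  exact List.monotone_filter_right _ fun t ht => by simpa using hp t (by simpa using ht)

theorem mem (h : Tagging f B T) (t : Fin m) : f t ∈ B (T t) :=
  (h.sub (T t)).subset (List.mem_map.2 ⟨t, by simp, rfl⟩)

theorem length_filter (p : Fin m → Prop) [DecidablePred p] :
    ((List.finRange m).filter p).length = (Finset.univ.filter p).card := by
  rw [← List.toFinset_card_of_nodup ((List.nodup_finRange m).filter _)]
  congr 1
  ext t
  simp

theorem card_le (h : Tagging f B T) {x : ℕ} {p : Fin m → Prop} [DecidablePred p]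
    (hp : ∀ t, p t → T t = x) : (Finset.univ.filter p).card ≤ (B x).length := by
  rw [← length_filter]
  simpa using (h.sub_of hp).length_le

theorem card_le_count [DecidableEq α] (h : Tagging f B T) {x : ℕ} {a : α} {p : Fin m → Prop}
    [DecidablePred p] (hp : ∀ t, p t → T t = x) (ha : ∀ t, p t → f t = a) :
    (Finset.univ.filter p).card ≤ (B x).count a := by
  have h1 := (h.sub_of hp).count_le a
  rw [List.count_eq_length.2] at h1
  · rw [← length_filter]
    simpa using h1
  · intro b hb
    obtain ⟨t, ht, rfl⟩ := List.mem_map.1 hb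
    exact (ha t (by simpa using ht)).symm

theorem rel (h : Tagging f B T) {t t' : Fin m} (htt : t < t') (hT : T t = T t')
    {R : α → α → Prop} (hR : (B (T t)).Pairwise R) : R (f t) (f t') := by
  have h1 := hR.sublist (h.sub (T t))
  rw [List.pairwise_map] at h1
  have h2 : [t, t'] <+ (List.finRange m).filter fun s => T s = T t := by
    have h3 : [t, t'] <+ List.finRange m := by
      refine List.sublist_of_subperm_of_pairwise (r := (· < ·)) ?_ (by simpa using htt)
        (List.pairwise_lt_finRange m)
      exact List.subperm_of_subset (by simp [htt.ne]) (by simp)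
    simpa [hT] using h3.filter fun s => T s = T t
  simpa using h1.sublist h2

end Tagging

theorem flatMap_sublist {α β : Type*} (l : List α) {f g : α → List β} (h : ∀ x ∈ l, f x <+ g x) :
    l.flatMap f <+ l.flatMap g := by
  induction l with
  | nil => simp
  | cons x l ih =>
    simp only [List.flatMap_cons]
    exact (h x (by simp)).append (ih fun y hy => h y (by simp [hy]))

/-- The blocks `A 0, C 0, A 1, C 1, …`. -/
def alternate {α : Type*} (A C : ℕ → List α) (x : ℕ) : List α :=
  if x % 2 = 0 then A (x / 2) else C (x / 2)

theorem alternate_flatMap {α : Type*} (A C : ℕ → List α) (n : ℕ) :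
    (List.range (2 * n + 1)).flatMap (alternate A C) =
      A 0 ++ (List.range n).flatMap fun r => C r ++ A (r + 1) := by
  induction n with
  | zero => simp [alternate]
  | succ n ih =>
    rw [show 2 * (n + 1) + 1 = 2 * n + 1 + 1 + 1 by ring, List.range_succ, List.range_succ,
      List.flatMap_append, List.flatMap_append, ih, List.range_succ, List.flatMap_append]
    have h1 : (2 * n + 1) % 2 = 1 := by omega
    have h2 : (2 * n + 1) / 2 = n := by omega
    have h3 : (2 * n + 1 + 1) % 2 = 0 := by omega
    have h4 : (2 * n + 1 + 1) / 2 = n + 1 := by omega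
    simp [alternate, h1, h2, h3, h4]

end KLCS

namespace KLCS

open scoped List

/-! ### Gadgets for the clauses and for the assignments -/

/-- The letter number `l` of a clause gadget in string `i`; the Boolean `b` tells whether the partial
assignment satisfies the clause. Letter `3 * k + i` occurs in string `i` only. -/
def clauseLetter (k i : ℕ) (b : Bool) (l : ℕ) : ℕ :=
  if l = i ∧ b = false then 3 * k + i else 2 * k + l

/-- The clause gadget: `2 * k, …, 3 * k - 1` in ascending order in string `0` and in descending
order in the other strings, where string `i` has the letter `2 * k + i` only if the clause is
satisfied. -/
def clauseGadget (k i : ℕ) (b : Bool) : List ℕ :=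
  (List.range k).map fun l => clauseLetter k i b (if i = 0 then l else k - 1 - l)

/-- The clause gadgets of `m` clauses, separated by `w` copies of the letter `4 * k`. -/
def clausesGadget (k w m i : ℕ) (b : ℕ → Bool) : List ℕ :=
  List.replicate w (4 * k) ++
    (List.range m).flatMap fun r => clauseGadget k i (b r) ++ List.replicate w (4 * k)

/-- The gadget of an assignment: the clause gadgets, or alternatively `e` copies of the letter
`4 * k + 1`. As the order of the alternatives is different in string `0`, they exclude each other. -/
def gadget (k w m e i : ℕ) (b : ℕ → Bool) : List ℕ :=
  if i = 0 then List.replicate e (4 * k + 1) ++ clausesGadget k w m i b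
  else clausesGadget k w m i b ++ List.replicate e (4 * k + 1)

theorem length_clauseGadget (k i : ℕ) (b : Bool) : (clauseGadget k i b).length = k := by
  simp [clauseGadget]

theorem length_clausesGadget (k w m i : ℕ) (b : ℕ → Bool) :
    (clausesGadget k w m i b).length = (m + 1) * w + m * k := by
  simp [clausesGadget, length_clauseGadget, List.length_flatMap]
  ring

theorem length_gadget (k w m e i : ℕ) (b : ℕ → Bool) :
    (gadget k w m e i b).length = e + (m + 1) * w + m * k := by
  rw [gadget]
  split_ifs <;> simp only [List.length_append, List.length_replicate, length_clausesGadget] <;> ring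

theorem mem_clauseGadget {k i a : ℕ} {b : Bool} (h : a ∈ clauseGadget k i b) :
    (∃ l < k, a = 2 * k + l ∧ (l = i → b = true)) ∨ a = 3 * k + i := by
  simp only [clauseGadget, List.mem_map, List.mem_range, clauseLetter] at h
  obtain ⟨l, hl, rfl⟩ := h
  set l' := if i = 0 then l else k - 1 - l with hl'
  have : l' < k := by rw [hl']; split_ifs <;> omega
  by_cases hc : l' = i ∧ b = false
  · right; rw [if_pos hc]
  · left
    refine ⟨l', this, by rw [if_neg hc], fun h => ?_⟩
    by_contra hb
    exact hc ⟨h, by simpa using hb⟩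

theorem mem_clausesGadget {k w m i a : ℕ} {b : ℕ → Bool}
    (h : a ∈ clausesGadget k w m i b) :
    (2 * k ≤ a ∧ a < 3 * k) ∨ a = 3 * k + i ∨ a = 4 * k := by
  simp only [clausesGadget, List.mem_append, List.mem_replicate, List.mem_flatMap] at h
  rcases h with h | ⟨r, -, h | h⟩
  · exact .inr (.inr h.2)
  · rcases mem_clauseGadget h with ⟨l, hl, rfl, -⟩ | h
    · left; omega
    · exact .inr (.inl h)
  · exact .inr (.inr h.2)

theorem mem_gadget {k w m e i a : ℕ} {b : ℕ → Bool} (h : a ∈ gadget k w m e i b) :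
    (2 * k ≤ a ∧ a < 3 * k) ∨ a = 3 * k + i ∨ a = 4 * k ∨ a = 4 * k + 1 := by
  have : a ∈ clausesGadget k w m i b ∨ a = 4 * k + 1 := by
    rw [gadget] at h
    split_ifs at h <;> simp only [List.mem_append, List.mem_replicate] at h <;> tauto
  rcases this with h | h
  · have := mem_clausesGadget h
    tauto
  · tauto

theorem sublist_clauseGadget {k i l : ℕ} {b : Bool} (hl : l < k) (h : l = i → b = true) :
    [2 * k + l] <+ clauseGadget k i b := by
  rw [List.singleton_sublist, clauseGadget, List.mem_map]
  by_cases hi : i = 0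
  · refine ⟨l, by simpa using hl, ?_⟩
    rw [if_pos hi, clauseLetter, if_neg]
    rintro ⟨h1, h2⟩
    simp [h h1] at h2
  · refine ⟨k - 1 - l, by simp; omega, ?_⟩
    rw [if_neg hi, show k - 1 - (k - 1 - l) = l by omega, clauseLetter, if_neg]
    rintro ⟨h1, h2⟩
    simp [h h1] at h2

theorem clauseGadget_zero_pairwise (k : ℕ) (b : Bool) :
    (clauseGadget k 0 b).Pairwise fun x y => x < 3 * k → y < 3 * k → x < y := by
  rw [clauseGadget, List.pairwise_map]
  refine List.pairwise_lt_range.imp fun {x y} h => ?_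
  simp only [clauseLetter, if_true]
  split_ifs <;> omega

theorem clauseGadget_one_pairwise (k : ℕ) (b : Bool) :
    (clauseGadget k 1 b).Pairwise fun x y => x < 3 * k → y < 3 * k → y < x := by
  rw [clauseGadget, List.pairwise_map]
  refine List.Pairwise.imp_of_mem (fun {x y} hx hy h => ?_) List.pairwise_lt_range
  rw [List.mem_range] at hx hy
  simp only [clauseLetter, one_ne_zero, if_false]
  split_ifs <;> omega

/-- If every clause is satisfied by one of the partial assignments, then the clause gadgets have a
common subsequence that takes all separators and a letter for every clause. -/
theorem exists_common_clausesGadget {k w m : ℕ} {b : ℕ → ℕ → Bool}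
    (h : ∀ r < m, ∃ i < k, b i r = true) :
    ∃ z : List ℕ, z.length = (m + 1) * w + m ∧ ∀ i, z <+ clausesGadget k w m i (b i) := by
  have : ∀ r, ∃ i, r < m → i < k ∧ b i r = true := by
    intro r
    by_cases hr : r < m
    · obtain ⟨i, hi⟩ := h r hr
      exact ⟨i, fun _ => hi⟩
    · exact ⟨0, fun h => absurd h hr⟩
  choose c hc using this
  refine ⟨List.replicate w (4 * k) ++
    (List.range m).flatMap fun r => [2 * k + c r] ++ List.replicate w (4 * k), ?_, fun i => ?_⟩
  · simp [List.length_flatMap]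
    ring
  · refine (List.Sublist.refl _).append (flatMap_sublist _ fun r hr => ?_)
    obtain ⟨h1, h2⟩ := hc r (by simpa using hr)
    exact (sublist_clauseGadget h1 fun h => h ▸ h2).append (List.Sublist.refl _)

/-- A common subsequence of that length exists only if every clause is satisfied: it misses so few
separators that each of its other letters lies in the gadgets of the same clause in all strings, and
the opposite orders of the gadgets allow only one letter per clause. -/
theorem satisfied_of_common_clausesGadget {k m : ℕ} (hk : 2 ≤ k) {b : ℕ → ℕ → Bool} {z : List ℕ}
    (hz : ∀ i < k, z <+ clausesGadget k (k * m + 1) m i (b i))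
    (hlen : (m + 1) * (k * m + 1) + m ≤ z.length) : ∀ r < m, ∃ i < k, b i r = true := by
  set w := k * m + 1 with hw
  set B : ℕ → ℕ → List ℕ := fun i => alternate (fun _ => List.replicate w (4 * k))
    (fun r => clauseGadget k i (b i r)) with hB
  set f : Fin z.length → ℕ := z.get with hf
  have htag : ∀ i, ∃ T : Fin z.length → ℕ,
      i < k → Tagging f (B i) T ∧ ∀ t, T t < 2 * m + 1 := by
    intro i
    by_cases hi : i < k
    · obtain ⟨T, hT⟩ := exists_tagging (f := f) (B := B i) (K := 2 * m + 1) (by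
        rw [hf, List.ofFn_get, hB, alternate_flatMap]
        exact hz i hi)
      exact ⟨T, fun _ => hT⟩
    · exact ⟨fun _ => 0, fun h => absurd h hi⟩
  choose T hT using htag
  have heven : ∀ i < k, ∀ t, f t = 4 * k ↔ T i t % 2 = 0 := by
    intro i hi t
    have hmem := (hT i hi).1.mem t
    simp only [hB, alternate] at hmem
    split_ifs at hmem with h
    · simp [(List.mem_replicate.1 hmem).2, h]
    · refine iff_of_false ?_ h
      rcases mem_clauseGadget hmem with ⟨l, hl, h', -⟩ | h' <;> omega
  set H : Finset (Fin z.length) := Finset.univ.filter fun t => f t = 4 * k with hH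
  set C : Finset (Fin z.length) := Finset.univ.filter fun t => ¬ f t = 4 * k with hC
  have hHC : H.card + C.card = z.length := by
    simpa using Finset.card_filter_add_card_filter_not (s := Finset.univ) (fun t => f t = 4 * k)
  -- Separators in the blocks of a set `J` of indices.
  have hsep : ∀ i < k, ∀ (s : Finset (Fin z.length)) (J : Finset ℕ),
      (∀ t ∈ s, f t = 4 * k) → (∀ t ∈ s, T i t / 2 ∈ J) → s.card ≤ w * J.card := by
    intro i hi s J hs hJ
    refine Finset.card_le_mul_card_image_of_maps_to hJ w fun j hj => ?_
    have h1 := (hT i hi).1.card_le (x := 2 * j) (p := fun t => t ∈ s ∧ T i t / 2 = j) fun t ht => by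
      have := (heven i hi t).1 (hs t ht.1)
      omega
    have h2 : (B i (2 * j)).length = w := by simp [hB, alternate]
    rw [h2] at h1
    refine le_trans (Finset.card_le_card fun t ht => ?_) h1
    simpa using ht
  have h0 : 0 < k := by omega
  have hcl : ∀ (s : Finset (Fin z.length)) (J : Finset ℕ) (n : ℕ), s ⊆ C →
      (∀ t ∈ s, T 0 t / 2 ∈ J) → (∀ j, (s.filter fun t => T 0 t = 2 * j + 1).card ≤ n) →
      s.card ≤ n * J.card := by
    intro s J n hs hJ hn
    refine Finset.card_le_mul_card_image_of_maps_to hJ n fun j hj => ?_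
    refine le_trans (Finset.card_le_card fun t ht => ?_) (hn j)
    simp only [Finset.mem_filter] at ht ⊢
    have h1 := hs ht.1
    simp only [hC, Finset.mem_filter, heven 0 h0] at h1
    exact ⟨ht.1, by omega⟩
  have hTC : ∀ t ∈ C, T 0 t / 2 ∈ Finset.range m := by
    intro t ht
    simp only [hC, Finset.mem_filter, heven 0 h0] at ht
    have := (hT 0 h0).2 t
    rw [Finset.mem_range]
    omega
  have hCk : C.card ≤ k * m := by
    have := hcl C (Finset.range m) k subset_rfl hTC fun j => by
      have h1 := (hT 0 h0).1.card_le (x := 2 * j + 1) (p := fun t => t ∈ C ∧ T 0 t = 2 * j + 1)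
        fun t ht => ht.2
      have h2 : (B 0 (2 * j + 1)).length = k := by
        have : (2 * j + 1) % 2 = 1 := by omega
        simp [hB, alternate, this, length_clauseGadget]
      rw [h2] at h1
      refine le_trans (Finset.card_le_card fun t ht => ?_) h1
      simpa using ht
    simpa using this
  have hHlt : m * w < H.card := by
    have : (m + 1) * w = m * w + w := by ring
    omega
  have hHle : H.card ≤ (m + 1) * w := by
    have := hsep 0 h0 H (Finset.range (m + 1)) (fun t ht => by simpa [hH] using ht)
      (fun t _ => by
        have := (hT 0 h0).2 t
        rw [Finset.mem_range]
        omega)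
    rw [Finset.card_range] at this
    linarith
  -- No letter is found in an earlier clause gadget in string `i` than in string `j`.
  have hle : ∀ i < k, ∀ j < k, ∀ t ∈ C, T j t ≤ T i t := by
    intro i hi j hj t ht
    by_contra hlt
    have htC : ¬ f t = 4 * k := by simpa [hC] using ht
    have hi2 := mt (heven i hi t).2 htC
    have hj2 := mt (heven j hj t).2 htC
    have hjm := (hT j hj).2 t
    have h1 := hsep i hi (H.filter fun s => s < t) (Finset.range (T i t / 2 + 1))
      (fun s hs => by simpa [hH] using (Finset.mem_filter.1 hs).1) fun s hs => by
        have := (hT i hi).1.mono (Finset.mem_filter.1 hs).2.le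
        rw [Finset.mem_range]
        omega
    have h2 := hsep j hj (H.filter fun s => ¬ s < t) (Finset.Ioc (T j t / 2) m)
      (fun s hs => by simpa [hH] using (Finset.mem_filter.1 hs).1) fun s hs => by
        have h3 := (hT j hj).1.mono (not_lt.1 (Finset.mem_filter.1 hs).2)
        have h4 : f s = 4 * k := by simpa [hH] using (Finset.mem_filter.1 hs).1
        have h5 := (heven j hj s).1 h4
        have h6 := (hT j hj).2 s
        rw [Finset.mem_Ioc]
        omega
    have h3 := Finset.card_filter_add_card_filter_not (s := H) (fun s => s < t)
    rw [Finset.card_range] at h1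
    rw [Nat.card_Ioc] at h2
    have h4 : w * (T i t / 2 + 1) + w * (m - T j t / 2) ≤ m * w := by
      rw [← mul_add, mul_comm]
      exact Nat.mul_le_mul_right _ (by omega)
    omega
  have heq : ∀ i < k, ∀ t ∈ C, T i t = T 0 t := fun i hi t ht =>
    le_antisymm (hle 0 h0 i hi t ht) (hle i hi 0 h0 t ht)
  have hblock : ∀ i < k, ∀ t ∈ C, f t ∈ clauseGadget k i (b i (T 0 t / 2)) := by
    intro i hi t ht
    have hmem := (hT i hi).1.mem t
    have htC : ¬ f t = 4 * k := by simpa [hC] using ht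
    have hodd := mt (heven i hi t).2 htC
    simp only [hB, alternate, if_neg hodd] at hmem
    rwa [heq i hi t ht] at hmem
  have hsmall : ∀ t ∈ C, f t < 3 * k := by
    intro t ht
    rcases mem_clauseGadget (hblock 0 h0 t ht) with ⟨l, hl, h, -⟩ | h
    · omega
    · rcases mem_clauseGadget (hblock 1 (by omega) t ht) with ⟨l, hl, h', -⟩ | h' <;>
        omega
  have hone : ∀ j, (C.filter fun t => T 0 t = 2 * j + 1).card ≤ 1 := by
    intro j
    rw [Finset.card_le_one]
    intro s hs t ht
    by_contra hne
    wlog hst : s < t generalizing s t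
    · exact this t ht s hs (Ne.symm hne) (lt_of_le_of_ne (not_lt.1 hst) (Ne.symm hne))
    rw [Finset.mem_filter] at hs ht
    have h1 : T 1 s = T 1 t := by rw [heq 1 (by omega) s hs.1, heq 1 (by omega) t ht.1, hs.2, ht.2]
    have hodd : ¬ (2 * j + 1) % 2 = 0 := by omega
    have a1 := (hT 0 h0).1.rel hst (hs.2.trans ht.2.symm)
      (R := fun x y => x < 3 * k → y < 3 * k → x < y) (by
        rw [hs.2]
        simp only [hB, alternate, if_neg hodd]
        exact clauseGadget_zero_pairwise _ _) (hsmall s hs.1) (hsmall t ht.1)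
    have a2 := (hT 1 (by omega)).1.rel hst h1
      (R := fun x y => x < 3 * k → y < 3 * k → y < x) (by
        rw [heq 1 (by omega) s hs.1, hs.2]
        simp only [hB, alternate, if_neg hodd]
        exact clauseGadget_one_pairwise _ _) (hsmall s hs.1) (hsmall t ht.1)
    omega
  intro r hr
  have : ∃ t ∈ C, T 0 t / 2 = r := by
    by_contra hno
    push Not at hno
    have h1 := hcl C ((Finset.range m).erase r) 1 subset_rfl
      (fun t ht => Finset.mem_erase.2 ⟨hno t ht, hTC t ht⟩) hone
    rw [Finset.card_erase_of_mem (by simpa using hr), Finset.card_range] at h1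
    omega
  obtain ⟨t, ht, rfl⟩ := this
  rcases mem_clauseGadget (hblock 0 h0 t ht) with ⟨l, hl, h, -⟩ | h
  · refine ⟨l, hl, ?_⟩
    rcases mem_clauseGadget (hblock l hl t ht) with ⟨l', hl', h', h''⟩ | h'
    · exact h'' (by omega)
    · omega
  · have := hsmall t ht
    omega

/-- Unless every clause is satisfied, nothing beats the second alternative. -/
theorem length_le_of_common_gadget {k m e : ℕ} (hk : 2 ≤ k) {b : ℕ → ℕ → Bool} {z : List ℕ}
    (he : e + 1 = (m + 1) * (k * m + 1) + m)
    (hz : ∀ i < k, z <+ gadget k (k * m + 1) m e i (b i))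
    (hb : ¬ ∀ r < m, ∃ i < k, b i r = true) : z.length ≤ e := by
  have hno : ∀ i < k, 4 * k + 1 ∉ clausesGadget k (k * m + 1) m i (b i) := by
    intro i hi h
    have := mem_clausesGadget h
    omega
  by_cases hφ : 4 * k + 1 ∈ z
  · have h0 := hz 0 (by omega)
    have h1 := hz 1 (by omega)
    rw [gadget, if_pos rfl, List.sublist_append_iff] at h0
    rw [gadget, if_neg one_ne_zero, List.sublist_append_iff] at h1
    obtain ⟨x, y, rfl, hx, hy⟩ := h0
    obtain ⟨u, v, huv, hu, hv⟩ := h1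
    have hu0 : u = [] := by
      cases u with
      | nil => rfl
      | cons a u =>
        exfalso
        have ha := hu.subset (List.mem_cons_self)
        cases x with
        | nil =>
          rw [List.nil_append] at hφ
          exact hno 0 (by omega) (hy.subset hφ)
        | cons c x =>
          simp only [List.cons_append, List.cons.injEq] at huv
          have hc := List.eq_of_mem_replicate (hx.subset List.mem_cons_self)
          rw [← huv.1, hc] at ha
          exact hno 1 (by omega) ha
    rw [huv, hu0, List.nil_append]
    simpa using hv.length_le
  · by_contra hlen
    refine hb (satisfied_of_common_clausesGadget hk (z := z) (fun i hi => ?_) (by omega))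
    have h := hz i hi
    rw [gadget] at h
    split_ifs at h
    · rw [List.sublist_append_iff] at h
      obtain ⟨x, y, rfl, hx, hy⟩ := h
      have : x = [] := List.eq_nil_iff_forall_not_mem.2 fun a ha => hφ (by
        rw [← List.eq_of_mem_replicate (hx.subset ha)]
        simp [ha])
      simpa [this] using hy
    · rw [List.sublist_append_iff] at h
      obtain ⟨x, y, rfl, hx, hy⟩ := h
      have : y = [] := List.eq_nil_iff_forall_not_mem.2 fun a ha => hφ (by
        rw [← List.eq_of_mem_replicate (hy.subset ha)]
        simp [ha])
      simpa [this] using hx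

theorem replicate_sublist_gadget (k w m e i : ℕ) (b : ℕ → Bool) :
    List.replicate e (4 * k + 1) <+ gadget k w m e i b := by
  rw [gadget]
  split_ifs
  · exact List.sublist_append_left _ _
  · exact List.sublist_append_right _ _

theorem clausesGadget_sublist_gadget (k w m e i : ℕ) (b : ℕ → Bool) :
    clausesGadget k w m i b <+ gadget k w m e i b := by
  rw [gadget]
  split_ifs
  · exact List.sublist_append_right _ _
  · exact List.sublist_append_left _ _

end KLCS

namespace KLCS

open scoped List

/-! ### The strings -/

/-- The weight of the separating letter `x < 2 * k - 1`. -/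
def weight (k W x : ℕ) : ℕ := min (x + 1) (2 * k - 1 - x) * W

/-- The separator in string `i`: the letters `k - 1 + i, …, k - 1 - i` in descending order, repeated
according to their weights. -/
def separator (k W i : ℕ) : List ℕ :=
  (List.range (2 * i + 1)).flatMap fun y =>
    List.replicate (weight k W (k - 1 + i - y)) (k - 1 + i - y)

/-- The beginning of string `i`: the letters `0, …, k - 2 - i`. -/
def front (k W N i : ℕ) : List ℕ :=
  (List.range (k - 1 - i)).flatMap fun x => List.replicate (N * weight k W x) x

/-- The end of string `i`: the letters `k + i, …, 2 * k - 2`. -/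
def back (k W N i : ℕ) : List ℕ :=
  (List.range (k - 1 - i)).flatMap fun y =>
    List.replicate (N * weight k W (k + i + y)) (k + i + y)

/-- String `i` for gadgets `g 0, …, g (N - 1)`: the list of all gadgets, `i + 1` times, with a
separator before each of them. The end is filled up with a letter that occurs in no other string. -/
def text (k W N i : ℕ) (g : ℕ → List ℕ) (fill : ℕ) : List ℕ :=
  front k W N i ++ (List.range ((i + 1) * N)).flatMap (fun t => separator k W i ++ g (t % N)) ++
    back k W N i ++ List.replicate fill (3 * k + i)

theorem mem_front {k W N i a : ℕ} (h : a ∈ front k W N i) : a < k - 1 - i := by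
  simp only [front, List.mem_flatMap, List.mem_range, List.mem_replicate] at h
  obtain ⟨x, hx, -, rfl⟩ := h
  exact hx

theorem mem_back {k W N i a : ℕ} (h : a ∈ back k W N i) : k + i ≤ a ∧ a < 2 * k - 1 := by
  simp only [back, List.mem_flatMap, List.mem_range, List.mem_replicate] at h
  obtain ⟨x, hx, -, rfl⟩ := h
  omega

theorem mem_separator {k W i a : ℕ} (hi : i < k) (h : a ∈ separator k W i) :
    k - 1 - i ≤ a ∧ a ≤ k - 1 + i := by
  simp only [separator, List.mem_flatMap, List.mem_range, List.mem_replicate] at h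
  obtain ⟨x, hx, -, rfl⟩ := h
  omega

theorem pairwise_flatMap_replicate {n : ℕ} {c a : ℕ → ℕ} {R : ℕ → ℕ → Prop}
    (hrefl : ∀ x, R x x) (h : ∀ x y, x < y → y < n → R (a x) (a y)) :
    ((List.range n).flatMap fun x => List.replicate (c x) (a x)).Pairwise R := by
  rw [List.pairwise_flatMap]
  refine ⟨fun x _ => ?_, ?_⟩
  · rw [List.pairwise_replicate]
    exact .inr (hrefl _)
  · refine List.Pairwise.imp_of_mem (fun {x y} hx hy hxy => ?_) List.pairwise_lt_range
    intro u hu v hv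
    rw [List.eq_of_mem_replicate hu, List.eq_of_mem_replicate hv]
    exact h x y hxy (by simpa using hy)

theorem separator_pairwise (k W i : ℕ) : (separator k W i).Pairwise fun x y => y ≤ x :=
  pairwise_flatMap_replicate (fun _ => le_rfl) fun _ _ _ _ => by omega

theorem count_separator_le {k W i a : ℕ} (hi : i < k) :
    (separator k W i).count a ≤ weight k W a := by
  rw [separator, List.count_flatMap]
  have : (List.map (List.count a ∘ fun y => List.replicate (weight k W (k - 1 + i - y))
      (k - 1 + i - y)) (List.range (2 * i + 1))).sum =
      ∑ y ∈ Finset.range (2 * i + 1), if k - 1 + i - y = a then weight k W a else 0 := by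
    rw [Finset.sum_range]
    rw [← List.sum_ofFn, List.ofFn_eq_map, ← List.map_coe_finRange_eq_range, List.map_map]
    congr 1
    refine List.map_congr_left fun y _ => ?_
    simp only [Function.comp, List.count_replicate, beq_iff_eq]
    split_ifs with h
    · rw [h]
    · rfl
  rw [this, ← Finset.sum_filter, Finset.sum_const, smul_eq_mul]
  have : (Finset.filter (fun y => k - 1 + i - y = a) (Finset.range (2 * i + 1))).card ≤ 1 := by
    rw [Finset.card_le_one]
    intro x hx y hy
    simp only [Finset.mem_filter, Finset.mem_range] at hx hy
    omega
  calc _ ≤ 1 * weight k W a := Nat.mul_le_mul_right _ this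
    _ = _ := one_mul _

/-- In string `0` the separating letters are in ascending order. -/
theorem text_zero_pairwise {k W N fill : ℕ} {g : ℕ → List ℕ} (hk : 0 < k)
    (hg : ∀ v, ∀ a ∈ g v, 2 * k ≤ a) :
    (text k W N 0 g fill).Pairwise fun x y => x < 2 * k → y < 2 * k → x ≤ y := by
  have hmid : ∀ a ∈ (List.range ((0 + 1) * N)).flatMap (fun t => separator k W 0 ++ g (t % N)),
      a = k - 1 ∨ 2 * k ≤ a := by
    intro a ha
    simp only [List.mem_flatMap, List.mem_append] at ha
    obtain ⟨t, -, h | h⟩ := ha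
    · have := mem_separator hk h
      omega
    · exact .inr (hg _ a h)
  rw [text, List.pairwise_append, List.pairwise_append, List.pairwise_append]
  refine ⟨⟨⟨?_, ?_, ?_⟩, ?_, ?_⟩, ?_, ?_⟩
  · exact pairwise_flatMap_replicate (fun _ _ _ => le_rfl) fun _ _ _ _ => by omega
  · refine List.pairwise_of_forall_mem_list fun a ha b hb => ?_
    have := hmid a ha
    have := hmid b hb
    omega
  · intro a ha b hb
    have := mem_front ha
    have := hmid b hb
    omega
  · exact pairwise_flatMap_replicate (fun _ _ _ => le_rfl) fun _ _ _ _ => by omega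
  · intro a ha b hb
    have := mem_back hb
    rw [List.mem_append] at ha
    rcases ha with ha | ha
    · have := mem_front ha
      omega
    · have := hmid a ha
      omega
  · rw [List.pairwise_replicate]
    exact .inr fun _ _ => le_rfl
  · intro a ha b hb
    have := List.eq_of_mem_replicate hb
    omega

/-- The blocks of `text`: the front, separators and gadgets alternating, and the rest. -/
def textBlocks (k W N i : ℕ) (g : ℕ → List ℕ) (fill : ℕ) : ℕ → List ℕ :=
  alternate
    (fun t => if t = 0 then front k W N i else if t = (i + 1) * N + 1 then
      back k W N i ++ List.replicate fill (3 * k + i) else g ((t - 1) % N))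
    (fun t => if t = (i + 1) * N then [] else separator k W i)

theorem text_eq_flatMap (k W N i : ℕ) (g : ℕ → List ℕ) (fill : ℕ) :
    text k W N i g fill =
      (List.range (2 * ((i + 1) * N + 1) + 1)).flatMap (textBlocks k W N i g fill) := by
  rw [textBlocks, alternate_flatMap, List.range_succ, List.flatMap_append, text]
  simp only [if_true, List.flatMap_cons, List.flatMap_nil, List.append_nil, List.nil_append,
    Nat.add_eq_zero_iff, one_ne_zero, and_false, if_false, List.append_assoc]
  congr 2
  refine List.flatMap_congr fun t ht => ?_
  rw [List.mem_range] at ht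
  rw [if_neg (by omega), if_neg (by omega)]
  simp

end KLCS

namespace KLCS

open scoped List

/-! ### Common subsequences are short if no tuple of gadgets matches -/

theorem mem_textBlocks {k W N i fill a x : ℕ} {g : ℕ → List ℕ}
    (hx : x < 2 * ((i + 1) * N + 1) + 1) (h : a ∈ textBlocks k W N i g fill x) :
    a ∈ front k W N i ∨ a ∈ back k W N i ∨ a = 3 * k + i ∨
      (∃ u < (i + 1) * N, x = 2 * u + 1 ∧ a ∈ separator k W i) ∨
      ∃ u < (i + 1) * N, x = 2 * u + 2 ∧ a ∈ g (u % N) := by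
  set n := (i + 1) * N with hn
  simp only [textBlocks, alternate, ← hn] at h
  split_ifs at h with h1 h2 h3 h4
  · exact .inl h
  · rw [List.mem_append] at h
    rcases h with h | h
    · exact .inr (.inl h)
    · exact .inr (.inr (.inl (List.eq_of_mem_replicate h)))
  · exact .inr (.inr (.inr (.inr ⟨x / 2 - 1, by omega, by omega, h⟩)))
  · simp at h
  · exact .inr (.inr (.inr (.inl ⟨x / 2, by omega, by omega, h⟩)))

/-- The number of strings `i` that have the letter `x` in their separators. -/
theorem card_strings_with_letter (k x : ℕ) :
    ((Finset.range k).filter fun i => k - 1 - i ≤ x ∧ x ≤ k - 1 + i).card =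
      min (x + 1) (2 * k - 1 - x) := by
  have : ((Finset.range k).filter fun i => k - 1 - i ≤ x ∧ x ≤ k - 1 + i) =
      Finset.Ico (k - min (x + 1) (2 * k - 1 - x)) k := by
    ext i
    simp only [Finset.mem_filter, Finset.mem_range, Finset.mem_Ico]
    omega
  rw [this, Nat.card_Ico]
  omega

/-- If the gadgets of every tuple have only common subsequences of length at most `e`, then every
common subsequence of the strings obeys this bound. Let `T i t` be the block of string `i` with the
`t`-th letter of the common subsequence. A separator of string `i` is used for one kind of letters
only, and it can be lost, that is, not used at all. Counting each separating letter with the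
inverse of its weight, and summing over all strings, bounds the number of separating letters. If
the letters from a gadget of string `0` spread over several gadgets of another string, then a
separator between them is lost, and this costs at least as much as the gadget can gain. -/
theorem length_le_of_common_text {k W N e : ℕ} (hk : 2 ≤ k) (hW : 0 < W) (hN : 0 < N)
    {g : ℕ → ℕ → List ℕ} {fill : ℕ → ℕ}
    (hg : ∀ i < k, ∀ v, ∀ a ∈ g i v, 2 * k ≤ a ∧ ∀ j < k, a = 3 * k + j → j = i)
    (hgW : ∀ v, (g 0 v).length ≤ W)
    (he : ∀ v : ℕ → ℕ, (∀ i, v i < N) → ∀ z : List ℕ, (∀ i < k, z <+ g i (v i)) → z.length ≤ e)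
    {z : List ℕ} (hz : ∀ i < k, z <+ text k W N i (g i) (fill i)) :
    z.length ≤ N * e + W * ∑ i ∈ Finset.range k, (i + 1) * N := by
  set B : ℕ → ℕ → List ℕ := fun i => textBlocks k W N i (g i) (fill i) with hB
  set f : Fin z.length → ℕ := z.get with hf
  have htag : ∀ i, ∃ T : Fin z.length → ℕ,
      i < k → Tagging f (B i) T ∧ ∀ t, T t < 2 * ((i + 1) * N + 1) + 1 := by
    intro i
    by_cases hi : i < k
    · obtain ⟨T, hT⟩ := exists_tagging (f := f) (B := B i) (by
        rw [hf, List.ofFn_get, hB, ← text_eq_flatMap]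
        exact hz i hi)
      exact ⟨T, fun _ => hT⟩
    · exact ⟨fun _ => 0, fun h => absurd h hi⟩
  choose T hT using htag
  have h0 : 0 < k := by omega
  have hmem : ∀ i < k, ∀ t, f t ∈ front k W N i ∨ f t ∈ back k W N i ∨ f t = 3 * k + i ∨
      (∃ u < (i + 1) * N, T i t = 2 * u + 1 ∧ f t ∈ separator k W i) ∨
      ∃ u < (i + 1) * N, T i t = 2 * u + 2 ∧ f t ∈ g i (u % N) :=
    fun i hi t => mem_textBlocks ((hT i hi).2 t) ((hT i hi).1.mem t)
  -- The filling letters are not used.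
  have hfill : ∀ i < k, ∀ t, f t ≠ 3 * k + i := by
    intro i hi t ht
    obtain ⟨j, hj, hji⟩ : ∃ j < k, j ≠ i := by
      by_cases h : i = 0
      · exact ⟨1, by omega, by omega⟩
      · exact ⟨0, by omega, by omega⟩
    rcases hmem j hj t with h | h | h | ⟨u, -, -, h⟩ | ⟨u, -, -, h⟩
    · have := mem_front h; omega
    · have := mem_back h; omega
    · omega
    · have := mem_separator hj h; omega
    · exact hji ((hg j hj _ _ h).2 i hi ht).symm
  have hsepT : ∀ i < k, ∀ t, k - 1 - i ≤ f t → f t ≤ k - 1 + i →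
      ∃ u < (i + 1) * N, T i t = 2 * u + 1 ∧ f t ∈ separator k W i := by
    intro i hi t h1 h2
    rcases hmem i hi t with h | h | h | h | ⟨u, -, -, h⟩
    · have := mem_front h; omega
    · have := mem_back h; omega
    · omega
    · exact h
    · have := (hg i hi _ _ h).1; omega
  have hgadT : ∀ i < k, ∀ t, 2 * k ≤ f t →
      ∃ u < (i + 1) * N, T i t = 2 * u + 2 ∧ f t ∈ g i (u % N) := by
    intro i hi t h1
    rcases hmem i hi t with h | h | h | ⟨u, -, -, h⟩ | h
    · have := mem_front h; omega
    · have := mem_back h; omega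
    · exact absurd h (hfill i hi t)
    · have := mem_separator hi h; omega
    · exact h
  have hlt : ∀ t, f t < 2 * k → f t < 2 * k - 1 := by
    intro t ht
    rcases hmem 0 h0 t with h | h | h | ⟨u, -, -, h⟩ | ⟨u, -, -, h⟩
    · have := mem_front h; omega
    · have := mem_back h; omega
    · omega
    · have := mem_separator h0 h; omega
    · have := (hg 0 h0 _ _ h).1; omega
  have hasc : ∀ s t, s < t → f s < 2 * k → f t < 2 * k → f s ≤ f t := by
    have h := (text_zero_pairwise h0 (W := W) (N := N) (fill := fill 0)
      fun v a ha => (hg 0 h0 v a ha).1).sublist (hz 0 h0)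
    rw [← List.ofFn_get z, List.pairwise_ofFn] at h
    exact fun s t hst => h hst
  set lost : ℕ → Finset ℕ := fun i =>
    (Finset.range ((i + 1) * N)).filter fun u => ∀ t, T i t ≠ 2 * u + 1 with hlost
  set S : Finset (Fin z.length) := Finset.univ.filter fun t => f t < 2 * k with hS
  set C : Finset (Fin z.length) := Finset.univ.filter fun t => ¬ f t < 2 * k with hC
  have hSC : S.card + C.card = z.length :=
    (Finset.card_filter_add_card_filter_not (s := Finset.univ) (fun t => f t < 2 * k)).trans
      (by simp)
  have hsep : S.card + W * ∑ i ∈ Finset.range k, (lost i).card ≤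
      W * ∑ i ∈ Finset.range k, (i + 1) * N := by
    set Si : ℕ → Finset (Fin z.length) := fun i =>
      Finset.univ.filter fun t => k - 1 - i ≤ f t ∧ f t ≤ k - 1 + i with hSi
    have claim : ∀ i ∈ Finset.range k, ∑ t ∈ Si i, (1 / weight k W (f t) : ℚ) ≤
        (i + 1) * N - (lost i).card := by
      intro i hi
      rw [Finset.mem_range] at hi
      have hmaps : ∀ t ∈ Si i, T i t / 2 ∈ Finset.range ((i + 1) * N) := by
        intro t ht
        obtain ⟨h1, h2⟩ := (Finset.mem_filter.1 ht).2
        obtain ⟨u, hu, hTu, -⟩ := hsepT i hi t h1 h2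
        rw [Finset.mem_range]
        omega
      rw [← Finset.sum_fiberwise_of_maps_to hmaps]
      have hcard : ((i + 1) * N - (lost i).card : ℚ) =
          ∑ u ∈ Finset.range ((i + 1) * N), if ∀ t, T i t ≠ 2 * u + 1 then (0 : ℚ) else 1 := by
        rw [← Finset.sum_filter_add_sum_filter_not _ (fun u => ∀ t, T i t ≠ 2 * u + 1)]
        rw [Finset.sum_congr rfl (g := fun _ => (0 : ℚ)) fun u hu => if_pos (Finset.mem_filter.1 hu).2]
        rw [Finset.sum_congr rfl (g := fun _ => (1 : ℚ)) fun u hu => if_neg (Finset.mem_filter.1 hu).2]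
        have h1 := Finset.card_filter_add_card_filter_not (s := Finset.range ((i + 1) * N))
          (fun u => ∀ t, T i t ≠ 2 * u + 1)
        rw [Finset.card_range] at h1
        have h2 : (((lost i).card + ((Finset.range ((i + 1) * N)).filter
          fun u => ¬ ∀ t, T i t ≠ 2 * u + 1).card : ℕ) : ℚ) = ((i + 1) * N : ℕ) :=
          congrArg Nat.cast h1
        push_cast at h2
        simp only [Finset.sum_const_zero, Finset.sum_const, nsmul_eq_mul, mul_one, zero_add]
        linarith
      rw [hcard]
      refine Finset.sum_le_sum fun u _ => ?_
      rcases (Finset.filter (fun t => T i t / 2 = u) (Si i)).eq_empty_or_nonempty with h | ⟨t, ht⟩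
      · rw [h, Finset.sum_empty]
        split_ifs <;> norm_num
      have hodd : ∀ s, s ∈ (Si i).filter (fun t => T i t / 2 = u) →
          T i s = 2 * u + 1 ∧ k - 1 - i ≤ f s ∧ f s ≤ k - 1 + i ∧ f s ∈ separator k W i := by
        intro s hs
        obtain ⟨hs1, hs2⟩ := Finset.mem_filter.1 hs
        obtain ⟨h1, h2⟩ := (Finset.mem_filter.1 hs1).2
        obtain ⟨v, -, hv, hv'⟩ := hsepT i hi s h1 h2
        exact ⟨by omega, h1, h2, hv'⟩
      obtain ⟨ht1, ht2, ht3, ht4⟩ := hodd t ht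
      rw [if_neg (by push Not; exact ⟨t, ht1⟩)]
      have hiN : u ≠ (i + 1) * N := by
        obtain ⟨v, hv, hv', -⟩ := hsepT i hi t ht2 ht3
        omega
      have hBu : B i (2 * u + 1) = separator k W i := by
        have h1 : (2 * u + 1) % 2 = 1 := by omega
        have h2 : (2 * u + 1) / 2 = u := by omega
        simp only [hB, textBlocks, alternate, h1, h2, one_ne_zero, if_false, if_neg hiN]
      have hsame : ∀ s, s ∈ (Si i).filter (fun t => T i t / 2 = u) → f s = f t := by
        have key : ∀ s ∈ (Si i).filter (fun t => T i t / 2 = u),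
            ∀ r ∈ (Si i).filter (fun t => T i t / 2 = u), s < r → f s = f r := by
          intro s hs r hr hsr
          obtain ⟨hs1, hs2, hs3, -⟩ := hodd s hs
          obtain ⟨hr1, hr2, hr3, -⟩ := hodd r hr
          refine le_antisymm (hasc s r hsr (by omega) (by omega)) ?_
          refine (hT i hi).1.rel hsr (hs1.trans hr1.symm) (R := fun x y => y ≤ x) ?_
          rw [hs1, hBu]
          exact separator_pairwise k W i
        intro s hs
        rcases lt_trichotomy s t with h | h | h
        · exact key s hs t ht h
        · rw [h]
        · exact (key t ht s hs h).symm
      rw [Finset.sum_congr rfl fun s hs => by rw [hsame s hs], Finset.sum_const, nsmul_eq_mul,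
        mul_one_div]
      refine div_le_one_of_le₀ ?_ (by positivity)
      have hc := (hT i hi).1.card_le_count (x := 2 * u + 1) (a := f t)
        (p := fun s => s ∈ (Si i).filter (fun t => T i t / 2 = u))
        (fun s hs => (hodd s hs).1) hsame
      rw [hBu] at hc
      have hc' := hc.trans (count_separator_le hi)
      rw [Finset.filter_univ_mem] at hc'
      exact_mod_cast hc'
    have hsum := Finset.sum_le_sum claim
    have hswap : ∑ i ∈ Finset.range k, ∑ t ∈ Si i, (1 / weight k W (f t) : ℚ) = S.card / W := by
      rw [Finset.sum_comm' (t' := Finset.univ) (s' := fun t => (Finset.range k).filter fun i =>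
        k - 1 - i ≤ f t ∧ f t ≤ k - 1 + i) (by simp [hSi])]
      rw [← Finset.sum_filter_add_sum_filter_not _ (fun t => f t < 2 * k)]
      rw [Finset.sum_eq_zero (s := Finset.univ.filter fun t => ¬ f t < 2 * k), add_zero]
      · rw [Finset.sum_congr rfl (g := fun _ => (1 / W : ℚ))]
        · rw [Finset.sum_const, nsmul_eq_mul, mul_one_div]
        · intro t ht
          have h1 := hlt t (Finset.mem_filter.1 ht).2
          rw [Finset.sum_const, card_strings_with_letter, nsmul_eq_mul, weight]
          have h2 : (0 : ℚ) < (min (f t + 1) (2 * k - 1 - f t) : ℕ) := by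
            rw [Nat.cast_pos]; omega
          have h3 : (0 : ℚ) < W := by exact_mod_cast hW
          rw [Nat.cast_mul]
          field_simp
      · intro t ht
        have h1 := (Finset.mem_filter.1 ht).2
        rw [Finset.filter_eq_empty_iff.2, Finset.sum_empty]
        intro i hi
        rw [Finset.mem_range] at hi
        omega
    rw [hswap, Finset.sum_sub_distrib, div_le_iff₀ (by exact_mod_cast hW)] at hsum
    have : ((S.card + W * ∑ i ∈ Finset.range k, (lost i).card : ℕ) : ℚ) ≤
        (W * ∑ i ∈ Finset.range k, (i + 1) * N : ℕ) := by
      push_cast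
      linarith
    exact_mod_cast this
  have hgad : C.card ≤ N * e + W * ∑ i ∈ Finset.range k, (lost i).card := by
    set Z : ℕ → Finset (Fin z.length) := fun r => C.filter fun t => T 0 t / 2 - 1 = r with hZ
    have hZmem : ∀ r, ∀ t ∈ Z r, 2 * k ≤ f t ∧ T 0 t = 2 * r + 2 := by
      intro r t ht
      obtain ⟨h1, h2⟩ := Finset.mem_filter.1 ht
      have h3 : 2 * k ≤ f t := not_lt.1 (Finset.mem_filter.1 h1).2
      obtain ⟨u, -, hu, -⟩ := hgadT 0 h0 t h3
      exact ⟨h3, by omega⟩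
    have hmaps : ∀ t ∈ C, T 0 t / 2 - 1 ∈ Finset.range N := by
      intro t ht
      obtain ⟨u, hu, hu', -⟩ := hgadT 0 h0 t (not_lt.1 (Finset.mem_filter.1 ht).2)
      rw [Finset.mem_range]
      omega
    have hBg : ∀ i < k, ∀ u < (i + 1) * N, B i (2 * u + 2) = g i (u % N) := by
      intro i hi u hu
      have h1 : (2 * u + 2) % 2 = 0 := by omega
      have h2 : (2 * u + 2) / 2 = u + 1 := by omega
      simp only [hB, textBlocks, alternate, h1, h2, if_true]
      rw [if_neg (by omega), if_neg (by omega)]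
      simp
    set E : Finset ℕ := (Finset.range N).filter fun r =>
      ∃ i < k, ∃ s ∈ Z r, ∃ t ∈ Z r, T i s < T i t with hE
    have hEcard : E.card ≤ ∑ i ∈ Finset.range k, (lost i).card := by
      rw [← Finset.card_sigma]
      have hex : ∀ r, ∃ p : (_ : ℕ) × ℕ, r ∈ E → p ∈ (Finset.range k).sigma lost ∧
          ∃ s ∈ Z r, ∃ t ∈ Z r, T p.1 s < 2 * p.2 + 1 ∧ 2 * p.2 + 1 < T p.1 t := by
        intro r
        by_cases hr : r ∈ E
        · obtain ⟨i, hi, s, hs, t, ht, hst⟩ := (Finset.mem_filter.1 hr).2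
          obtain ⟨u, hu, hu', -⟩ := hgadT i hi s (hZmem r s hs).1
          obtain ⟨v, hv, hv', -⟩ := hgadT i hi t (hZmem r t ht).1
          refine ⟨⟨i, u + 1⟩, fun _ => ⟨?_, s, hs, t, ht, by dsimp only; omega, by dsimp only; omega⟩⟩
          simp only [Finset.mem_sigma, Finset.mem_range, hlost, Finset.mem_filter]
          refine ⟨hi, by omega, fun x hx => ?_⟩
          -- A letter from this separator would lie between two letters of the same gadget.
          have h1 : s ≤ x := by
            by_contra h
            have := (hT i hi).1.mono (not_le.1 h).le
            omega
          have h2 : x ≤ t := by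
            by_contra h
            have := (hT i hi).1.mono (not_le.1 h).le
            omega
          have h3 := (hT 0 h0).1.mono h1
          have h4 := (hT 0 h0).1.mono h2
          rw [(hZmem r s hs).2] at h3
          rw [(hZmem r t ht).2] at h4
          have h5 : 2 * k ≤ f x := by
            obtain ⟨w, hw, hw', -⟩ := hgadT 0 h0 s (hZmem r s hs).1
            have h6 := (hT 0 h0).1.mem x
            have h7 := (hZmem r s hs).2
            rw [show T 0 x = 2 * w + 2 by omega, hBg 0 h0 w hw] at h6
            exact (hg 0 h0 _ _ h6).1
          obtain ⟨w, -, hw, -⟩ := hgadT i hi x h5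
          omega
        · exact ⟨⟨0, 0⟩, fun h => absurd h hr⟩
      choose p hp using hex
      refine Finset.card_le_card_of_injOn p (fun r hr => (hp r hr).1) ?_
      have key : ∀ r ∈ E, ∀ r' ∈ E, r < r' → p r ≠ p r' := by
        intro r hr r' hr' hlt' heq
        obtain ⟨h1, s, hs, t, ht, h2, h3⟩ := hp r hr
        obtain ⟨h1', s', hs', t', ht', h2', h3'⟩ := hp r' hr'
        have hi : (p r).1 < k := Finset.mem_range.1 (Finset.mem_sigma.1 h1).1
        have hts : t ≤ s' := by
          by_contra h
          have := (hT 0 h0).1.mono (not_le.1 h).le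
          rw [(hZmem r t ht).2, (hZmem r' s' hs').2] at this
          omega
        have := (hT _ hi).1.mono hts
        rw [← heq] at h2'
        omega
      intro r hr r' hr' heq
      rcases lt_trichotomy r r' with h | h | h
      · exact absurd heq (key r hr r' hr' h)
      · exact h
      · exact absurd heq.symm (key r' hr' r hr h)
    have hZW : ∀ r ∈ Finset.range N, (Z r).card ≤ e + if r ∈ E then W else 0 := by
      intro r hr
      have hrN := Finset.mem_range.1 hr
      by_cases hrE : r ∈ E
      · rw [if_pos hrE]
        have h1 := (hT 0 h0).1.card_le (x := 2 * r + 2) (p := fun t => t ∈ Z r)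
          fun t ht => (hZmem r t ht).2
        rw [hBg 0 h0 r (by simpa using hrN), Finset.filter_univ_mem] at h1
        have := hgW (r % N)
        omega
      · rw [if_neg hrE, add_zero]
        rcases (Z r).eq_empty_or_nonempty with h | ⟨t, ht⟩
        · simp [h]
        have hconst : ∀ i < k, ∀ s ∈ Z r, T i s = T i t := by
          intro i hi s hs
          by_contra hne
          refine hrE (Finset.mem_filter.2 ⟨hr, i, hi, ?_⟩)
          rcases lt_or_gt_of_ne hne with h | h
          · exact ⟨s, hs, t, ht, h⟩
          · exact ⟨t, ht, s, hs, h⟩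
        have := he (fun i => (T i t / 2 - 1) % N) (fun i => Nat.mod_lt _ hN)
          (((List.finRange z.length).filter fun s => s ∈ Z r).map f) fun i hi => by
            obtain ⟨u, hu, hu', -⟩ := hgadT i hi t (hZmem r t ht).1
            have h1 := (hT i hi).1.sub_of (x := 2 * u + 2) (p := fun s => s ∈ Z r)
              fun s hs => (hconst i hi s hs).trans hu'
            rw [hBg i hi u hu] at h1
            have h2 : T i t / 2 - 1 = u := by omega
            rw [h2]
            exact h1
        rw [List.length_map, Tagging.length_filter, Finset.filter_univ_mem] at this
        exact this
    have h1 := Finset.card_eq_sum_card_fiberwise hmaps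
    calc C.card = ∑ r ∈ Finset.range N, (Z r).card := h1
      _ ≤ ∑ r ∈ Finset.range N, (e + if r ∈ E then W else 0) := Finset.sum_le_sum hZW
      _ = N * e + E.card * W := by
        rw [Finset.sum_add_distrib, Finset.sum_const, Finset.card_range, smul_eq_mul,
          ← Finset.sum_filter, Finset.sum_const, smul_eq_mul]
        congr 3
        ext r
        exact Finset.mem_filter.trans ⟨fun h => h.2, fun h => ⟨(Finset.mem_filter.1 h).1, h⟩⟩
      _ ≤ _ := by
        rw [mul_comm E.card]
        exact Nat.add_le_add_left (Nat.mul_le_mul_left _ hEcard) _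
  omega

end KLCS

namespace KLCS

open scoped List

/-! ### A long common subsequence from a matching tuple of gadgets -/

theorem flatMap_replicate_const {α : Type*} (n c : ℕ) (a : α) :
    ((List.range n).flatMap fun _ => List.replicate c a) = List.replicate (n * c) a := by
  induction n with
  | zero => simp
  | succ n ih => rw [List.range_succ, List.flatMap_append, ih]; simp [Nat.succ_mul]

theorem replicate_sublist_separator {k W i x : ℕ} (h1 : k - 1 - i ≤ x) (h2 : x ≤ k - 1 + i)
    (hi : i < k) : List.replicate (weight k W x) x <+ separator k W i := by
  obtain ⟨y, hy, rfl⟩ : ∃ y, y < 2 * i + 1 ∧ x = k - 1 + i - y := ⟨k - 1 + i - x, by omega, by omega⟩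
  obtain ⟨c, hc⟩ := Nat.exists_eq_add_of_lt hy
  rw [separator, hc, show y + c + 1 = y + (1 + c) by omega, List.range_add, List.range_add]
  simp only [List.flatMap_append, List.map_append, List.flatMap_map]
  simp only [List.range_one, List.flatMap_cons, List.flatMap_nil, List.append_nil, add_zero]
  exact (List.sublist_append_left _ _).trans (List.sublist_append_right _ _)

theorem length_flatMap_range {α : Type*} (n : ℕ) (F : ℕ → List α) :
    ((List.range n).flatMap F).length = ∑ x ∈ Finset.range n, (F x).length := by
  induction n with
  | zero => simp
  | succ n ih => rw [List.range_succ, List.flatMap_append, Finset.sum_range_succ, ← ih]; simp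

/-- The concatenation of `F t` for `a ≤ t < a + n`. -/
def segment {α : Type*} (F : ℕ → List α) (a n : ℕ) : List α :=
  (List.range n).flatMap fun t => F (a + t)

theorem segment_add {α : Type*} (F : ℕ → List α) (a n m : ℕ) :
    segment F a (n + m) = segment F a n ++ segment F (a + n) m := by
  simp [segment, List.range_add, List.flatMap_map, add_assoc]

theorem replicate_sublist_segment {k W i x : ℕ} {g : ℕ → List ℕ} (h1 : k - 1 - i ≤ x)
    (h2 : x ≤ k - 1 + i) (hi : i < k) (a n : ℕ) :
    List.replicate (n * weight k W x) x <+ segment (fun t => separator k W i ++ g t) a n := by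
  rw [← flatMap_replicate_const]
  exact flatMap_sublist _ fun t _ =>
    (replicate_sublist_separator h1 h2 hi).trans (List.sublist_append_left _ _)

/-- The part of the common subsequence before the gadgets: `D j` counts the gadgets that the strings
`j, j + 1, …` skip in one phase, using the separating letter `k - 1 - j`. -/
def frontWord (k W a n : ℕ) (D : ℕ → ℕ) : List ℕ :=
  (List.range n).flatMap fun y =>
    List.replicate (D (k - 1 - (a + y)) * weight k W (a + y)) (a + y)

/-- The part of the common subsequence after the gadgets: `D j` counts the gadgets that the strings
`j, j + 1, …` skip in one phase, using the separating letter `k - 1 + j`. -/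
def backWord (k W a n : ℕ) (D : ℕ → ℕ) : List ℕ :=
  (List.range n).flatMap fun y =>
    List.replicate (D (a + y + 1) * weight k W (k + a + y)) (k + a + y)

theorem frontWord_sublist_segment {k W i : ℕ} (hi : i < k) {g : ℕ → List ℕ} (D : ℕ → ℕ) (a n : ℕ)
    (hn : n ≤ i) :
    frontWord k W (k - 1 - i) n D <+ segment (fun t => separator k W i ++ g t) a
      (∑ y ∈ Finset.range n, D (i - y)) := by
  induction n with
  | zero => simp [frontWord]
  | succ n ih =>
    rw [Finset.sum_range_succ, segment_add, frontWord, List.range_succ, List.flatMap_append]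
    refine (ih (by omega)).append ?_
    rw [List.flatMap_cons, List.flatMap_nil, List.append_nil,
      show k - 1 - (k - 1 - i + n) = i - n by omega]
    exact replicate_sublist_segment (by omega) (by omega) hi _ _

theorem backWord_sublist_segment {k W i : ℕ} (hi : i < k) {g : ℕ → List ℕ} (D : ℕ → ℕ) (a n : ℕ)
    (hn : n ≤ i) :
    backWord k W 0 n D <+ segment (fun t => separator k W i ++ g t) a
      (∑ y ∈ Finset.range n, D (y + 1)) := by
  induction n with
  | zero => simp [backWord]
  | succ n ih =>
    rw [Finset.sum_range_succ, segment_add, backWord, List.range_succ, List.flatMap_append]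
    refine (ih (by omega)).append ?_
    rw [List.flatMap_cons, List.flatMap_nil, List.append_nil, zero_add]
    exact replicate_sublist_segment (by omega) (by omega) hi _ _

theorem frontWord_add (k W a n m : ℕ) (D : ℕ → ℕ) :
    frontWord k W a (n + m) D = frontWord k W a n D ++ frontWord k W (a + n) m D := by
  simp [frontWord, List.range_add, List.flatMap_map, add_assoc]

theorem backWord_add (k W a n m : ℕ) (D : ℕ → ℕ) :
    backWord k W a (n + m) D = backWord k W a n D ++ backWord k W (a + n) m D := by
  simp [backWord, List.range_add, List.flatMap_map, add_assoc]

/-- If the gadgets with numbers `p 0, …, p (k - 1)` have a common subsequence `u` and all gadgets have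
the common subsequence `u'`, then the strings have a common subsequence that takes all separators,
once `u`, and otherwise `u'`. String `i` skips `D 1 + ⋯ + D i` of its gadgets before the gadgets of
string `0`, for differences `D` such that `p i` comes to lie opposite to `p 0`. -/
theorem exists_common_text {k W N : ℕ} (hk : 0 < k) (hN : 0 < N) {g : ℕ → ℕ → List ℕ}
    {fill : ℕ → ℕ} {p : ℕ → ℕ} (hp : ∀ i, p i < N) {u u' : List ℕ}
    (hu : ∀ i < k, u <+ g i (p i)) (hu' : ∀ i < k, ∀ v, u' <+ g i v) :
    ∃ z : List ℕ, z.length + u'.length =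
        u.length + N * u'.length + W * ∑ i ∈ Finset.range k, (i + 1) * N ∧
      ∀ i < k, z <+ text k W N i (g i) (fill i) := by
  set D : ℕ → ℕ := fun j => (p j + N - p (j - 1)) % N with hD
  have hDN : ∀ j, D j ≤ N := fun j => (Nat.mod_lt _ hN).le
  set Q : ℕ → ℕ := fun i => ∑ y ∈ Finset.range i, D (y + 1) with hQ
  have hQmod : ∀ i, (Q i + p 0) % N = p i := by
    intro i
    induction i with
    | zero => simp [hQ, Nat.mod_eq_of_lt (hp 0)]
    | succ i ih =>
      have h1 : Q (i + 1) = Q i + D (i + 1) := Finset.sum_range_succ _ _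
      rw [h1, show Q i + D (i + 1) + p 0 = (Q i + p 0) + D (i + 1) by ring, Nat.add_mod, ih, hD]
      simp only [Nat.add_sub_cancel, Nat.mod_mod, Nat.add_mod_mod]
      rw [show p i + (p (i + 1) + N - p i) = p (i + 1) + N by have := hp i; omega,
        Nat.add_mod_right, Nat.mod_eq_of_lt (hp _)]
  have hQN : ∀ i, Q i + ∑ y ∈ Finset.range i, (N - D (y + 1)) = i * N := by
    intro i
    rw [hQ, ← Finset.sum_add_distrib, Finset.sum_congr rfl (g := fun _ => N)]
    · simp
    · intro y _
      have := hDN (y + 1)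
      omega
  set h : ℕ → List ℕ := fun r => if r = p 0 then u else u' with hh
  set run : List ℕ := (List.range N).flatMap fun r =>
    List.replicate (weight k W (k - 1)) (k - 1) ++ h r with hrun
  refine ⟨frontWord k W 0 (k - 1) D ++ run ++ backWord k W 0 (k - 1) (fun j => N - D j), ?_, ?_⟩
  · set c : ℕ → ℕ := fun y => (k - 1 - y) * W with hc
    have hfw : (frontWord k W 0 (k - 1) D).length =
        ∑ y ∈ Finset.range (k - 1), D (y + 1) * c y := by
      rw [frontWord, length_flatMap_range, ← Finset.sum_range_reflect]
      refine Finset.sum_congr rfl fun y hy => ?_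
      rw [Finset.mem_range] at hy
      rw [List.length_replicate, weight, zero_add]
      congr 2 <;> omega
    have hbw : (backWord k W 0 (k - 1) fun j => N - D j).length =
        ∑ y ∈ Finset.range (k - 1), (N - D (y + 1)) * c y := by
      rw [backWord, length_flatMap_range]
      refine Finset.sum_congr rfl fun y hy => ?_
      rw [Finset.mem_range] at hy
      rw [List.length_replicate, weight, zero_add]
      congr 2
      omega
    have hrl : run.length + u'.length = N * (k * W) + (u.length + N * u'.length) := by
      have hmem : p 0 ∈ Finset.range N := Finset.mem_range.2 (hp 0)
      have h1 : ∑ r ∈ Finset.range N, (h r).length + u'.length = u.length + N * u'.length := by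
        have e1 := Finset.add_sum_erase (Finset.range N) (fun r => (h r).length) hmem
        have e2 := Finset.add_sum_erase (Finset.range N) (fun _ => u'.length) hmem
        rw [show ∑ _x ∈ Finset.range N, u'.length = N * u'.length by simp] at e2
        rw [← e1, ← e2, Finset.sum_congr rfl (g := fun _ => u'.length)]
        · simp only [hh, if_true]
          ring
        · intro r hr
          simp only [hh, if_neg (Finset.ne_of_mem_erase hr)]
      have hw : weight k W (k - 1) = k * W := by
        rw [weight]
        congr 1
        omega
      rw [← h1, hrun, length_flatMap_range]
      simp only [List.length_append, List.length_replicate, Finset.sum_add_distrib,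
        Finset.sum_const, Finset.card_range, smul_eq_mul, hw]
      ring
    have hsum : ∑ y ∈ Finset.range (k - 1), D (y + 1) * c y +
        ∑ y ∈ Finset.range (k - 1), (N - D (y + 1)) * c y + N * (k * W) =
        W * ∑ i ∈ Finset.range k, (i + 1) * N := by
      rw [← Finset.sum_add_distrib, Finset.sum_congr rfl (g := fun y => N * c y)]
      · rw [← Finset.sum_range_reflect (fun i => (i + 1) * N) k]
        obtain ⟨k', rfl⟩ := Nat.exists_eq_add_of_lt hk
        simp only [zero_add, Nat.add_sub_cancel]
        rw [Finset.sum_range_succ', mul_add, Finset.mul_sum]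
        congr 1
        · refine Finset.sum_congr rfl fun y hy => ?_
          rw [Finset.mem_range] at hy
          simp only [hc]
          rw [show k' - (y + 1) + 1 = k' - y by omega, zero_add, Nat.add_sub_cancel]
          ring
        · simp only [Nat.sub_zero]
          ring
      · intro y _
        rw [← add_mul]
        congr 1
        have := hDN (y + 1)
        omega
    simp only [List.length_append, hfw, hbw]
    omega
  · intro i hi
    have hk' : k - 1 = (k - 1 - i) + i := by omega
    have hsum : ∑ y ∈ Finset.range i, D (i - y) = Q i := by
      rw [hQ, ← Finset.sum_range_reflect]
      refine Finset.sum_congr rfl fun y hy => ?_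
      rw [Finset.mem_range] at hy
      congr 1
      omega
    have hseg : (List.range ((i + 1) * N)).flatMap (fun t => separator k W i ++ g i (t % N)) =
        segment (fun t => separator k W i ++ g i (t % N)) 0 (Q i) ++
        segment (fun t => separator k W i ++ g i (t % N)) (Q i) N ++
        segment (fun t => separator k W i ++ g i (t % N)) (Q i + N)
          (∑ y ∈ Finset.range i, (N - D (y + 1))) := by
      have h1 := segment_add (fun t => separator k W i ++ g i (t % N)) 0 (Q i) N
      have h2 := segment_add (fun t => separator k W i ++ g i (t % N)) 0 (Q i + N)
        (∑ y ∈ Finset.range i, (N - D (y + 1)))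
      rw [zero_add] at h1 h2
      rw [← h1, ← h2, segment, show Q i + N + ∑ y ∈ Finset.range i, (N - D (y + 1)) = (i + 1) * N by
        rw [add_right_comm, hQN]; ring]
      simp
    have hfront : frontWord k W 0 (k - 1 - i) D <+ front k W N i := by
      refine flatMap_sublist _ fun y _ => ?_
      rw [zero_add, List.replicate_sublist_replicate]
      exact Nat.mul_le_mul_right _ (hDN _)
    have hback : backWord k W i (k - 1 - i) (fun j => N - D j) <+ back k W N i := by
      refine flatMap_sublist _ fun y _ => ?_
      rw [List.replicate_sublist_replicate]
      exact Nat.mul_le_mul_right _ (Nat.sub_le _ _)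
    have hrun' : run <+ segment (fun t => separator k W i ++ g i (t % N)) (Q i) N := by
      refine flatMap_sublist _ fun r _ => ?_
      refine (replicate_sublist_separator (by omega) (by omega) hi).append ?_
      simp only [hh]
      split_ifs with hr
      · rw [hr, hQmod]
        exact hu i hi
      · exact hu' i hi _
    have h1 := frontWord_sublist_segment hi (W := W) (g := fun t => g i (t % N)) D 0 i le_rfl
    rw [hsum] at h1
    have h2 := backWord_sublist_segment hi (W := W) (g := fun t => g i (t % N)) (fun j => N - D j)
      (Q i + N) i le_rfl
    rw [text, hseg]
    conv_lhs => rw [hk', frontWord_add, add_comm (k - 1 - i) i, backWord_add, zero_add, zero_add]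
    have h3 := ((((hfront.append h1).append hrun').append h2).append hback).trans
      (List.sublist_append_left _ (List.replicate (fill i) (3 * k + i)))
    simpa only [List.append_assoc] using h3

end KLCS

namespace KLCS

open scoped List

/-! ### The strings for a formula -/

theorem sum_range_succ_mul_two (n : ℕ) : (∑ x ∈ Finset.range n, (x + 1)) * 2 = n * (n + 1) := by
  induction n with
  | zero => simp
  | succ n ih => rw [Finset.sum_range_succ, add_mul, ih]; ring

theorem length_front_add_length_back (k W N i : ℕ) :
    (front k W N i).length + (back k W N i).length = N * W * ((k - 1 - i) * (k - i)) := by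
  set n := k - 1 - i with hn
  have h1 : (front k W N i).length = N * W * ∑ x ∈ Finset.range n, (x + 1) := by
    rw [front, length_flatMap_range, Finset.mul_sum]
    refine Finset.sum_congr rfl fun x hx => ?_
    rw [Finset.mem_range] at hx
    rw [List.length_replicate, weight, min_eq_left (by omega)]
    ring
  have h2 : (back k W N i).length = N * W * ∑ x ∈ Finset.range n, (x + 1) := by
    rw [back, length_flatMap_range, ← Finset.sum_range_reflect, Finset.mul_sum]
    refine Finset.sum_congr rfl fun x hx => ?_
    rw [Finset.mem_range] at hx
    rw [List.length_replicate, weight, min_eq_right (by omega),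
      show 2 * k - 1 - (k + i + (n - 1 - x)) = x + 1 by omega]
    ring
  rw [h1, h2, ← mul_two, mul_assoc, sum_range_succ_mul_two]
  by_cases h : i < k
  · rw [show n + 1 = k - i by omega]
  · rw [show n = 0 by omega]
    simp

theorem sum_weights_separator {k i : ℕ} (hi : i < k) :
    ∑ y ∈ Finset.range (2 * i + 1), min (k - 1 + i - y + 1) (2 * k - 1 - (k - 1 + i - y)) +
      (k - 1 - i) * (k - i) = k ^ 2 := by
  induction i with
  | zero =>
    obtain ⟨k, rfl⟩ := Nat.exists_eq_add_of_lt hi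
    simp only [mul_zero, zero_add, Finset.sum_range_one, add_zero, Nat.sub_zero,
      Nat.add_sub_cancel]
    rw [min_eq_left (by omega)]
    ring
  | succ i ih =>
    have ih := ih (by omega)
    rw [show 2 * (i + 1) + 1 = 2 * i + 1 + 1 + 1 by ring, Finset.sum_range_succ,
      Finset.sum_range_succ']
    obtain ⟨j, rfl⟩ := Nat.exists_eq_add_of_lt hi
    have e1 : ∀ y ∈ Finset.range (2 * i + 1),
        min (i + 1 + j + 1 - 1 + (i + 1) - (y + 1) + 1)
          (2 * (i + 1 + j + 1) - 1 - (i + 1 + j + 1 - 1 + (i + 1) - (y + 1))) =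
        min (i + 1 + j + 1 - 1 + i - y + 1)
          (2 * (i + 1 + j + 1) - 1 - (i + 1 + j + 1 - 1 + i - y)) := by
      intro y _
      congr 2 <;> omega
    rw [Finset.sum_congr rfl e1, min_eq_right (by omega), min_eq_left (by omega)]
    rw [show i + 1 + j + 1 - 1 - i = j + 1 by omega, show i + 1 + j + 1 - i = j + 2 by omega] at ih
    rw [show i + 1 + j + 1 - 1 - (i + 1) = j by omega,
      show i + 1 + j + 1 - (i + 1) = j + 1 by omega,
      show 2 * (i + 1 + j + 1) - 1 - (i + 1 + j + 1 - 1 + (i + 1) - 0) = j + 1 by omega,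
      show i + 1 + j + 1 - 1 + (i + 1) - (2 * i + 1 + 1) + 1 = j + 1 by omega]
    linarith

theorem length_separator {k W i : ℕ} (hi : i < k) :
    (separator k W i).length = (k ^ 2 - (k - 1 - i) * (k - i)) * W := by
  rw [separator, length_flatMap_range, ← sum_weights_separator hi, Nat.add_sub_cancel,
    Finset.sum_mul]
  exact Finset.sum_congr rfl fun y _ => by rw [List.length_replicate, weight]

/-- The length of string `i` without the filling letters, if all gadgets have length `W`. -/
def textLength (k W N i : ℕ) : ℕ :=
  N * W * ((i + 1) * (k ^ 2 + 1 - (k - 1 - i) * (k - i)) + (k - 1 - i) * (k - i))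

theorem length_text {k W N i fill : ℕ} {g : ℕ → List ℕ} (hi : i < k)
    (hg : ∀ v, (g v).length = W) :
    (text k W N i g fill).length = textLength k W N i + fill := by
  have h1 := length_front_add_length_back k W N i
  have h2 : (k - 1 - i) * (k - i) ≤ k ^ 2 := by
    rw [← sum_weights_separator hi]
    exact Nat.le_add_left _ _
  rw [text, List.length_append, List.length_append, List.length_append, length_flatMap_range]
  simp only [List.length_append, hg, length_separator hi, Finset.sum_const, Finset.card_range,
    smul_eq_mul, List.length_replicate]
  rw [textLength, mul_add (N * W), ← h1,
    show k ^ 2 + 1 - (k - 1 - i) * (k - i) = k ^ 2 - (k - 1 - i) * (k - i) + 1 by omega]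
  ring

theorem textLength_le {k W N i : ℕ} (hi : i < k) :
    textLength k W N i ≤ N * W * (k * (k ^ 2 + 1)) := by
  have h2 : (k - 1 - i) * (k - i) ≤ k ^ 2 + 1 := by
    rw [← sum_weights_separator hi]
    omega
  obtain ⟨c, hc⟩ := Nat.exists_eq_add_of_le h2
  rw [textLength, hc, Nat.add_sub_cancel_left]
  refine Nat.mul_le_mul_left _ ?_
  have : (k - 1 - i) * (k - i) ≤ k * ((k - 1 - i) * (k - i)) := Nat.le_mul_of_pos_left _ (by omega)
  have : (i + 1) * c ≤ k * c := Nat.mul_le_mul_right _ hi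
  rw [mul_add]
  omega

/-- The parameters of the strings for a formula with `n` variables and `m` clauses. -/
structure Params where
  /-- the number of strings -/
  k : ℕ
  /-- the number of variables -/
  n : ℕ
  /-- the number of clauses -/
  m : ℕ

namespace Params

variable (p : Params)

/-- The number of variables per group. -/
def s : ℕ := (p.n + p.k - 1) / p.k
/-- The number of partial assignments. -/
def N : ℕ := 2 ^ p.s
/-- The number of copies of the letter between clause gadgets. -/
def w : ℕ := p.k * p.m + 1
/-- The length of a common subsequence of gadgets that do not match. -/
def e : ℕ := (p.m + 1) * p.w + p.m - 1
/-- The length of a gadget, and the unit of the weights. -/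
def W : ℕ := p.e + (p.m + 1) * p.w + p.m * p.k
/-- The length of the strings. -/
def L : ℕ := p.N * p.W * (p.k * (p.k ^ 2 + 1))
/-- The length of a longest common subsequence if the formula is not satisfiable. -/
def thr : ℕ := p.N * p.e + p.W * ∑ i ∈ Finset.range p.k, (i + 1) * p.N

theorem e_succ : p.e + 1 = (p.m + 1) * (p.k * p.m + 1) + p.m := by
  have h1 : p.e + 1 = (p.m + 1) * p.w + p.m := by
    have : 0 < (p.m + 1) * p.w := by simp [w]
    rw [e]
    omega
  exact h1

theorem N_pos : 0 < p.N := Nat.two_pow_pos _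

theorem W_pos : 0 < p.W := by
  have : 0 < (p.m + 1) * p.w := by simp [w]
  rw [W]
  omega

/-- String `i`, where `b i v r` tells whether the assignment `v` of group `i` satisfies clause `r`. -/
def string (b : ℕ → ℕ → ℕ → Bool) (i : ℕ) : List ℕ :=
  text p.k p.W p.N i (fun v => gadget p.k p.w p.m p.e i (b i v)) (p.L - textLength p.k p.W p.N i)

variable {p} {b : ℕ → ℕ → ℕ → Bool}

theorem length_string {i : ℕ} (hi : i < p.k) : (p.string b i).length = p.L := by
  have hg : ∀ v, (gadget p.k p.w p.m p.e i (b i v)).length = p.W := fun v =>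
    length_gadget _ _ _ _ _ _
  rw [string, length_text hi hg]
  exact Nat.add_sub_cancel' (textLength_le hi)

theorem lt_of_mem_string {i a : ℕ} (hk : 2 ≤ p.k) (hi : i < p.k) (h : a ∈ p.string b i) :
    a < 5 * p.k := by
  simp only [string, text, List.mem_append, List.mem_flatMap, List.mem_replicate] at h
  rcases h with ((h | ⟨t, -, h | h⟩) | h) | h
  · have := mem_front h; omega
  · have := mem_separator hi h; omega
  · have := mem_gadget h; omega
  · have := mem_back h; omega
  · omega

theorem length_le_thr {z : List ℕ} (hk : 2 ≤ p.k)
    (hb : ¬ ∃ v : ℕ → ℕ, (∀ i, v i < p.N) ∧ ∀ r < p.m, ∃ i < p.k, b i (v i) r = true)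
    (hz : ∀ i < p.k, z <+ p.string b i) : z.length ≤ p.thr := by
  refine length_le_of_common_text hk p.W_pos p.N_pos (fun i hi v a ha => ?_)
    (fun v => (length_gadget _ _ _ _ _ _).le) (fun v hv z hz => ?_) hz
  · have := mem_gadget ha
    exact ⟨by omega, fun j hj h => by omega⟩
  · exact length_le_of_common_gadget hk p.e_succ hz fun h => hb ⟨v, hv, h⟩

theorem exists_length_eq (hk : 2 ≤ p.k)
    (hb : ∃ v : ℕ → ℕ, (∀ i, v i < p.N) ∧ ∀ r < p.m, ∃ i < p.k, b i (v i) r = true) :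
    ∃ z : List ℕ, z.length = p.thr + 1 ∧ ∀ i < p.k, z <+ p.string b i := by
  obtain ⟨v, hv, h⟩ := hb
  obtain ⟨u, hu, hug⟩ := exists_common_clausesGadget (w := p.w) (b := fun i => b i (v i)) h
  obtain ⟨z, hz, hzt⟩ := exists_common_text (k := p.k) (W := p.W) (by omega) p.N_pos
    (g := fun i v => gadget p.k p.w p.m p.e i (b i v))
    (fill := fun i => p.L - textLength p.k p.W p.N i) hv (u := u)
    (u' := List.replicate p.e (4 * p.k + 1))
    (fun i _ => (hug i).trans (clausesGadget_sublist_gadget _ _ _ _ _ _))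
    (fun i _ v => replicate_sublist_gadget _ _ _ _ _ _)
  refine ⟨z, ?_, hzt⟩
  have := p.e_succ
  rw [List.length_replicate, hu] at hz
  rw [thr]
  have hw : p.w = p.k * p.m + 1 := rfl
  rw [hw] at hz
  omega

end Params

/-- Lists of equal length over the letters `0, …, σ - 1`, as functions. -/
theorem exists_instance {k L σ : ℕ} (hk : 0 < k) {X : ℕ → List ℕ} (hlen : ∀ i < k, (X i).length = L)
    (hlt : ∀ i < k, ∀ a ∈ X i, a < σ) :
    ∃ x : Fin k → Fin L → Fin σ, encode x = L :: (List.range k).flatMap X ∧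
      ∀ out, IsLCSLength x out →
        (∃ z : List ℕ, z.length = out ∧ ∀ i < k, z <+ X i) ∧
        ∀ z : List ℕ, (∀ i < k, z <+ X i) → z.length ≤ out := by
  set x : Fin k → Fin L → Fin σ := fun i j =>
    ⟨(X i)[(j : ℕ)]'(by rw [hlen i i.2]; exact j.2), hlt i i.2 _ (List.getElem_mem _)⟩ with hx
  have hX : ∀ i : Fin k, (List.ofFn fun j => (x i j : ℕ)) = X i := by
    intro i
    refine List.ext_getElem (by simp [hlen i i.2]) fun j h1 h2 => ?_
    simp [hx]
  have hmap : ∀ i : Fin k, (List.ofFn (x i)).map Fin.val = X i := by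
    intro i
    rw [List.map_ofFn, ← hX i]
    rfl
  refine ⟨x, ?_, fun out hout => ⟨?_, fun z hz => ?_⟩⟩
  · rw [encode]
    congr 1
    simp only [hX]
    rw [List.flatMap_def, ← List.map_coe_finRange_eq_range, List.map_map, List.ofFn_eq_map]
    rfl
  · obtain ⟨z, hz, hzx⟩ := hout.1
    refine ⟨z.map Fin.val, by simpa using hz, fun i hi => ?_⟩
    have := (hzx ⟨i, hi⟩).map Fin.val
    rwa [hmap] at this
  · have h0 := hz 0 hk
    rw [← hmap ⟨0, hk⟩, List.sublist_map_iff] at h0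
    obtain ⟨y, -, rfl⟩ := h0
    rw [List.length_map]
    refine hout.2 ⟨y, rfl, fun i => ?_⟩
    have h1 := hz i i.2
    rw [← hmap i, List.sublist_map_iff] at h1
    obtain ⟨y', hy', h⟩ := h1
    rwa [List.map_injective_iff.2 Fin.val_injective h]

end KLCS

namespace KLCS

open RAM

/-! ### The program that writes the strings -/

namespace Red

instance : Add Ex := ⟨Ex.op .plus⟩
instance : Sub Ex := ⟨Ex.op .monus⟩
instance : Mul Ex := ⟨Ex.op .times⟩
instance : Div Ex := ⟨Ex.op .quot⟩

section Simp

variable (M : ℕ → ℕ) (ρ : ℕ → ℕ) (a b : Ex)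

@[simp] theorem eval_add : (a + b).eval M ρ = a.eval M ρ + b.eval M ρ := rfl
@[simp] theorem eval_sub : (a - b).eval M ρ = a.eval M ρ - b.eval M ρ := rfl
@[simp] theorem eval_mul : (a * b).eval M ρ = a.eval M ρ * b.eval M ρ := rfl
@[simp] theorem eval_div : (a / b).eval M ρ = a.eval M ρ / b.eval M ρ := rfl
@[simp] theorem eval_lit (c : ℕ) : (Ex.lit c).eval M ρ = c := rfl
@[simp] theorem eval_var (x : ℕ) : (Ex.var x).eval M ρ = ρ x := rfl
@[simp] theorem eval_read : (Ex.read a).eval M ρ = M (a.eval M ρ) := rfl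

end Simp

/-- `1` if the values are equal, and `0` otherwise. -/
def eqEx (a b : Ex) : Ex := .lit 1 - ((a - b) + (b - a))

theorem eval_eqEx (M ρ : ℕ → ℕ) (a b : Ex) :
    (eqEx a b).eval M ρ = if a.eval M ρ = b.eval M ρ then 1 else 0 := by
  simp only [eqEx, eval_sub, eval_lit, eval_add]
  split_ifs <;> omega

/-- The remainder of a division. -/
def modEx (a b : Ex) : Ex := a - a / b * b

theorem eval_modEx (M ρ : ℕ → ℕ) (a b : Ex) :
    (modEx a b).eval M ρ = a.eval M ρ % b.eval M ρ := by
  simp only [modEx, eval_sub, eval_mul, eval_div]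
  have := Nat.div_add_mod' (a.eval M ρ) (b.eval M ρ)
  omega

/-- A power of `2`. -/
def powEx (a : Ex) : Ex := .iter 10 a (.lit 1) (.var 21 + .var 21)

theorem iterIdx_double (n : ℕ) : iterIdx (fun _ y => y + y) 1 n = 2 ^ n := by
  induction n with
  | zero => rfl
  | succ n ih => rw [iterIdx, ih]; ring

theorem eval_powEx_body (M ρ : ℕ → ℕ) (j y : ℕ) :
    (Ex.var 21 + Ex.var 21).eval M (iterEnv ρ 10 j y) = y + y := by
  simp [iterEnv]

theorem eval_powEx (M ρ : ℕ → ℕ) (a : Ex) : (powEx a).eval M ρ = 2 ^ a.eval M ρ := by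
  simp only [powEx, Ex.eval.eq_5, eval_powEx_body, eval_lit]
  exact iterIdx_double _

/-! The variables `0, …, 10` contain the number of variables of the formula, the number of clauses,
the parameters `s`, `N`, `w`, `e`, `W` and `L` of the strings, the address to which the input is
moved, a bound on its length, and the threshold. Variable `12` is the number of the string, `13` the
number of the gadget in the string, `14` counts separating letters, `15` is the number of the
clause, `16` counts letters in a clause gadget, and `17` counts repetitions. -/

/-- The position in the input of the clause with a given number. -/
def posEx (r : Ex) : Ex := .iter 11 r (.lit 2) (.var 23 + .read (.var 23) + .lit 1)

/-- A literal of clause `15`; variable `24` is the number of the literal. -/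
def literalEx : Ex := .read (posEx (.var 15) + .lit 1 + .var 24)

/-- The propositional variable of this literal. -/
def litVarEx : Ex := literalEx / .lit 2

/-- The value that the assignment `13` gives to this propositional variable. -/
def litBitEx : Ex :=
  modEx (modEx (.var 13) (.var 3) / powEx (modEx litVarEx (.var 2))) (.lit 2)

/-- `1` if the variable of the literal is in group `12` and the assignment `13` satisfies it. -/
def litSatEx : Ex :=
  eqEx (litVarEx / .var 2) (.var 12) * eqEx litBitEx (modEx literalEx (.lit 2))

/-- The number of literals of clause `15` that are satisfied by the assignment `13` of group `12`. -/
def countEx : Ex := .iter 12 (.read (posEx (.var 15))) (.lit 0) (.var 25 + litSatEx)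

/-- `1` if there is such a literal, and `0` otherwise. -/
def satEx : Ex := .lit 1 - (.lit 1 - countEx)

/-- The number of the letter `16` of a clause gadget. -/
def letterNoEx (k : ℕ) : Ex :=
  (.lit 1 - .var 12) * .var 16 + (.lit 1 - (.lit 1 - .var 12)) * (.lit (k - 1) - .var 16)

/-- `1` if this letter is replaced because the clause is not satisfied. -/
def replacedEx (k : ℕ) : Ex := eqEx (letterNoEx k) (.var 12) * (.lit 1 - satEx)

/-- The letter of a clause gadget. -/
def letterEx (k : ℕ) : Ex :=
  replacedEx k * (.lit (3 * k) + .var 12) + (.lit 1 - replacedEx k) * (.lit (2 * k) + letterNoEx k)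

/-- The weight of a separating letter. -/
def weightEx (k : ℕ) (x : Ex) : Ex :=
  (x + .lit 1 - (x + .lit 1 - (.lit (2 * k - 1) - x))) * .var 6

/-- Repetitions of a letter. -/
def repGen (big : Bool) (n a : Ex) : Gen := .loop big 17 n (.emit a)

/-- The front of a string. -/
def frontGen (k : ℕ) : Gen :=
  .loop false 14 (.lit (k - 1) - .var 12) (repGen true (.var 3 * weightEx k (.var 14)) (.var 14))

/-- The letter number `14` of a separator. -/
def sepLetterEx (k : ℕ) : Ex := .lit (k - 1) + .var 12 - .var 14

/-- A separator. -/
def sepGen (k : ℕ) : Gen :=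
  .loop false 14 (.lit 2 * .var 12 + .lit 1)
    (repGen false (weightEx k (sepLetterEx k)) (sepLetterEx k))

/-- The letter number `14` of the back of a string. -/
def backLetterEx (k : ℕ) : Ex := .lit k + .var 12 + .var 14

/-- The back of a string. -/
def backGen (k : ℕ) : Gen :=
  .loop false 14 (.lit (k - 1) - .var 12)
    (repGen true (.var 3 * weightEx k (backLetterEx k)) (backLetterEx k))

/-- A clause gadget. -/
def clauseGen (k : ℕ) : Gen := .loop false 16 (.lit k) (.emit (letterEx k))

/-- The gadgets for all clauses. -/
def clausesGen (k : ℕ) : Gen :=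
  .seq (repGen false (.var 4) (.lit (4 * k)))
    (.loop false 15 (.var 1) (.seq (clauseGen k) (repGen false (.var 4) (.lit (4 * k)))))

/-- The gadget of an assignment. -/
def gadgetGen (k : ℕ) : Gen :=
  .seq (repGen false ((.lit 1 - .var 12) * .var 5) (.lit (4 * k + 1)))
    (.seq (clausesGen k)
      (repGen false ((.lit 1 - (.lit 1 - .var 12)) * .var 5) (.lit (4 * k + 1))))

/-- The length of a string without the filling letters. -/
def textLengthEx (k : ℕ) : Ex :=
  .var 3 * .var 6 * ((.var 12 + .lit 1) *
    (.lit (k ^ 2 + 1) - (.lit (k - 1) - .var 12) * (.lit k - .var 12)) +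
      (.lit (k - 1) - .var 12) * (.lit k - .var 12))

/-- A string. -/
def textGen (k : ℕ) : Gen :=
  .seq (.seq (.seq (frontGen k)
    (.loop true 13 ((.var 12 + .lit 1) * .var 3) (.seq (sepGen k) (gadgetGen k))))
    (backGen k)) (repGen true (.var 7 - textLengthEx k) (.lit (3 * k) + .var 12))

/-- The input for `k`-LCS: the length of the strings, and the strings. -/
def inputGen (k : ℕ) : Gen := .seq (.emit (.var 7)) (.loop false 12 (.lit k) (textGen k))

/-- The computation of the parameters. -/
def paramList (k q : ℕ) : List (ℕ × Ex) :=
  [(0, .read (.lit 0)), (1, .read (.lit 1)), (2, (.var 0 + .lit (k - 1)) / .lit k),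
    (3, powEx (.var 2)), (4, .lit k * .var 1 + .lit 1),
    (5, (.var 1 + .lit 1) * .var 4 + .var 1 - .lit 1),
    (6, .var 5 + (.var 1 + .lit 1) * .var 4 + .var 1 * .lit k),
    (7, .var 3 * .var 6 * .lit (k * (k ^ 2 + 1))),
    (9, .lit 2 + .var 1 * .lit (q + 1)),
    (8, .lit k * .var 7 + .lit 1 + .var 9),
    (10, .var 3 * .var 5 + .var 6 * (.lit (∑ i ∈ Finset.range k, (i + 1)) * .var 3))]

/-- The reduction from `q`-SAT to `k`-LCS. -/
def reduction (k q : ℕ) : Reduction where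
  params := paramList k q
  gen := inputGen k
  base := 8
  size := 9
  thr := 10

/-- The environment contains the parameters of the strings. -/
structure Vals (p : Params) (ρ : ℕ → ℕ) : Prop where
  m : ρ 1 = p.m
  s : ρ 2 = p.s
  N : ρ 3 = p.N
  w : ρ 4 = p.w
  e : ρ 5 = p.e
  W : ρ 6 = p.W
  L : ρ 7 = p.L

theorem Vals.update {p : Params} {ρ : ℕ → ℕ} (h : Vals p ρ) {x : ℕ} (hx : 12 ≤ x) (j : ℕ) :
    Vals p (Function.update ρ x j) := by
  have hne : ∀ y < 12, Function.update ρ x j y = ρ y := fun y hy =>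
    Function.update_of_ne (by omega) _ _
  exact ⟨(hne 1 (by omega)).trans h.m, (hne 2 (by omega)).trans h.s, (hne 3 (by omega)).trans h.N,
    (hne 4 (by omega)).trans h.w, (hne 5 (by omega)).trans h.e, (hne 6 (by omega)).trans h.W,
    (hne 7 (by omega)).trans h.L⟩

/-- The expression `satEx` computes the truth values `b`. -/
def SatSpec (p : Params) (M : ℕ → ℕ) (b : ℕ → ℕ → ℕ → Bool) : Prop :=
  ∀ ρ, Vals p ρ → ρ 12 < p.k → ρ 15 < p.m →
    satEx.eval M ρ = (b (ρ 12) (ρ 13 % p.N) (ρ 15)).toNat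

theorem den_repGen {M ρ : ℕ → ℕ} {big : Bool} {n a : Ex} {c : ℕ}
    (h : ∀ j, a.eval M (Function.update ρ 17 j) = c) :
    (repGen big n a).den M ρ = List.replicate (n.eval M ρ) c := by
  simp only [repGen, Gen.den, h]
  simpa using flatMap_replicate_const (n.eval M ρ) 1 c

theorem eval_weightEx {p : Params} {M ρ : ℕ → ℕ} (h : Vals p ρ) (x : Ex) :
    (weightEx p.k x).eval M ρ = weight p.k p.W (x.eval M ρ) := by
  simp only [weightEx, eval_mul, eval_sub, eval_add, eval_lit, eval_var, h.W, weight]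
  congr 1
  omega

theorem den_frontGen {p : Params} {M ρ : ℕ → ℕ} (h : Vals p ρ) :
    (frontGen p.k).den M ρ = front p.k p.W p.N (ρ 12) := by
  simp only [frontGen, Gen.den, eval_sub, eval_lit, eval_var, front]
  refine List.flatMap_congr fun x _ => ?_
  rw [den_repGen (c := x) fun j => by simp]
  have h' := h.update (x := 14) (by norm_num) x
  rw [eval_mul, eval_weightEx h', eval_var, eval_var, h'.N, Function.update_self]

theorem den_sepGen {p : Params} {M ρ : ℕ → ℕ} (h : Vals p ρ) :
    (sepGen p.k).den M ρ = separator p.k p.W (ρ 12) := by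
  simp only [sepGen, Gen.den, eval_add, eval_mul, eval_lit, eval_var, separator]
  refine List.flatMap_congr fun y _ => ?_
  rw [den_repGen (c := p.k - 1 + ρ 12 - y) fun j => by simp [sepLetterEx]]
  have h' := h.update (x := 14) (by norm_num) y
  rw [eval_weightEx h']
  simp [sepLetterEx]

theorem den_backGen {p : Params} {M ρ : ℕ → ℕ} (h : Vals p ρ) :
    (backGen p.k).den M ρ = back p.k p.W p.N (ρ 12) := by
  simp only [backGen, Gen.den, eval_sub, eval_lit, eval_var, back]
  refine List.flatMap_congr fun y _ => ?_
  rw [den_repGen (c := p.k + ρ 12 + y) fun j => by simp [backLetterEx]]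
  have h' := h.update (x := 14) (by norm_num) y
  rw [eval_mul, eval_weightEx h', eval_var, h'.N]
  simp [backLetterEx]

theorem eval_letterNoEx (M ρ : ℕ → ℕ) (k : ℕ) :
    (letterNoEx k).eval M ρ = if ρ 12 = 0 then ρ 16 else k - 1 - ρ 16 := by
  simp only [letterNoEx, eval_add, eval_mul, eval_sub, eval_lit, eval_var]
  split_ifs with h
  · simp [h]
  · rw [show 1 - ρ 12 = 0 by omega]
    simp

theorem den_clauseGen {p : Params} {M ρ : ℕ → ℕ} {b : ℕ → ℕ → ℕ → Bool} (h : Vals p ρ)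
    (hb : SatSpec p M b) (hi : ρ 12 < p.k) (hr : ρ 15 < p.m) :
    (clauseGen p.k).den M ρ = clauseGadget p.k (ρ 12) (b (ρ 12) (ρ 13 % p.N) (ρ 15)) := by
  simp only [clauseGen, Gen.den, eval_lit, clauseGadget]
  rw [← List.map_eq_flatMap]
  refine List.map_congr_left fun l _ => ?_
  have h' := hb _ (h.update (x := 16) (by norm_num) l) (by simpa using hi) (by simpa using hr)
  have hrep : (replacedEx p.k).eval M (Function.update ρ 16 l) =
      if (if ρ 12 = 0 then l else p.k - 1 - l) = ρ 12 ∧ b (ρ 12) (ρ 13 % p.N) (ρ 15) = false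
      then 1 else 0 := by
    simp only [replacedEx, eval_mul, eval_eqEx, eval_sub, eval_lit, h', eval_var, eval_letterNoEx,
      Function.update_self, ne_eq, not_false_eq_true, Nat.reduceEqDiff,
      Function.update_of_ne]
    cases b (ρ 12) (ρ 13 % p.N) (ρ 15) <;> simp
  simp only [letterEx, eval_add, eval_mul, eval_sub, eval_lit, eval_var, hrep, eval_letterNoEx,
    Function.update_self, ne_eq, not_false_eq_true, Nat.reduceEqDiff, Function.update_of_ne,
    clauseLetter]
  split_ifs <;> simp

theorem den_clausesGen {p : Params} {M ρ : ℕ → ℕ} {b : ℕ → ℕ → ℕ → Bool} (h : Vals p ρ)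
    (hb : SatSpec p M b) (hi : ρ 12 < p.k) :
    (clausesGen p.k).den M ρ =
      clausesGadget p.k p.w p.m (ρ 12) (b (ρ 12) (ρ 13 % p.N)) := by
  simp only [clausesGen, Gen.den, eval_var, clausesGadget, h.m]
  congr 1
  · rw [den_repGen (c := 4 * p.k) fun j => by simp, eval_var, h.w]
  · refine List.flatMap_congr fun r hr => ?_
    rw [List.mem_range] at hr
    have h' := h.update (x := 15) (by norm_num) r
    rw [den_repGen (c := 4 * p.k) fun j => by simp, eval_var, h'.w,
      den_clauseGen h' hb (by simpa using hi) (by simpa using hr)]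
    simp

theorem den_gadgetGen {p : Params} {M ρ : ℕ → ℕ} {b : ℕ → ℕ → ℕ → Bool} (h : Vals p ρ)
    (hb : SatSpec p M b) (hi : ρ 12 < p.k) :
    (gadgetGen p.k).den M ρ = gadget p.k p.w p.m p.e (ρ 12) (b (ρ 12) (ρ 13 % p.N)) := by
  simp only [gadgetGen, Gen.den, den_clausesGen h hb hi, gadget]
  rw [den_repGen (c := 4 * p.k + 1) fun j => by simp,
    den_repGen (c := 4 * p.k + 1) fun j => by simp]
  simp only [eval_mul, eval_sub, eval_lit, eval_var, h.e]
  split_ifs with h0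
  · simp [h0]
  · rw [show 1 - ρ 12 = 0 by omega]
    simp

theorem den_textGen {p : Params} {M ρ : ℕ → ℕ} {b : ℕ → ℕ → ℕ → Bool} (h : Vals p ρ)
    (hb : SatSpec p M b) (hi : ρ 12 < p.k) :
    (textGen p.k).den M ρ = p.string b (ρ 12) := by
  simp only [textGen, Gen.den, Params.string, text]
  rw [den_frontGen h, den_backGen h, den_repGen (c := 3 * p.k + ρ 12) fun j => by simp]
  congr 2
  · congr 1
    rw [eval_mul, eval_add, eval_var, eval_lit, eval_var, h.N]
    refine List.flatMap_congr fun t _ => ?_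
    have h' := h.update (x := 13) (by norm_num) t
    rw [den_sepGen h', den_gadgetGen h' hb (by simpa using hi)]
    simp
  · simp only [textLengthEx, eval_sub, eval_mul, eval_add, eval_var, eval_lit, h.L, h.N, h.W,
      textLength]

theorem den_inputGen {p : Params} {M ρ : ℕ → ℕ} {b : ℕ → ℕ → ℕ → Bool} (h : Vals p ρ)
    (hb : SatSpec p M b) :
    (inputGen p.k).den M ρ = p.L :: (List.range p.k).flatMap (p.string b) := by
  simp only [inputGen, Gen.den, eval_var, eval_lit, h.L, List.singleton_append]
  congr 1
  refine List.flatMap_congr fun i hi => ?_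
  rw [List.mem_range] at hi
  rw [den_textGen (h.update (by norm_num) i) hb (by simpa using hi)]
  simp

end Red

end KLCS

namespace KLCS

open RAM

/-! ### Reading the formula -/

namespace Red

/-- The group `i` of `s` variables contains the variable of the literal, and the assignment of the
group whose truth values are the binary digits of `v` satisfies the literal. -/
def litSat {n : ℕ} (s i v : ℕ) (l : SAT.Literal n) : Bool :=
  decide ((l.1 : ℕ) / s = i) && (v.testBit (l.1 % s) == l.2)

/-- The assignment `v` of group `i` satisfies clause `r` of the formula. -/
def groupSat {n : ℕ} (F : SAT.CNF n) (s i v r : ℕ) : Bool := (F.getD r []).any (litSat s i v)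

/-- The words of the input. -/
def word {n : ℕ} (F : SAT.CNF n) (a : ℕ) : ℕ := (SAT.encode F).getD a 0

/-- The position of clause `r` in the input. -/
def clausePos {n : ℕ} (F : SAT.CNF n) (r : ℕ) : ℕ :=
  2 + ((F.take r).flatMap SAT.encodeClause).length

section Word

variable {n : ℕ} (F : SAT.CNF n)

theorem word_clausePos_add {r : ℕ} (hr : r < F.length) {j : ℕ} (hj : j ≤ F[r].length) :
    word F (clausePos F r + j) = (SAT.encodeClause F[r]).getD j 0 := by
  have h : SAT.encode F = (n :: F.length :: (F.take r).flatMap SAT.encodeClause) ++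
      (SAT.encodeClause F[r] ++ (F.drop (r + 1)).flatMap SAT.encodeClause) := by
    conv_lhs => rw [SAT.encode]
    simp only [List.cons_append]
    rw [← List.flatMap_cons, ← List.flatMap_append, List.cons_getElem_drop_succ,
      List.take_append_drop]
  rw [word, h, List.getD_append_right _ _ _ _ (by simp [clausePos]; omega),
    List.getD_append _ _ _ _ (by simp [clausePos, SAT.encodeClause]; omega)]
  congr 1
  simp [clausePos]
  omega

theorem word_clausePos {r : ℕ} (hr : r < F.length) : word F (clausePos F r) = F[r].length := by
  simpa [SAT.encodeClause] using word_clausePos_add F hr (Nat.zero_le _)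

theorem word_clausePos_add_succ {r : ℕ} (hr : r < F.length) {h : ℕ} (hh : h < F[r].length) :
    word F (clausePos F r + 1 + h) = SAT.encodeLiteral F[r][h] := by
  rw [add_assoc, add_comm 1 h, word_clausePos_add F hr (by omega), SAT.encodeClause,
    List.getD_cons_succ, List.getD_eq_getElem _ _ (by simpa using hh), List.getElem_map]

theorem clausePos_succ {r : ℕ} (hr : r < F.length) :
    clausePos F (r + 1) = clausePos F r + F[r].length + 1 := by
  rw [clausePos, List.take_add_one, List.getElem?_eq_getElem hr, Option.toList_some,
    List.flatMap_append, List.length_append, clausePos]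
  simp only [List.flatMap_cons, List.flatMap_nil, List.append_nil, SAT.encodeClause,
    List.length_cons, List.length_map]
  omega

/-- The position of a clause is found by reading the lengths of the clauses before it. -/
theorem iterIdx_clausePos {r : ℕ} (hr : r ≤ F.length) :
    iterIdx (fun _ y => y + word F y + 1) 2 r = clausePos F r := by
  induction r with
  | zero => simp [iterIdx, clausePos]
  | succ r ih => rw [iterIdx, ih (by omega), word_clausePos F hr, clausePos_succ F hr]

theorem eval_posEx_body (M ρ : ℕ → ℕ) (j y : ℕ) :
    (Ex.var 23 + .read (.var 23) + .lit 1).eval M (iterEnv ρ 11 j y) = y + M y + 1 := by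
  simp [iterEnv]

theorem eval_posEx (ρ : ℕ → ℕ) (a : Ex) (h : a.eval (word F) ρ ≤ F.length) :
    (posEx a).eval (word F) ρ = clausePos F (a.eval (word F) ρ) := by
  simp only [posEx, Ex.eval.eq_5, eval_posEx_body, eval_lit]
  exact iterIdx_clausePos F h

theorem eval_literalEx {ρ : ℕ → ℕ} (hr : ρ 15 < F.length) (hh : ρ 24 < F[ρ 15].length) :
    literalEx.eval (word F) ρ = SAT.encodeLiteral F[ρ 15][ρ 24] := by
  have h := eval_posEx F ρ (.var 15) hr.le
  simp only [literalEx, eval_read, eval_add, eval_lit, h]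
  exact word_clausePos_add_succ F hr hh

theorem eval_litSatEx {p : Params} {ρ : ℕ → ℕ} (h : Vals p ρ) (hr : ρ 15 < F.length)
    (hh : ρ 24 < F[ρ 15].length) :
    litSatEx.eval (word F) ρ = (litSat p.s (ρ 12) (ρ 13 % p.N) F[ρ 15][ρ 24]).toNat := by
  have h0 := eval_literalEx F hr hh
  set l := F[ρ 15][ρ 24]
  have hdiv : SAT.encodeLiteral l / 2 = l.1 := by
    rw [SAT.encodeLiteral]
    have := l.2.toNat_lt
    omega
  have hmod : SAT.encodeLiteral l % 2 = l.2.toNat := by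
    rw [SAT.encodeLiteral]
    have := l.2.toNat_lt
    omega
  simp only [litSatEx, litBitEx, litVarEx, eval_mul, eval_eqEx, eval_div, eval_modEx, eval_powEx,
    eval_lit, eval_var, h0, hdiv, hmod, h.s, h.N, litSat, Nat.testBit_eq_decide_div_mod_eq]
  rcases Nat.mod_two_eq_zero_or_one (ρ 13 % p.N / 2 ^ (l.1 % p.s)) with h2 | h2 <;>
    cases l.2 <;> by_cases h3 : (l.1 : ℕ) / p.s = ρ 12 <;> simp [h2, h3]

theorem iterIdx_congr {f g : ℕ → ℕ → ℕ} {a n : ℕ} (h : ∀ j < n, ∀ y, f j y = g j y) :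
    iterIdx f a n = iterIdx g a n := by
  induction n with
  | zero => rfl
  | succ n ih => rw [iterIdx, iterIdx, ih fun j hj => h j (by omega), h n (by omega)]

theorem iterIdx_countP {α : Type*} (l : List α) (f : α → Bool) (g : ℕ → ℕ)
    (hg : ∀ j (hj : j < l.length), g j = (f l[j]).toNat) {j : ℕ} (hj : j ≤ l.length) :
    iterIdx (fun j y => y + g j) 0 j = (l.take j).countP f := by
  induction j with
  | zero => rfl
  | succ j ih =>
    rw [iterIdx, ih (by omega), hg j (by omega), List.take_add_one,
      List.getElem?_eq_getElem (by omega), List.countP_append]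
    cases h : f l[j] <;> simp [h]

/-- The intermediate values in the evaluation of `countEx`. -/
theorem iterIdx_litSatEx {p : Params} {ρ : ℕ → ℕ} (h : Vals p ρ) (hr : ρ 15 < F.length) {j : ℕ}
    (hj : j ≤ F[ρ 15].length) :
    iterIdx (fun j y => (Ex.var 25 + litSatEx).eval (word F) (iterEnv ρ 12 j y)) 0 j =
      (F[ρ 15].take j).countP (litSat p.s (ρ 12) (ρ 13 % p.N)) := by
  have key : ∀ i (hi : i < F[ρ 15].length), ∀ y,
      (Ex.var 25 + litSatEx).eval (word F) (iterEnv ρ 12 i y) =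
        y + (litSat p.s (ρ 12) (ρ 13 % p.N) F[ρ 15][i]).toNat := by
    intro i hi y
    have hv : Vals p (iterEnv ρ 12 i y) := (h.update (by norm_num) i).update (by norm_num) y
    have h15 : iterEnv ρ 12 i y 15 = ρ 15 := by simp [iterEnv]
    have h24 : iterEnv ρ 12 i y 24 = i := by simp [iterEnv]
    have := eval_litSatEx F hv (by rw [h15]; exact hr) (by simp only [h15, h24]; exact hi)
    rw [eval_add, this]
    simp [iterEnv]
  rw [← iterIdx_countP F[ρ 15] _
    (fun i => if hi : i < F[ρ 15].length then (litSat p.s (ρ 12) (ρ 13 % p.N) F[ρ 15][i]).toNat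
      else 0) (fun i hi => dif_pos hi) hj]
  refine iterIdx_congr fun i hi y => ?_
  rw [key i (by omega), dif_pos (by omega)]

/-- The expression `satEx` tells whether the assignment `13` of group `12` satisfies clause `15`. -/
theorem satSpec {p : Params} (hm : p.m = F.length) :
    SatSpec p (word F) (groupSat F p.s) := by
  intro ρ h _ hr
  rw [hm] at hr
  have hlen : (Ex.read (posEx (.var 15))).eval (word F) ρ = F[ρ 15].length := by
    rw [eval_read, eval_posEx F ρ (.var 15) hr.le]
    exact word_clausePos F hr
  have hc : countEx.eval (word F) ρ = F[ρ 15].countP (litSat p.s (ρ 12) (ρ 13 % p.N)) := by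
    rw [countEx, Ex.eval, hlen]
    refine (iterIdx_litSatEx F h hr le_rfl).trans ?_
    rw [List.take_length]
  simp only [satEx, eval_sub, eval_lit, hc, groupSat, List.getD_eq_getElem _ _ hr]
  cases hany : F[ρ 15].any (litSat p.s (ρ 12) (ρ 13 % p.N)) with
  | true =>
    have : 0 < F[ρ 15].countP (litSat p.s (ρ 12) (ρ 13 % p.N)) := by
      rw [List.countP_pos_iff]
      simpa using hany
    simp; omega
  | false =>
    have : F[ρ 15].countP (litSat p.s (ρ 12) (ρ 13 % p.N)) = 0 := by
      rw [List.countP_eq_zero]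
      simpa using hany
    simp [this]

/-- An assignment of the variables is a tuple of assignments of the groups; their truth values are
the binary digits of numbers below `N`. -/
theorem satisfiable_iff {p : Params} (hk : 0 < p.k) (F : SAT.CNF p.n) (hm : p.m = F.length) :
    SAT.Satisfiable F ↔ ∃ v : ℕ → ℕ, (∀ i, v i < p.N) ∧
      ∀ r < p.m, ∃ i < p.k, groupSat F p.s i (v i) r = true := by
  have hs : ∀ x, x < p.n → 0 < p.s ∧ x / p.s < p.k := by
    intro x hx
    have hks : p.n ≤ p.k * p.s := by
      rw [Params.s]
      have := Nat.div_add_mod (p.n + p.k - 1) p.k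
      have := Nat.mod_lt (p.n + p.k - 1) hk
      omega
    have hs0 : 0 < p.s := by
      rcases Nat.eq_zero_or_pos p.s with h | h
      · rw [h] at hks; omega
      · exact h
    exact ⟨hs0, (Nat.div_lt_iff_lt_mul hs0).2 (by omega)⟩
  constructor
  · rintro ⟨a, ha⟩
    refine ⟨fun i => Nat.ofBits fun j : Fin p.s =>
      if h : i * p.s + j < p.n then a ⟨i * p.s + j, h⟩ else false,
      fun i => Nat.ofBits_lt_two_pow _, fun r hr => ?_⟩
    rw [hm] at hr
    obtain ⟨l, hl, hal⟩ := ha F[r] (List.getElem_mem hr)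
    obtain ⟨hs0, hlt⟩ := hs l.1 l.1.2
    refine ⟨_, hlt, ?_⟩
    rw [groupSat, List.getD_eq_getElem _ _ hr, List.any_eq_true]
    refine ⟨l, hl, ?_⟩
    have hx : l.1 / p.s * p.s + l.1 % p.s = l.1 := Nat.div_add_mod' _ _
    simp [litSat, Nat.testBit_ofBits_lt _ _ (Nat.mod_lt _ hs0), hx, hal]
  · rintro ⟨v, -, hv⟩
    refine ⟨fun x => (v (x / p.s)).testBit (x % p.s), fun c hc => ?_⟩
    obtain ⟨r, hr, rfl⟩ := List.getElem_of_mem hc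
    obtain ⟨i, -, hi⟩ := hv r (hm ▸ hr)
    rw [groupSat, List.getD_eq_getElem _ _ hr, List.any_eq_true] at hi
    obtain ⟨l, hl, h⟩ := hi
    simp only [litSat, Bool.and_eq_true, decide_eq_true_eq, beq_iff_eq] at h
    exact ⟨l, hl, by simpa only [h.1] using h.2⟩

end Word

end Red

end KLCS

namespace KLCS

open RAM

/-! ### The program stays within its bounds -/

namespace Params

/-- A bound on the number of input words of a formula with at most `q` literals per clause. -/
def size (p : Params) (q : ℕ) : ℕ := 2 + p.m * (q + 1)

/-- The address to which the input is moved. -/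
def base (p : Params) (q : ℕ) : ℕ := p.k * p.L + 1 + p.size q

/-- A bound on the lengths of all numbers that are handled. -/
def digits (p : Params) (q : ℕ) : ℕ :=
  p.n + p.k * p.W * (p.k * (p.k ^ 2 + 1)) + 2 * p.size q + 2 * p.k + q + 2

variable (p : Params) (q : ℕ)

theorem s_le (hk : 0 < p.k) : p.s ≤ p.n := by
  rw [s, Nat.div_le_iff_le_mul_add_pred hk]
  have := Nat.le_mul_of_pos_left p.n hk
  omega

theorem w_le_W : p.w ≤ p.W := by
  have : p.w ≤ (p.m + 1) * p.w := Nat.le_mul_of_pos_left _ (by omega)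
  rw [W]
  omega

theorem e_le_W : p.e ≤ p.W := by
  rw [W]
  omega

theorem N_mul_W_le_L (hk : 0 < p.k) : p.N * (p.k * p.W) ≤ p.L := by
  have : p.L = p.N * (p.k * p.W) * (p.k ^ 2 + 1) := by rw [L]; ring
  rw [this]
  exact Nat.le_mul_of_pos_right _ (by positivity)

theorem thr_le_L (hk : 0 < p.k) : p.thr ≤ p.L := by
  have h2 := sum_range_succ_mul_two p.k
  have h3 : ∑ i ∈ Finset.range p.k, (i + 1) * p.N = (∑ i ∈ Finset.range p.k, (i + 1)) * p.N :=
    (Finset.sum_mul _ _ _).symm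
  have h4 : (∑ i ∈ Finset.range p.k, (i + 1)) + 1 ≤ p.k * (p.k ^ 2 + 1) := by
    nlinarith [Nat.mul_le_mul hk hk, Nat.mul_le_mul (Nat.mul_le_mul hk hk) hk]
  calc p.thr ≤ p.N * p.W + p.W * ((∑ i ∈ Finset.range p.k, (i + 1)) * p.N) := by
        rw [thr, h3]
        have := Nat.mul_le_mul_left p.N p.e_le_W
        omega
    _ = p.N * p.W * ((∑ i ∈ Finset.range p.k, (i + 1)) + 1) := by ring
    _ ≤ p.L := Nat.mul_le_mul_left _ h4

/-- All addresses are below `base + size`, and all values of variables are at most `base`. The summands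
`n` and `Y` of `digits` account for the number of partial assignments and for the remaining factor of
the length of the strings, and `2 * size + 2` for the input. -/
theorem base_add_size_lt (hk : 0 < p.k) : p.base q + p.size q < 2 ^ p.digits q := by
  set Y := p.k * p.W * (p.k * (p.k ^ 2 + 1)) with hY
  have h1 : p.k * p.L ≤ 2 ^ p.n * 2 ^ Y := by
    calc p.k * p.L = p.N * Y := by rw [L, hY]; ring
      _ ≤ 2 ^ p.n * 2 ^ Y :=
        Nat.mul_le_mul (Nat.pow_le_pow_right (by norm_num) (p.s_le hk)) Nat.lt_two_pow_self.le
  have h2 : 1 ≤ 2 ^ p.n * 2 ^ Y := Nat.mul_pos (Nat.two_pow_pos _) (Nat.two_pow_pos _)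
  have h3 : 2 * p.size q + 2 < 2 ^ (2 * p.size q + 2) := Nat.lt_two_pow_self
  calc p.base q + p.size q = p.k * p.L + (1 + 2 * p.size q) := by rw [base]; ring
    _ ≤ 2 ^ p.n * 2 ^ Y * (2 * p.size q + 2) := by nlinarith
    _ < 2 ^ p.n * 2 ^ Y * 2 ^ (2 * p.size q + 2) := Nat.mul_lt_mul_of_pos_left h3 h2
    _ = 2 ^ (p.n + Y + (2 * p.size q + 2)) := by rw [pow_add 2 (p.n + Y), pow_add 2 p.n]
    _ ≤ 2 ^ p.digits q := Nat.pow_le_pow_right (by norm_num) (by rw [digits]; omega)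

theorem k_mul_W_le (hk : 0 < p.k) : p.k * p.W ≤ p.digits q := by
  have : p.k * p.W ≤ p.k * p.W * (p.k * (p.k ^ 2 + 1)) :=
    Nat.le_mul_of_pos_right _ (by positivity)
  rw [digits]
  omega

theorem W_le (hk : 0 < p.k) : p.W ≤ p.digits q :=
  (Nat.le_mul_of_pos_left _ hk).trans (p.k_mul_W_le q hk)

theorem m_le_size : p.m ≤ p.size q := by
  have : p.m ≤ p.m * (q + 1) := Nat.le_mul_of_pos_right _ (by omega)
  rw [size]
  omega

end Params

namespace Red

section Ok

variable (M : ℕ → ℕ) (Z : ℕ) (ρ : ℕ → ℕ) (a b : Ex)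

@[simp] theorem ok_add : (a + b).Ok M Z ρ ↔ a.Ok M Z ρ ∧ b.Ok M Z ρ := Iff.rfl
@[simp] theorem ok_sub : (a - b).Ok M Z ρ ↔ a.Ok M Z ρ ∧ b.Ok M Z ρ := Iff.rfl
@[simp] theorem ok_mul : (a * b).Ok M Z ρ ↔ a.Ok M Z ρ ∧ b.Ok M Z ρ := Iff.rfl
@[simp] theorem ok_div : (a / b).Ok M Z ρ ↔ a.Ok M Z ρ ∧ b.Ok M Z ρ := Iff.rfl
@[simp] theorem ok_lit (c : ℕ) : (Ex.lit c).Ok M Z ρ := trivial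
@[simp] theorem ok_var (x : ℕ) : (Ex.var x).Ok M Z ρ := trivial
@[simp] theorem ok_read : (Ex.read a).Ok M Z ρ ↔ a.Ok M Z ρ := Iff.rfl

variable {M Z ρ a b}

theorem ok_powEx (ha : a.Ok M Z ρ) (h : a.eval M ρ < Z) : (powEx a).Ok M Z ρ := by
  refine ⟨ha, ok_lit _ _ _ _, h.le, fun j hj => ?_, fun _ _ => by simp⟩
  simp only [eval_powEx_body, eval_lit]
  rw [iterIdx_double]
  exact Nat.pow_lt_pow_right (by norm_num) (by omega)

theorem ok_eqEx (ha : a.Ok M Z ρ) (hb : b.Ok M Z ρ) : (eqEx a b).Ok M Z ρ := by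
  simp [eqEx, ha, hb]

theorem ok_modEx (ha : a.Ok M Z ρ) (hb : b.Ok M Z ρ) : (modEx a b).Ok M Z ρ := by
  simp [modEx, ha, hb]

end Ok

section Formula

variable {n q : ℕ} {F : SAT.CNF n}

theorem length_flatMap_encodeClause_le (G : SAT.CNF n) (h : SAT.HasWidth q G) :
    (G.flatMap SAT.encodeClause).length ≤ G.length * (q + 1) := by
  rw [List.length_flatMap]
  refine (List.sum_le_card_nsmul _ (q + 1) fun a ha => ?_).trans (by simp)
  obtain ⟨c, hc, rfl⟩ := List.mem_map.1 ha
  simpa [SAT.encodeClause] using h c hc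

theorem length_encode_le (h : SAT.HasWidth q F) :
    (SAT.encode F).length ≤ 2 + F.length * (q + 1) := by
  have := length_flatMap_encodeClause_le F h
  simp only [SAT.encode, List.length_cons]
  omega

theorem clausePos_le (h : SAT.HasWidth q F) {r : ℕ} (hr : r ≤ F.length) :
    clausePos F r ≤ 2 + F.length * (q + 1) := by
  have := length_flatMap_encodeClause_le (F.take r) fun c hc => h c (List.mem_of_mem_take hc)
  have := Nat.mul_le_mul_right (q + 1) hr
  rw [List.length_take, min_eq_left hr] at *
  rw [clausePos]
  omega

variable {p : Params} {Z : ℕ} {ρ : ℕ → ℕ}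

theorem ok_posEx (h : SAT.HasWidth q F) (hZ : 2 + F.length * (q + 1) ≤ Z) {a : Ex}
    (ha : a.Ok (word F) Z ρ) (har : a.eval (word F) ρ ≤ F.length) :
    (posEx a).Ok (word F) Z ρ := by
  have hF : F.length ≤ F.length * (q + 1) := Nat.le_mul_of_pos_right _ (by omega)
  refine ⟨ha, ok_lit _ _ _ _, by omega, fun j hj => ?_, fun _ _ => by simp⟩
  simp only [eval_posEx_body, eval_lit]
  rw [iterIdx_clausePos F (by omega)]
  exact ((clausePos_le h (by omega)).trans hZ).trans_lt Nat.lt_two_pow_self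

theorem ok_literalEx (h : SAT.HasWidth q F) (hZ : 2 + F.length * (q + 1) ≤ Z)
    (hr : ρ 15 < F.length) : literalEx.Ok (word F) Z ρ := by
  have := ok_posEx (ρ := ρ) h hZ (a := .var 15) (ok_var _ _ _ _) hr.le
  simp [literalEx, this]

theorem ok_litSatEx (h : SAT.HasWidth q F) (hZ : 2 + F.length * (q + 1) ≤ Z) (hn : n ≤ Z)
    (hr : ρ 15 < F.length) (hh : ρ 24 < F[ρ 15].length) :
    litSatEx.Ok (word F) Z ρ := by
  have h1 := ok_literalEx h hZ hr
  have h2 : litVarEx.Ok (word F) Z ρ := by simp [litVarEx, h1]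
  have h3 : (modEx litVarEx (.var 2)).Ok (word F) Z ρ := ok_modEx h2 (ok_var _ _ _ _)
  have h4 : (powEx (modEx litVarEx (.var 2))).Ok (word F) Z ρ := by
    refine ok_powEx h3 ?_
    have hlit := eval_literalEx F hr hh
    have hx := F[ρ 15][ρ 24].1.2
    have hb := F[ρ 15][ρ 24].2.toNat_lt
    rw [SAT.encodeLiteral] at hlit
    rw [eval_modEx]
    refine (Nat.mod_le _ _).trans_lt ?_
    rw [litVarEx, eval_div, eval_lit, hlit]
    omega
  have h5 : litBitEx.Ok (word F) Z ρ := by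
    refine ok_modEx ?_ (ok_lit _ _ _ _)
    rw [ok_div]
    exact ⟨ok_modEx (ok_var _ _ _ _) (ok_var _ _ _ _), h4⟩
  rw [litSatEx, ok_mul]
  exact ⟨ok_eqEx (by simp [h2]) (ok_var _ _ _ _), ok_eqEx h5 (ok_modEx h1 (ok_lit _ _ _ _))⟩

theorem ok_satEx (h : SAT.HasWidth q F) (hZ : 2 + F.length * (q + 1) ≤ Z) (hn : n ≤ Z) (hq : q ≤ Z)
    (hv : Vals p ρ) (hr : ρ 15 < F.length) : satEx.Ok (word F) Z ρ := by
  have hpos := ok_posEx (ρ := ρ) h hZ (a := .var 15) (ok_var _ _ _ _) hr.le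
  have hlen : (Ex.read (posEx (.var 15))).eval (word F) ρ = F[ρ 15].length := by
    rw [eval_read, eval_posEx F ρ (.var 15) hr.le]
    exact word_clausePos F hr
  have hw : F[ρ 15].length ≤ q := h _ (List.getElem_mem hr)
  have hcount : countEx.Ok (word F) Z ρ := by
    refine ⟨hpos, ok_lit _ _ _ _, by rw [hlen]; omega, fun j hj => ?_, fun j hj => ?_⟩
    · rw [hlen] at hj
      rw [eval_lit, iterIdx_litSatEx F hv hr hj]
      refine List.countP_le_length.trans_lt (lt_of_le_of_lt ?_ Nat.lt_two_pow_self)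
      rw [List.length_take]
      omega
    · rw [hlen] at hj
      rw [ok_add]
      refine ⟨ok_var _ _ _ _, ?_⟩
      generalize iterIdx _ _ _ = y
      have h15 : iterEnv ρ 12 j y 15 = ρ 15 := by simp [iterEnv]
      have h24 : iterEnv ρ 12 j y 24 = j := by simp [iterEnv]
      exact ok_litSatEx h hZ hn (by rw [h15]; exact hr) (by simp only [h15, h24]; exact hj)
  simp [satEx, hcount]

end Formula

end Red

end KLCS

namespace KLCS

open RAM

namespace Red

theorem weight_le (k W x : ℕ) : weight k W x ≤ k * W :=
  Nat.mul_le_mul_right _ (by omega)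

theorem ok_repGen {M ρ : ℕ → ℕ} {Z X : ℕ} {big : Bool} {n a : Ex} (hn : n.Ok M Z ρ)
    (h : n.eval M ρ ≤ if big then X else Z) (ha : ∀ j, a.Ok M Z (Function.update ρ 17 j)) :
    (repGen big n a).Ok M Z X ρ :=
  ⟨hn, h, fun j _ => ha j⟩

/-! The loops marked as long are the repetitions at the ends of the strings, the loop over the gadgets
of a string, and the loop for the filling letters. They are bounded by `base`, which exceeds the
length of a string; all other loops are bounded by `digits`. -/

section Gen

variable {p : Params} {q : ℕ} {F : SAT.CNF p.n} {M ρ : ℕ → ℕ}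

theorem two_mul_k_le_digits : 2 * p.k ≤ p.digits q := by
  rw [Params.digits]
  omega

theorem ok_frontGen (hk : 0 < p.k) (hv : Vals p ρ) :
    (frontGen p.k).Ok M (p.digits q) (p.base q) ρ := by
  have hkZ := two_mul_k_le_digits (p := p) (q := q)
  refine ⟨by simp, ?_, fun x _ => ok_repGen (by simp [weightEx]) ?_ fun _ => ok_var _ _ _ _⟩
  · simp only [eval_sub, eval_lit, eval_var, Bool.false_eq_true, if_false]
    omega
  · have hv' := hv.update (x := 14) (by norm_num) x
    rw [eval_mul, eval_weightEx hv', eval_var, hv'.N, if_pos rfl]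
    refine (Nat.mul_le_mul_left _ (weight_le _ _ _)).trans ((p.N_mul_W_le_L hk).trans ?_)
    have := Nat.le_mul_of_pos_left p.L hk
    rw [Params.base]
    omega

theorem ok_backGen (hk : 0 < p.k) (hv : Vals p ρ) :
    (backGen p.k).Ok M (p.digits q) (p.base q) ρ := by
  have hkZ := two_mul_k_le_digits (p := p) (q := q)
  refine ⟨by simp, ?_, fun x _ => ok_repGen (by simp [weightEx, backLetterEx]) ?_
    fun _ => by simp [backLetterEx]⟩
  · simp only [eval_sub, eval_lit, eval_var, Bool.false_eq_true, if_false]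
    omega
  · have hv' := hv.update (x := 14) (by norm_num) x
    rw [eval_mul, eval_weightEx hv', eval_var, hv'.N, if_pos rfl]
    refine (Nat.mul_le_mul_left _ (weight_le _ _ _)).trans ((p.N_mul_W_le_L hk).trans ?_)
    have := Nat.le_mul_of_pos_left p.L hk
    rw [Params.base]
    omega

theorem ok_sepGen (hk : 0 < p.k) (hv : Vals p ρ) (hi : ρ 12 < p.k) :
    (sepGen p.k).Ok M (p.digits q) (p.base q) ρ := by
  have hkZ := two_mul_k_le_digits (p := p) (q := q)
  refine ⟨by simp, ?_, fun x _ => ok_repGen (by simp [weightEx, sepLetterEx]) ?_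
    fun _ => by simp [sepLetterEx]⟩
  · simp only [eval_add, eval_mul, eval_lit, eval_var, Bool.false_eq_true, if_false]
    omega
  · rw [eval_weightEx (hv.update (x := 14) (by norm_num) x)]
    exact (weight_le _ _ _).trans (p.k_mul_W_le q hk)

theorem ok_clauseGen (h : SAT.HasWidth q F) (hm : p.m = F.length) (hv : Vals p ρ)
    (hr : ρ 15 < p.m) : (clauseGen p.k).Ok (word F) (p.digits q) (p.base q) ρ := by
  have hkZ := two_mul_k_le_digits (p := p) (q := q)
  refine ⟨by simp, ?_, fun x _ => ?_⟩
  · simp only [eval_lit, Bool.false_eq_true, if_false]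
    omega
  · have hsat : satEx.Ok (word F) (p.digits q) (Function.update ρ 16 x) := by
      refine ok_satEx h ?_ ?_ ?_ (hv.update (by norm_num) x) (by simpa [hm] using hr)
      · rw [← hm, Params.digits, Params.size]; omega
      · rw [Params.digits]; omega
      · rw [Params.digits]; omega
    have hno : (letterNoEx p.k).Ok (word F) (p.digits q) (Function.update ρ 16 x) := by
      simp [letterNoEx]
    have hrep : (replacedEx p.k).Ok (word F) (p.digits q) (Function.update ρ 16 x) := by
      rw [replacedEx, ok_mul]
      exact ⟨ok_eqEx hno (ok_var _ _ _ _), by simp [hsat]⟩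
    change (letterEx p.k).Ok _ _ _
    simp [letterEx, hrep, hno]

theorem ok_gadgetGen (h : SAT.HasWidth q F) (hm : p.m = F.length) (hk : 0 < p.k) (hv : Vals p ρ) :
    (gadgetGen p.k).Ok (word F) (p.digits q) (p.base q) ρ := by
  have hWZ := p.W_le q hk
  have heZ := p.e_le_W.trans hWZ
  have hwZ := p.w_le_W.trans hWZ
  have he : ∀ x, (1 - x) * p.e ≤ p.digits q := fun x =>
    (Nat.mul_le_mul_right _ (Nat.sub_le 1 x)).trans (by omega)
  have hw : ∀ ρ, Vals p ρ → (repGen false (.var 4) (.lit (4 * p.k))).Ok (word F) (p.digits q)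
      (p.base q) ρ := fun ρ hv =>
    ok_repGen (ok_var _ _ _ _) (by simpa [hv.w] using hwZ) fun _ => ok_lit _ _ _ _
  refine ⟨ok_repGen (by simp) ?_ fun _ => ok_lit _ _ _ _, ⟨hw ρ hv, ok_var _ _ _ _, ?_,
    fun r hr => ⟨ok_clauseGen h hm (hv.update (by norm_num) r) ?_, hw _ (hv.update (by norm_num) r)⟩⟩,
    ok_repGen (by simp) ?_ fun _ => ok_lit _ _ _ _⟩
  · simpa [hv.e] using he (ρ 12)
  · have := p.m_le_size q
    simp only [eval_var, hv.m, Bool.false_eq_true, if_false, Params.digits]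
    omega
  · simpa [hv.m] using hr
  · simpa [hv.e] using he (1 - ρ 12)

theorem ok_inputGen (h : SAT.HasWidth q F) (hm : p.m = F.length) (hk : 0 < p.k) (hv : Vals p ρ) :
    (inputGen p.k).Ok (word F) (p.digits q) (p.base q) ρ := by
  have hkZ := two_mul_k_le_digits (p := p) (q := q)
  have hL : p.L ≤ p.base q := by
    have := Nat.le_mul_of_pos_left p.L hk
    rw [Params.base]
    omega
  refine ⟨ok_var _ _ _ _, ok_lit _ _ _ _, ?_, fun i hi => ?_⟩
  · simp only [eval_lit, Bool.false_eq_true, if_false]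
    omega
  have hv' := hv.update (x := 12) (by norm_num) i
  have hi' : Function.update ρ 12 i 12 < p.k := by simpa using hi
  generalize Function.update ρ 12 i = ρ' at *
  refine ⟨⟨⟨ok_frontGen hk hv', by simp, ?_, fun t _ => ?_⟩, ok_backGen hk hv'⟩,
    ok_repGen (by simp [textLengthEx]) ?_ fun _ => by simp⟩
  · simp only [eval_add, eval_mul, eval_lit, eval_var, hv'.N, if_true]
    refine le_trans ?_ ((p.N_mul_W_le_L hk).trans hL)
    rw [mul_comm]
    exact Nat.mul_le_mul_left _ (hi'.trans_le (Nat.le_mul_of_pos_right _ p.W_pos))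
  · have hv'' := hv'.update (x := 13) (by norm_num) t
    exact ⟨ok_sepGen hk hv'' (by simpa using hi'), ok_gadgetGen h hm hk hv''⟩
  · simp only [eval_sub, eval_var, hv'.L, if_true]
    omega

end Gen

/-- The environment after the computation of the parameters. -/
def inputEnv {n : ℕ} (k q : ℕ) (F : SAT.CNF n) : ℕ → ℕ :=
  paramEnv (word F) (paramList k q) fun _ => 0

section Env

variable {n : ℕ} (k q : ℕ) (F : SAT.CNF n)

theorem word_zero : word F 0 = n := rfl

theorem word_one : word F 1 = F.length := rfl


variable {k}

theorem s_eq {m : ℕ} (hk : 0 < k) : (n + (k - 1)) / k = Params.s ⟨k, n, m⟩ := by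
  rw [Params.s]
  congr 1
  simp only
  omega

theorem inputEnv_spec (hk : 0 < k) :
    Vals ⟨k, n, F.length⟩ (inputEnv k q F) ∧
      inputEnv k q F 8 = Params.base ⟨k, n, F.length⟩ q ∧
      inputEnv k q F 9 = Params.size ⟨k, n, F.length⟩ q ∧
      inputEnv k q F 10 = Params.thr ⟨k, n, F.length⟩ := by
  have hs := s_eq (n := n) (m := F.length) hk
  have hthr : Params.thr ⟨k, n, F.length⟩ = 2 ^ Params.s ⟨k, n, F.length⟩ *
      Params.e ⟨k, n, F.length⟩ + Params.W ⟨k, n, F.length⟩ *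
        ((∑ i ∈ Finset.range k, (i + 1)) * 2 ^ Params.s ⟨k, n, F.length⟩) := by
    rw [Finset.sum_mul]
    rfl
  rw [hthr]
  simp only [inputEnv, paramEnv, paramList, eval_powEx, eval_add, eval_sub, eval_mul, eval_div,
    eval_lit, eval_var, eval_read, Function.update_self, ne_eq, Function.update_of_ne,
    not_false_eq_true, Nat.reduceEqDiff, zero_ne_one, OfNat.one_ne_ofNat, word_zero, word_one, hs]
  refine ⟨⟨?_, ?_, ?_, ?_, ?_, ?_, ?_⟩, ?_, ?_, ?_⟩ <;> rfl

/-- All parameters have at most `digits` binary digits. -/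
theorem paramsOk (hk : 0 < k) :
    ParamsOk (word F) (Params.digits ⟨k, n, F.length⟩ q) (paramList k q) fun _ => 0 := by
  have hs := s_eq (n := n) (m := F.length) hk
  have hthr : 2 ^ Params.s ⟨k, n, F.length⟩ *
      Params.e ⟨k, n, F.length⟩ + Params.W ⟨k, n, F.length⟩ *
        ((∑ i ∈ Finset.range k, (i + 1)) * 2 ^ Params.s ⟨k, n, F.length⟩) =
          Params.thr ⟨k, n, F.length⟩ := by
    rw [Finset.sum_mul]
    rfl
  set p : Params := ⟨k, n, F.length⟩ with hp
  have hlt : ∀ x, x ≤ p.digits q → x < 2 ^ p.digits q := fun x hx => hx.trans_lt Nat.lt_two_pow_self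
  have hbase := p.base_add_size_lt q hk
  have hkL := Nat.le_mul_of_pos_left p.L hk
  have hL : p.L < 2 ^ p.digits q := by
    rw [Params.base] at hbase
    change p.L ≤ p.k * p.L at hkL
    omega
  have hsn : p.s < p.digits q := by
    have := p.s_le hk
    rw [Params.digits]
    omega
  have hW := p.W_le q hk
  refine ⟨by simp, ?_, by simp, ?_, by simp, ?_, ok_powEx (by simp) ?_, ?_, by simp, ?_, by simp, ?_,
    by simp, ?_, by simp, ?_, by simp, ?_, by simp, ?_, by simp, ?_, trivial⟩
  all_goals simp only [eval_powEx, eval_add, eval_sub, eval_mul, eval_div,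
    eval_lit, eval_var, eval_read, Function.update_self, ne_eq, Function.update_of_ne,
    not_false_eq_true, Nat.reduceEqDiff, zero_ne_one, OfNat.one_ne_ofNat, word_zero, word_one, hs]
  · refine hlt _ ?_
    change p.n ≤ _
    rw [Params.digits]
    omega
  · refine hlt _ ?_
    have := p.m_le_size q
    change p.m ≤ _
    rw [Params.digits]
    omega
  · exact hlt _ hsn.le
  · exact hsn
  · exact Nat.pow_lt_pow_right (by norm_num) hsn
  · exact hlt _ (p.w_le_W.trans hW)
  · exact hlt _ (p.e_le_W.trans hW)
  · exact hlt _ hW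
  · exact hL
  · refine hlt _ ?_
    change p.size q ≤ _
    rw [Params.digits]
    omega
  · change p.base q < _
    omega
  · exact hthr ▸ (p.thr_le_L hk).trans_lt hL

theorem word_lt (h : SAT.HasWidth q F) (a : ℕ) :
    word F a < 2 ^ Params.digits ⟨k, n, F.length⟩ q := by
  set p : Params := ⟨k, n, F.length⟩ with hp
  have hlt : ∀ x, x ≤ p.digits q → x < 2 ^ p.digits q := fun x hx => hx.trans_lt Nat.lt_two_pow_self
  have hn : n ≤ p.digits q := by
    change p.n ≤ _
    rw [Params.digits]
    omega
  rw [word]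
  by_cases ha : a < (SAT.encode F).length
  · rw [List.getD_eq_getElem _ _ ha]
    have hmem := List.getElem_mem ha
    generalize (SAT.encode F)[a] = x at hmem
    simp only [SAT.encode, List.mem_cons, List.mem_flatMap, SAT.encodeClause, List.mem_map] at hmem
    rcases hmem with rfl | rfl | ⟨c, hc, rfl | ⟨l, -, rfl⟩⟩
    · exact hlt _ hn
    · refine hlt _ ?_
      have := p.m_le_size q
      change p.m ≤ _
      rw [Params.digits]
      omega
    · refine hlt _ ((h c hc).trans ?_)
      rw [Params.digits]
      omega
    · have h1 := l.1.2
      have h2 := l.2.toNat_lt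
      have h3 : n < 2 ^ n := Nat.lt_two_pow_self
      have h4 : 2 ^ (n + 1) ≤ 2 ^ p.digits q := by
        refine Nat.pow_le_pow_right (by norm_num) ?_
        change p.n + 1 ≤ _
        rw [Params.digits]
        omega
      rw [pow_succ] at h4
      rw [SAT.encodeLiteral]
      omega
  · rw [List.getD_eq_default _ _ (by omega)]
    exact Nat.two_pow_pos _

theorem den_input (hk : 0 < k) :
    (inputGen k).den (word F) (inputEnv k q F) = Params.L ⟨k, n, F.length⟩ ::
      (List.range k).flatMap (Params.string ⟨k, n, F.length⟩
        (groupSat F (Params.s ⟨k, n, F.length⟩))) :=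
  den_inputGen (p := ⟨k, n, F.length⟩) (inputEnv_spec q F hk).1
    (satSpec F (p := ⟨k, n, F.length⟩) rfl)

/-- The reduction stays within its bounds on formulas with at most `q` literals per clause. -/
theorem valid_reduction (hk : 0 < k) (h : SAT.HasWidth q F) :
    (reduction k q).Valid (SAT.encode F) (Params.digits ⟨k, n, F.length⟩ q)
      (Params.base ⟨k, n, F.length⟩ q) (inputEnv k q F) := by
  obtain ⟨hv, h8, h9, -⟩ := inputEnv_spec q F hk
  have hden : ((inputGen k).den (word F) (inputEnv k q F)).length ≤
      Params.base ⟨k, n, F.length⟩ q := by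
    rw [den_input q F hk, List.length_cons, length_flatMap_range, Finset.sum_congr rfl fun i hi =>
      Params.length_string (p := ⟨k, n, F.length⟩) (Finset.mem_range.1 hi)]
    rw [Params.base, Finset.sum_const, Finset.card_range, smul_eq_mul]
    omega
  have hgen := ok_inputGen (p := ⟨k, n, F.length⟩) h rfl hk hv
  have hpar := paramsOk q F hk
  have hword := word_lt (k := k) q F h
  have hb := Params.base_add_size_lt ⟨k, n, F.length⟩ q hk
  have hsb : Params.size ⟨k, n, F.length⟩ q ≤ Params.base ⟨k, n, F.length⟩ q := by
    rw [Params.base]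
    omega
  have hsZ : Params.size ⟨k, n, F.length⟩ q ≤ Params.digits ⟨k, n, F.length⟩ q := by
    rw [Params.digits]
    omega
  have hlen : (SAT.encode F).length ≤ Params.size ⟨k, n, F.length⟩ q := length_encode_le h
  rw [← h8, ← h9] at *
  generalize Params.digits ⟨k, n, F.length⟩ q = Z at *
  exact
    { env := rfl
      input_lt := hword
      params_ok := hpar
      gen_ok := hgen
      X_lt := by omega
      size_le := hsZ
      length_le := hlen
      size_le_base := hsb
      base_lt := hb
      den_le := hden }

end Env

end Red

end KLCS

namespace RAM

/-! ### The time is polynomial in the number of digits -/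

/-- The function `f` is bounded by a polynomial in `u`. -/
def PolyBounded {ι : Type*} (u f : ι → ℕ) : Prop := ∃ A D, ∀ x, f x ≤ A * (u x + 1) ^ D

namespace PolyBounded

variable {ι : Type*} {u f g : ι → ℕ}

theorem mono (hg : PolyBounded u g) (h : ∀ x, f x ≤ g x) : PolyBounded u f := by
  obtain ⟨A, D, hA⟩ := hg
  exact ⟨A, D, fun x => (h x).trans (hA x)⟩

theorem const (c : ℕ) : PolyBounded u fun _ => c := ⟨c, 0, fun _ => by simp⟩

theorem self : PolyBounded u u := ⟨1, 1, fun _ => by simp⟩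

theorem add (hf : PolyBounded u f) (hg : PolyBounded u g) : PolyBounded u fun x => f x + g x := by
  obtain ⟨A, D, hA⟩ := hf
  obtain ⟨B, E, hB⟩ := hg
  refine ⟨A + B, D + E, fun x => ?_⟩
  have h1 : (u x + 1) ^ D ≤ (u x + 1) ^ (D + E) := Nat.pow_le_pow_right (by omega) (by omega)
  have h2 : (u x + 1) ^ E ≤ (u x + 1) ^ (D + E) := Nat.pow_le_pow_right (by omega) (by omega)
  calc f x + g x ≤ A * (u x + 1) ^ D + B * (u x + 1) ^ E := add_le_add (hA x) (hB x)
    _ ≤ A * (u x + 1) ^ (D + E) + B * (u x + 1) ^ (D + E) := by gcongr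
    _ = _ := by ring

theorem mul (hf : PolyBounded u f) (hg : PolyBounded u g) : PolyBounded u fun x => f x * g x := by
  obtain ⟨A, D, hA⟩ := hf
  obtain ⟨B, E, hB⟩ := hg
  refine ⟨A * B, D + E, fun x => ?_⟩
  calc f x * g x ≤ A * (u x + 1) ^ D * (B * (u x + 1) ^ E) := Nat.mul_le_mul (hA x) (hB x)
    _ = _ := by ring

theorem pow (hf : PolyBounded u f) (d : ℕ) : PolyBounded u fun x => f x ^ d := by
  induction d with
  | zero => simpa using const 1
  | succ d ih => simpa [pow_succ] using ih.mul hf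

theorem comp {h : ℕ → ℕ} (hh : PolyBounded id h) (hf : PolyBounded u f) :
    PolyBounded u fun x => h (f x) := by
  obtain ⟨A, D, hA⟩ := hh
  exact ((const A).mul ((hf.add (const 1)).pow D)).mono fun x => hA (f x)

end PolyBounded

open PolyBounded

theorem Ex.polyBounded_bits (e : Ex) : PolyBounded id fun Z => e.bits Z := by
  induction e with
  | lit c => exact .const _
  | var x => exact .self
  | op o a b iha ihb => exact (iha.add ihb).add (.const 1)
  | read a => exact .self
  | iter x n a e => exact .self

theorem Ex.polyBounded_cost (e : Ex) : PolyBounded id fun Z => e.cost Z := by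
  have hid : PolyBounded id fun Z : ℕ => Z := .self
  induction e with
  | lit c => exact .const _
  | var x => exact hid.add (.const 2)
  | op o a b iha ihb =>
    exact iha.add (ihb.add ((a.polyBounded_bits.add b.polyBounded_bits).add (.const 2)))
  | read a iha =>
    exact iha.add (((a.polyBounded_bits.add hid).add (.const 2)).add
      (((a.polyBounded_bits.add hid).add (.const 1)).add (hid.add (.const 2))))
  | iter x n a e ihn iha ihe =>
    exact ((((ihn.add iha).add a.polyBounded_bits).add ((PolyBounded.const 7).mul
      (hid.add (.const 2)))).add (.const 4)).add
      (hid.mul (ihe.add ((PolyBounded.const 4).mul (hid.add (.const 3)))))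

/-- The depth to which long loops are nested. -/
def Gen.depth : Gen → ℕ
  | emit _ => 0
  | seq g h => max g.depth h.depth
  | loop big _ _ g => g.depth + big.toNat

theorem Gen.exists_cost_le (g : Gen) :
    ∃ f : ℕ → ℕ, PolyBounded id f ∧ ∀ Z X, g.cost Z X ≤ f Z * (X + 1) ^ g.depth := by
  have hid : PolyBounded id fun Z : ℕ => Z := .self
  induction g with
  | emit e =>
    refine ⟨fun Z => e.cost Z + ((Z + e.bits Z + 2) + (Z + 1 + 2)), ?_, fun Z X => by
      simp [Gen.cost, Gen.depth]⟩
    exact e.polyBounded_cost.add (((hid.add e.polyBounded_bits).add (.const 2)).add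
      ((hid.add (.const 1)).add (.const 2)))
  | seq g h ihg ihh =>
    obtain ⟨f₁, hf₁, h₁⟩ := ihg
    obtain ⟨f₂, hf₂, h₂⟩ := ihh
    refine ⟨_, hf₁.add hf₂, fun Z X => ?_⟩
    have e1 : (X + 1) ^ g.depth ≤ (X + 1) ^ max g.depth h.depth :=
      Nat.pow_le_pow_right (by omega) (le_max_left _ _)
    have e2 : (X + 1) ^ h.depth ≤ (X + 1) ^ max g.depth h.depth :=
      Nat.pow_le_pow_right (by omega) (le_max_right _ _)
    rw [Gen.depth, add_mul]
    exact add_le_add ((h₁ Z X).trans (Nat.mul_le_mul_left _ e1))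
      ((h₂ Z X).trans (Nat.mul_le_mul_left _ e2))
  | loop big x n g ih =>
    obtain ⟨f, hf, h⟩ := ih
    refine ⟨_, n.polyBounded_cost.add ((((PolyBounded.const 3).mul (hid.add (.const 2))).add
      (.const 1)).add ((hid.add (.const 1)).mul (hf.add ((PolyBounded.const 3).mul
        (hid.add (.const 3)))))), fun Z X => ?_⟩
    have h1 : (if big then X else Z) ≤ (Z + 1) * (X + 1) ^ big.toNat := by
      cases big
      · simp
      · simp only [if_true, Bool.toNat_true, pow_one]
        nlinarith
    have hpos : 1 ≤ (X + 1) ^ g.depth := Nat.pos_of_ne_zero (by positivity)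
    have hpos' : 1 ≤ (X + 1) ^ (g.depth + big.toNat) := Nat.pos_of_ne_zero (by positivity)
    have h2 : g.cost Z X + 3 * (Z + 3) ≤ (f Z + 3 * (Z + 3)) * (X + 1) ^ g.depth := by
      rw [add_mul]
      exact add_le_add (h Z X) (Nat.le_mul_of_pos_right _ hpos)
    have h3 := Nat.mul_le_mul h1 h2
    have h4 : (Z + 1) * (X + 1) ^ big.toNat * ((f Z + 3 * (Z + 3)) * (X + 1) ^ g.depth) =
        (Z + 1) * (f Z + 3 * (Z + 3)) * (X + 1) ^ (g.depth + big.toNat) := by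
      rw [pow_add]
      ring
    rw [h4] at h3
    have h5 := Nat.le_mul_of_pos_right (n.cost Z + (3 * (Z + 2) + 1)) hpos'
    simp only [Gen.cost, Gen.depth]
    calc _ = (n.cost Z + (3 * (Z + 2) + 1)) + (if big then X else Z) *
          (g.cost Z X + 3 * (Z + 3)) := by ring
      _ ≤ _ := add_le_add h5 h3
      _ = _ := by ring

theorem polyBounded_paramsCost (l : List (ℕ × Ex)) : PolyBounded id fun Z => paramsCost Z l := by
  have hid : PolyBounded id fun Z : ℕ => Z := .self
  induction l with
  | nil => exact .const 1
  | cons a l ih => exact a.2.polyBounded_cost.add ((hid.add (.const 2)).add ih)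

/-- A reduction whose long loops are not nested takes time linear in the number of their rounds. -/
theorem Reduction.exists_cost_le (r : Reduction) (h : r.gen.depth ≤ 1) :
    ∃ f : ℕ → ℕ, PolyBounded id f ∧ ∀ Z X, r.cost Z X ≤ f Z * (X + 1) := by
  have hid : PolyBounded id fun Z : ℕ => Z := .self
  obtain ⟨f, hf, hg⟩ := r.gen.exists_cost_le
  have hZ : ∀ c, PolyBounded id fun Z : ℕ => c * (Z + 2) := fun c =>
    (PolyBounded.const c).mul (hid.add (.const 2))
  refine ⟨_, ((((polyBounded_paramsCost r.params).add (hid.mul (hZ 14))).add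
    (hid.mul (hZ 7))).add (hZ 20)).add hf, fun Z X => ?_⟩
  have h1 : r.gen.cost Z X ≤ f Z * (X + 1) := (hg Z X).trans
    (Nat.mul_le_mul_left _ ((Nat.pow_le_pow_right (by omega) h).trans_eq (pow_one _)))
  have h2 := Nat.le_mul_of_pos_right (paramsCost Z r.params + Z * (14 * (Z + 2)) +
    Z * (7 * (Z + 2)) + 20 * (Z + 2)) (show 0 < X + 1 by omega)
  rw [Reduction.cost, add_mul]
  omega

end RAM

namespace KLCS

open RAM

/-! ### Deciding satisfiability -/

namespace Params

/-- The length of the strings divided by the number of partial assignments. -/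
def unitLength (p : Params) : ℕ := p.W * (p.k * (p.k ^ 2 + 1))

theorem L_eq (p : Params) : p.L = p.N * p.unitLength := by
  rw [L, unitLength]
  ring

theorem unitLength_pos (p : Params) (hk : 0 < p.k) : 0 < p.unitLength :=
  Nat.mul_pos p.W_pos (by positivity)

theorem N_le (p : Params) (hk : 0 < p.k) : (p.N : ℝ) ≤ (2 : ℝ) ^ ((p.n : ℝ) / p.k) * 2 := by
  have hk' : (0 : ℝ) < p.k := by exact_mod_cast hk
  have hs : (p.s : ℝ) ≤ (p.n : ℝ) / p.k + 1 := by
    have h : p.k * p.s ≤ p.n + p.k := by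
      have := Nat.mul_div_le (p.n + p.k - 1) p.k
      rw [s]
      omega
    have h' : (p.k : ℝ) * p.s ≤ p.n + p.k := by exact_mod_cast h
    rw [div_add_one hk'.ne', le_div_iff₀ hk']
    linarith
  calc (p.N : ℝ) = (2 : ℝ) ^ (p.s : ℝ) := by rw [N, Real.rpow_natCast]; push_cast; rfl
    _ ≤ (2 : ℝ) ^ ((p.n : ℝ) / p.k + 1) := Real.rpow_le_rpow_of_exponent_le (by norm_num) hs
    _ = _ := by rw [Real.rpow_add (by norm_num), Real.rpow_one]

/-- The sum of the number of variables and the number of clauses. -/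
def formulaSize (x : ℕ × ℕ) : ℕ := x.1 + x.2

section Poly

variable (k q : ℕ)

theorem polyBounded_m : PolyBounded formulaSize fun x => x.2 :=
  PolyBounded.self.mono fun x => by rw [formulaSize]; omega

theorem polyBounded_n : PolyBounded formulaSize fun x => x.1 :=
  PolyBounded.self.mono fun x => by rw [formulaSize]; omega

theorem polyBounded_size : PolyBounded formulaSize fun x => size ⟨k, x.1, x.2⟩ q :=
  (PolyBounded.const 2).add (polyBounded_m.mul (.const (q + 1)))

theorem polyBounded_W : PolyBounded formulaSize fun x => W ⟨k, x.1, x.2⟩ := by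
  have hm := polyBounded_m
  have hw : PolyBounded formulaSize fun x => w ⟨k, x.1, x.2⟩ :=
    ((PolyBounded.const k).mul hm).add (.const 1)
  have hmw : PolyBounded formulaSize fun x => (x.2 + 1) * w ⟨k, x.1, x.2⟩ :=
    (hm.add (.const 1)).mul hw
  exact (((hmw.add hm).mono fun x => Nat.sub_le _ 1).add hmw).add (hm.mul (.const k))

theorem polyBounded_unitLength : PolyBounded formulaSize fun x => unitLength ⟨k, x.1, x.2⟩ :=
  (polyBounded_W k).mul (.const (k * (k ^ 2 + 1)))

theorem polyBounded_digits : PolyBounded formulaSize fun x => digits ⟨k, x.1, x.2⟩ q :=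
  (((((polyBounded_n.add (((PolyBounded.const k).mul (polyBounded_W k)).mul (.const (k * (k ^ 2 + 1))))).add
    ((PolyBounded.const 2).mul (polyBounded_size k q))).add (.const (2 * k))).add
      (.const q)).add (.const 2))

end Poly

end Params

namespace Red

/-- The reduction decides satisfiability: the strings have a common subsequence longer than the
threshold if and only if the formula is satisfiable. -/
theorem halts_reduction {k n q : ℕ} {F : SAT.CNF n} (hk : 2 ≤ k) (h : SAT.HasWidth q F)
    {P : Prog} {τ : ℕ → ℝ}
    (hP : ∀ x : Fin k → Fin (Params.L ⟨k, n, F.length⟩) → Fin (5 * k), ∃ out t : ℕ,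
      HaltsWith P (encode x) out t ∧ IsLCSLength x out ∧
        (t : ℝ) ≤ τ (Params.L ⟨k, n, F.length⟩)) [Decidable (SAT.Satisfiable F)] :
    ∃ t, HaltsWith ((reduction k q).prog P) (SAT.encode F) (if SAT.Satisfiable F then 1 else 0) t ∧
      (t : ℝ) ≤ τ (Params.L ⟨k, n, F.length⟩) + ((reduction k q).cost
        (Params.digits ⟨k, n, F.length⟩ q) (Params.base ⟨k, n, F.length⟩ q) : ℕ) := by
  have hk0 : 0 < k := by omega
  have hvalid := valid_reduction q F hk0 h
  have hden := den_input q F hk0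
  have hthr := (inputEnv_spec q F hk0).2.2.2
  have hsat := satisfiable_iff (p := ⟨k, n, F.length⟩) hk0 F rfl
  set p : Params := ⟨k, n, F.length⟩ with hp
  obtain ⟨x, hx, hlcs⟩ := exists_instance (σ := 5 * k) hk0
    (X := p.string (groupSat F p.s)) (fun i hi => Params.length_string (p := p) hi)
    fun i hi a ha => Params.lt_of_mem_string (p := p) hk hi ha
  obtain ⟨out, t, hhalt, hout, ht⟩ := hP x
  obtain ⟨⟨z, hz, hzx⟩, hmax⟩ := hlcs out hout
  have hiff : SAT.Satisfiable F ↔ p.thr < out := by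
    rw [hsat]
    constructor
    · intro hv
      obtain ⟨y, hy, hyx⟩ := Params.exists_length_eq (p := p) hk hv
      have := hmax y hyx
      omega
    · intro hlt
      by_contra hv
      have := Params.length_le_thr (p := p) hk hv hzx
      omega
  have hL : p.L < 2 ^ p.digits q := by
    have h1 := p.base_add_size_lt q hk0
    have h2 := Nat.le_mul_of_pos_left p.L hk0
    change p.L ≤ p.k * p.L at h2
    rw [Params.base] at h1
    omega
  have hout_lt : out < 2 ^ p.digits q := by
    have := (hzx 0 hk0).length_le
    rw [Params.length_string (p := p) hk0] at this
    omega
  rw [hx, ← hden] at hhalt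
  obtain ⟨t', ht', hle⟩ := Reduction.halts hvalid hhalt hout_lt
    (hthr.trans_lt ((p.thr_le_L hk0).trans_lt hL))
  have hthr' : inputEnv k q F (reduction k q).thr = p.thr := hthr
  rw [hthr'] at ht'
  simp only [← hiff] at ht'
  refine ⟨t', ht', ?_⟩
  have : (t' : ℝ) ≤ t + ((reduction k q).cost (p.digits q) (p.base q) : ℕ) := by exact_mod_cast hle
  linarith

theorem depth_reduction (k q : ℕ) : (reduction k q).gen.depth ≤ 1 := le_of_eq rfl

/-- The time for the reduction is `2 ^ (n / k)` up to a polynomial factor. -/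
theorem cost_reduction_le {k : ℕ} (hk : 0 < k) (q : ℕ) : ∃ A D : ℕ, ∀ n m : ℕ,
    (((reduction k q).cost (Params.digits ⟨k, n, m⟩ q) (Params.base ⟨k, n, m⟩ q) : ℕ) : ℝ) ≤
      A * (2 : ℝ) ^ ((n : ℝ) / k) * ((n : ℝ) + m + 1) ^ D := by
  obtain ⟨f, hf, hcost⟩ := (reduction k q).exists_cost_le (depth_reduction k q)
  obtain ⟨A, D, hA⟩ := (hf.comp (Params.polyBounded_digits k q)).mul
    (((PolyBounded.const k).mul (Params.polyBounded_unitLength k)).add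
      ((PolyBounded.const 2).add (Params.polyBounded_size k q)))
  refine ⟨2 * A, D, fun n m => ?_⟩
  set p : Params := ⟨k, n, m⟩ with hp
  have hN := p.N_le hk
  have hbase : p.base q + 1 ≤ p.N * (k * p.unitLength + (2 + p.size q)) := by
    have h1 : p.k * p.L = p.N * (k * p.unitLength) := by
      rw [p.L_eq]
      change k * _ = _
      ring
    have h2 := Nat.le_mul_of_pos_left (2 + p.size q) p.N_pos
    rw [Params.base, h1, mul_add]
    omega
  have h1 : (reduction k q).cost (p.digits q) (p.base q) ≤ p.N * (A * (n + m + 1) ^ D) := by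
    calc _ ≤ f (p.digits q) * (p.base q + 1) := hcost _ _
      _ ≤ f (p.digits q) * (p.N * (k * p.unitLength + (2 + p.size q))) :=
        Nat.mul_le_mul_left _ hbase
      _ = p.N * (f (p.digits q) * (k * p.unitLength + (2 + p.size q))) := by ring
      _ ≤ _ := Nat.mul_le_mul_left _ (hA (n, m))
  calc _ ≤ ((p.N * (A * (n + m + 1) ^ D) : ℕ) : ℝ) := by exact_mod_cast h1
    _ = (p.N : ℝ) * (A * ((n : ℝ) + m + 1) ^ D) := by push_cast; ring
    _ ≤ (2 : ℝ) ^ ((p.n : ℝ) / p.k) * 2 * (A * ((n : ℝ) + m + 1) ^ D) :=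
      mul_le_mul_of_nonneg_right hN (by positivity)
    _ = _ := by push_cast; ring

/-- The time of an algorithm for `k`-LCS with exponent `k - ε`, on strings of length `L`. -/
theorem rpow_L_le {k : ℕ} (hk : 0 < k) {ε δ : ℝ} (hδ : k * δ ≤ ε) (hδ0 : 0 ≤ δ) (hδ1 : δ ≤ 1) :
    ∃ A D : ℕ, ∀ n m : ℕ, (Params.L ⟨k, n, m⟩ : ℝ) ^ ((k : ℝ) - ε) ≤
      A * (2 : ℝ) ^ ((1 - δ) * n) * ((n : ℝ) + m + 1) ^ D := by
  obtain ⟨A, D, hA⟩ := ((PolyBounded.const 2).mul (Params.polyBounded_unitLength k)).pow k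
  have hk' : (0 : ℝ) < k := by exact_mod_cast hk
  refine ⟨A, D, fun n m => ?_⟩
  set p : Params := ⟨k, n, m⟩ with hp
  have hN := p.N_le hk
  have hV : 0 < p.unitLength := p.unitLength_pos hk
  have hL : (1 : ℝ) ≤ p.L := by
    rw [p.L_eq]
    exact_mod_cast Nat.mul_pos p.N_pos hV
  have hV1 : (1 : ℝ) ≤ 2 * p.unitLength := by
    have : (1 : ℝ) ≤ p.unitLength := by exact_mod_cast hV
    linarith
  have hexp : (0 : ℝ) ≤ k * (1 - δ) := mul_nonneg hk'.le (by linarith)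
  have hpoly : (2 * (p.unitLength : ℝ)) ^ k ≤ A * ((n : ℝ) + m + 1) ^ D := by
    exact_mod_cast hA (n, m)
  calc (p.L : ℝ) ^ ((k : ℝ) - ε) ≤ (p.L : ℝ) ^ (k * (1 - δ)) :=
        Real.rpow_le_rpow_of_exponent_le hL (by linarith)
    _ ≤ ((2 : ℝ) ^ ((n : ℝ) / k) * (2 * p.unitLength)) ^ (k * (1 - δ)) := by
      refine Real.rpow_le_rpow (by positivity) ?_ hexp
      rw [p.L_eq, Nat.cast_mul]
      calc (p.N : ℝ) * p.unitLength ≤ (2 : ℝ) ^ ((p.n : ℝ) / p.k) * 2 * p.unitLength :=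
            mul_le_mul_of_nonneg_right hN (by positivity)
        _ = _ := by ring
    _ = (2 : ℝ) ^ ((1 - δ) * n) * (2 * (p.unitLength : ℝ)) ^ (k * (1 - δ)) := by
      rw [Real.mul_rpow (by positivity) (by positivity), ← Real.rpow_mul (by norm_num)]
      congr 2
      field_simp
    _ ≤ (2 : ℝ) ^ ((1 - δ) * n) * (2 * (p.unitLength : ℝ)) ^ (k : ℝ) := by
      refine mul_le_mul_of_nonneg_left (Real.rpow_le_rpow_of_exponent_le hV1 ?_) (by positivity)
      nlinarith
    _ ≤ (2 : ℝ) ^ ((1 - δ) * n) * (A * ((n : ℝ) + m + 1) ^ D) := by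
      rw [Real.rpow_natCast]
      exact mul_le_mul_of_nonneg_left hpoly (by positivity)
    _ = _ := by ring

/-- A fast algorithm for `k`-LCS gives a fast algorithm for `q`-SAT. -/
theorem solvableInTime {k : ℕ} (hk : 2 ≤ k) {ε δ : ℝ} (hδ : k * δ ≤ ε) (hδ0 : 0 ≤ δ)
    (hδ2 : δ ≤ 1 / 2) (h : SolvableInTime k (5 * k) ((k : ℝ) - ε)) (q : ℕ) :
    SAT.SolvableInTime q (1 - δ) := by
  obtain ⟨P, C, hP⟩ := h
  have hk0 : 0 < k := by omega
  obtain ⟨A, D, hA⟩ := cost_reduction_le hk0 q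
  obtain ⟨B, E, hB⟩ := rpow_L_le hk0 hδ hδ0 (by linarith)
  refine ⟨(reduction k q).prog P, |C| * B + A, E + D, fun n F hF => ?_⟩
  classical
  have hLpos : 1 ≤ Params.L ⟨k, n, F.length⟩ := by
    rw [Params.L_eq]
    exact Nat.mul_pos (Params.N_pos _) (Params.unitLength_pos _ hk0)
  obtain ⟨t, ht, hle⟩ := halts_reduction (q := q) (τ := fun L => C * (L : ℝ) ^ ((k : ℝ) - ε)) hk hF
    (hP _ hLpos)
  refine ⟨t, by convert ht, hle.trans ?_⟩
  set T : ℝ := (2 : ℝ) ^ ((1 - δ) * n)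
  set U : ℝ := (n : ℝ) + F.length + 1
  have hU : 1 ≤ U := by
    have : (0 : ℝ) ≤ (n : ℝ) + F.length := by positivity
    simp only [U]
    linarith
  have hT : (2 : ℝ) ^ ((n : ℝ) / k) ≤ T := by
    refine Real.rpow_le_rpow_of_exponent_le (by norm_num) ?_
    have hk2 : (2 : ℝ) ≤ k := by exact_mod_cast hk
    have hn : (0 : ℝ) ≤ n := by positivity
    calc (n : ℝ) / k ≤ n / 2 := div_le_div_of_nonneg_left hn (by norm_num) hk2
      _ ≤ (1 - δ) * n := by nlinarith
  have hT0 : 0 ≤ T := by positivity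
  have hUE : U ^ E ≤ U ^ (E + D) := pow_le_pow_right₀ hU (by omega)
  have hUD : U ^ D ≤ U ^ (E + D) := pow_le_pow_right₀ hU (by omega)
  have hmain : C * (Params.L ⟨k, n, F.length⟩ : ℝ) ^ ((k : ℝ) - ε) ≤ |C| * (B * T * U ^ (E + D)) :=
    calc _ ≤ |C| * (Params.L ⟨k, n, F.length⟩ : ℝ) ^ ((k : ℝ) - ε) :=
          mul_le_mul_of_nonneg_right (le_abs_self C) (by positivity)
      _ ≤ |C| * (B * T * U ^ E) := mul_le_mul_of_nonneg_left (hB n F.length) (abs_nonneg C)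
      _ ≤ _ := by gcongr
  have hcost : ((reduction k q).cost (Params.digits ⟨k, n, F.length⟩ q)
      (Params.base ⟨k, n, F.length⟩ q) : ℝ) ≤ A * T * U ^ (E + D) := by
    refine (hA n F.length).trans ?_
    gcongr
  calc _ ≤ |C| * (B * T * U ^ (E + D)) + A * T * U ^ (E + D) := add_le_add hmain hcost
    _ = _ := by ring

end Red

end KLCS

/-- There is an absolute constant `c` such that an `O(n ^ (k - ε))` time algorithm for `k`-LCS over
an alphabet of size `c * k`, for some `k ≥ 2` and some `ε > 0`, refutes SETH. -/
theorem theorem2 :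
    ∃ c : ℕ, ∀ (k : ℕ), 2 ≤ k → ∀ (ε : ℝ), 0 < ε →
      KLCS.SolvableInTime k (c * k) ((k : ℝ) - ε) → ¬ SAT.SETH := by
  -- The letters of the strings are less than `4 * k + 2`.
  refine ⟨5, fun k hk ε hε h hSETH => ?_⟩
  have hk' : (0 : ℝ) < k := by
    have : 0 < k := by omega
    exact_mod_cast this
  -- The bound `1 / 2` makes the time `2 ^ (n / k)` for writing the strings affordable.
  obtain ⟨q, -, hq⟩ := hSETH (min (1 / 2) (ε / k)) (lt_min (by norm_num) (by positivity))
  refine hq (KLCS.Red.solvableInTime hk ?_ (le_min (by norm_num) (by positivity))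
    (min_le_left _ _) h q)
  calc (k : ℝ) * min (1 / 2) (ε / k) ≤ k * (ε / k) :=
        mul_le_mul_of_nonneg_left (min_le_right _ _) hk'.le
    _ = ε := mul_div_cancel₀ _ hk'.ne'
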